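/- Let $\nu\in(-\frac{\pi}{4},\frac{\pi}{4})$, $\theta\in\mathbb R$, and work in $L^2(\mathbb R^2)$ with inner product $\langle f,g\rangle=\int\overline f\,g$. Let $x_j$ be multiplication by the $j$-th coordinate, $p_j=-i\,\partial_{x_j}$, $\hat x_1=x_1-\frac\theta2p_2$, $\hat x_2=x_2+\frac\theta2p_1$, $\hat p_j=p_j$, acting on Schwartz functions, and put $$A_1=\tfrac1{\sqrt2}\left(\hat x_1e^{i\nu}+\tfrac\theta2\hat p_2e^{i\nu}+i\hat p_1e^{-i\nu}\right),\qquad A_2=\tfrac1{\sqrt2}\left(\hat x_2e^{i\nu}-\tfrac\theta2\hat p_1e^{i\nu}+i\hat p_2e^{-i\nu}\right),$$ $$B_1=\tfrac1{\sqrt2}\left(\hat x_1e^{i\nu}+\tfrac\theta2\hat p_2e^{i\nu}-i\hat p_1e^{-i\nu}\right),\qquad B_2=\tfrac1{\sqrt2}\left(\hat x_2e^{i\nu}-\tfrac\theta2\hat p_1e^{i\nu}-i\hat p_2e^{-i\nu}\right),$$ $$H_{\nu,\theta}=\tfrac1{\cos2\nu}(B_1A_1+B_2A_2+1),\qquad a_j=\tfrac1{\sqrt2}(x_j+ip_j),\qquad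 h_\nu=\tfrac1{\cos2\nu}(a_1^\dagger a_1+a_2^\dagger a_2+1).$$ Let $\varphi_{0,0}=N_1e^{-\frac12e^{2i\nu}(x_1^2+x_2^2)}$, $\Psi_{0,0}=N_2e^{-\frac12e^{-2i\nu}(x_1^2+x_2^2)}$, $e_{0,0}=\pi^{-1/2}e^{-\frac12(x_1^2+x_2^2)}$, where $N_1,N_2\in\mathbb C$ satisfy $\overline{N_1}N_2=e^{-2i\nu}/\pi$ (so that $\langle\varphi_{0,0},\Psi_{0,0}\rangle=1$), and for $n=(n_1,n_2)\in\mathbb N^2$ $$\varphi_n=\frac{B_1^{n_1}B_2^{n_2}\varphi_{0,0}}{\sqrt{n_1!\,n_2!}},\qquad \Psi_n=\frac{(A_1^\dagger)^{n_1}(A_2^\dagger)^{n_2}\Psi_{0,0}}{\sqrt{n_1!\,n_2!}},\qquad e_n=\frac{(a_1^\dagger)^{n_1}(a_2^\dagger)^{n_2}e_{0,0}}{\sqrt{n_1!\,n_2!}} .$$ Let $\mathcal D_e$ and $\mathcal D_\varphi$ be the linear spans of the $e_n$ and of the $\varphi_n$. Let $G=\frac12\sum_{j}(x_j\partial_{x_j}+\partial_{x_j}x_j)$,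 the generator of the unitary group $(e^{sG}f)(x)=e^{s}f(e^{s}x)$, $s\in\mathbb R$. Let $T_\nu=e^{i\nu G}$ be the unbounded operator whose domain consists of all $f$ for which $s\mapsto e^{sG}f$ extends to a function $F$ that is bounded and continuous on the closed strip between $\operatorname{Im}z=0$ and $\operatorname{Im}z=\nu$ and holomorphic inside, with $T_\nu f=F(i\nu)$. Finally let $\Theta=\frac1{\pi|N_1|^2}T_\nu^{-2}$. Compositions and inverses of unbounded operators have their natural domains, and $^\dagger$ of an unbounded operator is its Hilbert-space adjoint. Then the following hold. 1. If $\nu\ne0$, then $\|\varphi_n\|\to\infty$ and $\|\Psi_n\|\to\infty$ as $n$ leaves every finite subset of $\mathbb N^2$. Neither $(\varphi_n)$ nor $(\Psi_n)$ is a Riesz basis, and neither is a (Schauder) basis, for any enumeration of $\mathbb N^2$. 2. $(e_n)$ is orthonormal, $\mathcal D_e$ is dense, and $(\varphi_n)$, $(\Psi_n)$ are $\mathcal D_e$-quasi bases: $\langle\varphi_m,\Psi_n\rangle=\delta_{m,n}$, and for all $f,g\in\mathcal D_e$ $$\langle f,g\rangle=\sum_{n}\langle f,\varphi_n\rangle\langle\Psi_n,g\rangle=\sum_{n}\langle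 f,\Psi_n\rangle\langle\varphi_n,g\rangle,$$ both series converging unconditionally. (The Schwartz operators $A_j^\dagger$ used to build $\Psi_n$ are restrictions of the Hilbert-space adjoints of the $A_j$.) 3. For Schwartz $u$, $\frac{d}{ds}\big|_{s=0}e^{sG}u=Gu$ in $L^2$. $T_\nu$ is self-adjoint and injective, with densely defined inverse. There are constants $c,c'\neq0$ with $T_\nu e_n=c\,\varphi_n$ and $(T_\nu^{-1})^\dagger e_n=c'\,\Psi_n$ for all $n$. If $\nu\ne0$, both $T_\nu$ and $T_\nu^{-1}$ are unbounded and not everywhere defined. 4. $\Theta$ is a metric operator: it is self-adjoint, strictly positive and injective; $\Theta\varphi_n=\Psi_n$ for all $n$; $\mathcal D_\varphi$ is dense; and $\Theta H_{\nu,\theta}f=H_{\nu,\theta}^\dagger\Theta f$ for all $f\in\mathcal D_\varphi$. If $\nu\neq0$, both $\Theta$ and $\Theta^{-1}$ are unbounded. For $j=1,2$ the pair $(A_j,B_j^\dagger)$ is $\Theta$-conjugate: $A_jf=\Theta^{-1}B_j^\dagger\Theta f$ for all $f\in\mathcal D_\varphi$, and also for all $f$ in some dense subspace that $\Theta,\Theta^{-1},A_j,B_j,A_j^\dagger,B_j^\dagger$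 ($j=1,2$) all map into itself. 5. $H_{\nu,\theta}$ is similar to a self-adjoint oscillator Hamiltonian: $h_\nu$ is essentially self-adjoint on the Schwartz functions, and $h_\nu f=T_\nu^{-1}H_{\nu,\theta}T_\nu f$ for all $f\in\mathcal D_e$. -/

import Mathlib

open MeasureTheory Filter Topology
open scoped SchwartzMap LineDeriv InnerProductSpace

noncomputable section

namespace Swanson

/-- The plane. -/
abbrev Plane := EuclideanSpace ℝ (Fin 2)

/-- The Hilbert space of square-integrable complex functions on the plane (Lebesgue measure). The
inner product `inner ℂ f g` is conjugate-linear in `f`. -/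
abbrev L2 := Lp ℂ 2 (volume : Measure Plane)

/-- Continuous linear operators on the Schwartz space of the plane. -/
abbrev SOp := 𝓢(Plane, ℂ) →L[ℂ] 𝓢(Plane, ℂ)

/-- The class in `L2` of a Schwartz function. -/
def toL2 : 𝓢(Plane, ℂ) →L[ℂ] L2 := SchwartzMap.toLpCLM ℂ ℂ 2 volume

/-! ### Position, momentum and the ladder operators -/

/-- Multiplication by the coordinate `x_j`. -/
def X (j : Fin 2) : SOp := SchwartzMap.smulLeftCLM ℂ (fun x : Plane => ((x j : ℝ) : ℂ))

/-- The partial derivative `d/dx_j`. -/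
def D (j : Fin 2) : SOp :=
  LineDeriv.lineDerivOpCLM ℂ 𝓢(Plane, ℂ) (EuclideanSpace.single j (1 : ℝ))

/-- The momentum `p_j = -i d/dx_j`. -/
def P (j : Fin 2) : SOp := (-Complex.I) • D j

theorem X_apply (j : Fin 2) (f : 𝓢(Plane, ℂ)) (x : Plane) : X j f x = (x j : ℂ) * f x := by
  have h : (fun x : Plane => ((x j : ℝ) : ℂ)).HasTemperateGrowth :=
    (Complex.ofRealCLM.comp (EuclideanSpace.proj (𝕜 := ℝ) j)).hasTemperateGrowth
  simp [X, SchwartzMap.smulLeftCLM_apply_apply h]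

theorem D_apply (j : Fin 2) (f : 𝓢(Plane, ℂ)) (x : Plane) :
    D j f x = lineDeriv ℝ f x (EuclideanSpace.single j (1 : ℝ)) :=
  SchwartzMap.lineDerivOp_apply _ f x

/-- The non-commuting coordinates, realised by the Bopp shift:
`x̂₁ = x₁ - (θ/2) p₂`, `x̂₂ = x₂ + (θ/2) p₁`. -/
def Xhat (θ : ℝ) : Fin 2 → SOp :=
  ![X 0 - ((θ / 2 : ℝ) : ℂ) • P 1, X 1 + ((θ / 2 : ℝ) : ℂ) • P 0]

/-- The momenta `p̂_j = p_j`. -/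
def Phat : Fin 2 → SOp := P

/-- The phase `e^{iν}`. -/
def phase (ν : ℝ) : ℂ := Complex.exp (Complex.I * ν)

/-- `1 / √2` -/
def rsqrtTwo : ℂ := ((1 / Real.sqrt 2 : ℝ) : ℂ)

/-- The commuting combinations `x̂₁ + (θ/2) p̂₂` and `x̂₂ - (θ/2) p̂₁`. -/
def Xshift (θ : ℝ) : Fin 2 → SOp :=
  ![Xhat θ 0 + ((θ / 2 : ℝ) : ℂ) • Phat 1, Xhat θ 1 - ((θ / 2 : ℝ) : ℂ) • Phat 0]

/-- The pseudo-bosonic lowering operators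
`A₁ = (x̂₁ e^{iν} + (θ/2) p̂₂ e^{iν} + i p̂₁ e^{-iν}) / √2`,
`A₂ = (x̂₂ e^{iν} - (θ/2) p̂₁ e^{iν} + i p̂₂ e^{-iν}) / √2`. -/
def A (ν θ : ℝ) (j : Fin 2) : SOp :=
  rsqrtTwo • (phase ν • Xshift θ j + (Complex.I * phase (-ν)) • Phat j)

/-- The pseudo-bosonic raising operators: as `A`, with `- i p̂_j e^{-iν}`. -/
def B (ν θ : ℝ) (j : Fin 2) : SOp :=
  rsqrtTwo • (phase ν • Xshift θ j - (Complex.I * phase (-ν)) • Phat j)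

/-- The adjoint `A_j†` on Schwartz functions: the coefficients of `A_j` are conjugated, and
`x̂_j`, `p̂_j` are symmetric. -/
def Adag (ν θ : ℝ) (j : Fin 2) : SOp :=
  rsqrtTwo • (phase (-ν) • Xshift θ j - (Complex.I * phase ν) • Phat j)

/-- The Hamiltonian `H_{ν,θ} = (B₁A₁ + B₂A₂ + 1) / cos 2ν` on Schwartz functions. -/
def H (ν θ : ℝ) : SOp :=
  ((1 / Real.cos (2 * ν) : ℝ) : ℂ) •
    (B ν θ 0 ∘L A ν θ 0 + B ν θ 1 ∘L A ν θ 1 + ContinuousLinearMap.id ℂ _)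

/-- The bosonic lowering operators `a_j = (x_j + i p_j) / √2`. -/
def a (j : Fin 2) : SOp := rsqrtTwo • (X j + Complex.I • P j)

/-- The bosonic raising operators `a_j† = (x_j - i p_j) / √2`. -/
def adag (j : Fin 2) : SOp := rsqrtTwo • (X j - Complex.I • P j)

/-- The oscillator Hamiltonian `h = (a₁†a₁ + a₂†a₂ + 1) / cos 2ν` on Schwartz functions. -/
def h (ν : ℝ) : SOp :=
  ((1 / Real.cos (2 * ν) : ℝ) : ℂ) •
    (adag 0 ∘L a 0 + adag 1 ∘L a 1 + ContinuousLinearMap.id ℂ _)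

/-! ### Gaussians and the families of vectors -/

theorem norm_iteratedFDeriv_cexp_le (n : ℕ) :
    ∃ K : ℝ, 0 ≤ K ∧ ∀ w : ℂ, ‖iteratedFDeriv ℝ n Complex.exp w‖ ≤ K * ‖Complex.exp w‖ := by
  induction n with
  | zero => exact ⟨1, zero_le_one, fun w => by simp⟩
  | succ n ih =>
    obtain ⟨K, hK, hb⟩ := ih
    let L : ℂ →L[ℝ] (ℂ →L[ℝ] ℂ) := ContinuousLinearMap.mul ℝ ℂ
    have hd : fderiv ℝ Complex.exp = L ∘ Complex.exp := by
      funext w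
      have := ((Complex.hasDerivAt_exp w).hasFDerivAt.restrictScalars ℝ).fderiv
      rw [this]
      ext
      simp [L, mul_comm]
    refine ⟨‖L‖ * K, by positivity, fun w => ?_⟩
    rw [← norm_iteratedFDeriv_fderiv, hd]
    have hc : ContDiff ℝ n Complex.exp := Complex.contDiff_exp
    calc _ ≤ ‖L‖ * ‖iteratedFDeriv ℝ n Complex.exp w‖ :=
          L.norm_iteratedFDeriv_comp_left hc.contDiffAt le_rfl
      _ ≤ ‖L‖ * (K * ‖Complex.exp w‖) := by gcongr; exact hb w
      _ = _ := by ring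

theorem gaussian_exponent_hasTemperateGrowth (c : ℂ) :
    (fun x : Plane => -c * ((‖x‖ ^ 2 : ℝ) : ℂ)).HasTemperateGrowth := by
  have h1 : (fun x : Plane => ‖x‖ ^ 2).HasTemperateGrowth :=
    Function.hasTemperateGrowth_norm_sq Plane
  exact (Function.HasTemperateGrowth.const (-c)).mul
    (Function.Complex.hasTemperateGrowth_ofReal.comp h1)

theorem one_add_pow_mul_exp_le (b : ℝ) (hb : 0 < b) (m : ℕ) :
    ∃ C : ℝ, ∀ r : ℝ, 0 ≤ r → (1 + r) ^ m * Real.exp (-b * r ^ 2) ≤ C := by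
  refine ⟨2 ^ m * ((m.factorial : ℝ) * Real.exp b / b ^ m), fun r hr => ?_⟩
  have h1 : (1 + r) ^ m ≤ 2 ^ m * (1 + r ^ 2) ^ m := by
    rw [← mul_pow]
    gcongr
    nlinarith [sq_nonneg (r - 1)]
  have h2 : (b * (1 + r ^ 2)) ^ m / (m.factorial : ℝ) ≤ Real.exp (b * (1 + r ^ 2)) :=
    Real.pow_div_factorial_le_exp _ (by positivity) m
  have h3 : (1 + r ^ 2) ^ m ≤ (m.factorial : ℝ) / b ^ m * Real.exp (b * (1 + r ^ 2)) := by
    rw [div_le_iff₀ (by positivity), mul_pow] at h2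
    rw [div_mul_eq_mul_div, le_div_iff₀ (by positivity)]
    nlinarith
  calc (1 + r) ^ m * Real.exp (-b * r ^ 2)
      ≤ (2 ^ m * ((m.factorial : ℝ) / b ^ m * Real.exp (b * (1 + r ^ 2)))) *
          Real.exp (-b * r ^ 2) := by
        gcongr
        exact h1.trans (by gcongr)
    _ = 2 ^ m * ((m.factorial : ℝ) / b ^ m *
          (Real.exp (b * (1 + r ^ 2)) * Real.exp (-b * r ^ 2))) := by ring
    _ = 2 ^ m * ((m.factorial : ℝ) * Real.exp b / b ^ m) := by
        rw [← Real.exp_add]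
        ring_nf

theorem gaussian_decay (c : ℂ) (hc : 0 < c.re) (k n : ℕ) :
    ∃ C : ℝ, ∀ x : Plane, ‖x‖ ^ k *
      ‖iteratedFDeriv ℝ n (fun x : Plane => Complex.exp (-c * ((‖x‖ ^ 2 : ℝ) : ℂ))) x‖ ≤ C := by
  have hq := gaussian_exponent_hasTemperateGrowth c
  obtain ⟨l, C₀, hC₀, hl⟩ := hq.norm_iteratedFDeriv_le_uniform n
  choose K hK0 hK using norm_iteratedFDeriv_cexp_le
  obtain ⟨M, hM⟩ := one_add_pow_mul_exp_le c.re hc (k + l * n)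
  let S : ℝ := ∑ i ∈ Finset.range (n + 1), K i
  have hS0 : 0 ≤ S := Finset.sum_nonneg fun i _ => hK0 i
  refine ⟨n.factorial * S * (C₀ + 1) ^ n * M, fun x => ?_⟩
  have hx : 0 ≤ ‖x‖ := norm_nonneg x
  have hre : ‖Complex.exp (-c * ((‖x‖ ^ 2 : ℝ) : ℂ))‖ = Real.exp (-c.re * ‖x‖ ^ 2) := by
    rw [Complex.norm_exp, Complex.re_mul_ofReal]
    simp
  have hcomp := norm_iteratedFDeriv_comp_le (𝕜 := ℝ) (g := Complex.exp)
    (f := fun x : Plane => -c * ((‖x‖ ^ 2 : ℝ) : ℂ)) (n := n) (N := n)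
    Complex.contDiff_exp (hq.1.of_le (by exact_mod_cast le_top)) le_rfl x
    (C := S * Real.exp (-c.re * ‖x‖ ^ 2)) (D := (C₀ + 1) * (1 + ‖x‖) ^ l)
    (fun i hi => by
      refine (hK i _).trans ?_
      rw [hre]
      gcongr
      exact Finset.single_le_sum (f := K) (fun i _ => hK0 i)
        (Finset.mem_range.2 (Nat.lt_succ_of_le hi)))
    (fun i hi1 hi => by
      have h1 : (1 : ℝ) ≤ (C₀ + 1) * (1 + ‖x‖) ^ l :=
        one_le_mul_of_one_le_of_one_le (by linarith) (one_le_pow₀ (by linarith))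
      calc _ ≤ C₀ * (1 + ‖x‖) ^ l := hl i hi x
        _ ≤ (C₀ + 1) * (1 + ‖x‖) ^ l := by gcongr; linarith
        _ ≤ _ := le_self_pow₀ h1 (by omega))
  have hcomp' : ‖iteratedFDeriv ℝ n
      (fun x : Plane => Complex.exp (-c * ((‖x‖ ^ 2 : ℝ) : ℂ))) x‖ ≤
      n.factorial * (S * Real.exp (-c.re * ‖x‖ ^ 2)) * ((C₀ + 1) * (1 + ‖x‖) ^ l) ^ n := hcomp
  calc _ ≤ (1 + ‖x‖) ^ k * (n.factorial * (S * Real.exp (-c.re * ‖x‖ ^ 2)) *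
        ((C₀ + 1) * (1 + ‖x‖) ^ l) ^ n) := by
        gcongr
        linarith
    _ = n.factorial * S * (C₀ + 1) ^ n *
        ((1 + ‖x‖) ^ (k + l * n) * Real.exp (-c.re * ‖x‖ ^ 2)) := by
        rw [mul_pow, pow_add, pow_mul]
        ring
    _ ≤ _ := by
        gcongr
        exact hM _ hx

/-- The Gaussian `x ↦ e^{-c |x|²}` as a Schwartz function, for `Re c > 0`. -/
def gaussian (c : ℂ) (hc : 0 < c.re) : 𝓢(Plane, ℂ) where
  toFun x := Complex.exp (-c * ((‖x‖ ^ 2 : ℝ) : ℂ))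
  smooth' := by
    exact Complex.contDiff_exp.comp ((gaussian_exponent_hasTemperateGrowth c).1)
  decay' := gaussian_decay c hc

/-- The range `(-π/4, π/4)` of the parameter `ν`. -/
def nuRange : Set ℝ := Set.Ioo (-(Real.pi / 4)) (Real.pi / 4)

theorem gaussian_param_pos {ν : ℝ} (hν : ν ∈ nuRange) :
    0 < (Complex.exp (2 * Complex.I * ν) / 2).re := by
  have h1 : (2 * Complex.I * ν : ℂ) = ((2 * ν : ℝ) : ℂ) * Complex.I := by push_cast; ring
  have h2 : (Complex.exp (2 * Complex.I * ν) / 2).re = Real.cos (2 * ν) / 2 := by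
    rw [h1, show (2 : ℂ) = ((2 : ℝ) : ℂ) by norm_num, Complex.div_ofReal_re,
      Complex.exp_ofReal_mul_I_re]
  rw [h2]
  have := Real.cos_pos_of_mem_Ioo (x := 2 * ν) ⟨by linarith [hν.1], by linarith [hν.2]⟩
  positivity

theorem neg_mem_nuRange {ν : ℝ} (hν : ν ∈ nuRange) : -ν ∈ nuRange := ⟨by linarith [hν.2], by linarith [hν.1]⟩

theorem zero_mem_nuRange : (0 : ℝ) ∈ nuRange := ⟨by linarith [Real.pi_pos], by linarith [Real.pi_pos]⟩

/-- The Gaussian `exp (-½ e^{2iν} |x|²)`. -/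
def vacuum (ν : ℝ) (hν : ν ∈ nuRange) : 𝓢(Plane, ℂ) :=
  gaussian (Complex.exp (2 * Complex.I * ν) / 2) (gaussian_param_pos hν)

/-- `C₁^{n₁} C₂^{n₂} v / √(n₁! n₂!)` -/
def ladder (C : Fin 2 → SOp) (v : 𝓢(Plane, ℂ)) (n : ℕ × ℕ) : 𝓢(Plane, ℂ) :=
  ((1 / Real.sqrt (n.1.factorial * n.2.factorial) : ℝ) : ℂ) • (C 0 ^ n.1) ((C 1 ^ n.2) v)

/-- `φ_{n₁,n₂} = B₁^{n₁} B₂^{n₂} φ_{0,0} / √(n₁! n₂!)` with `φ_{0,0} = N₁ exp (-½ e^{2iν} |x|²)`. -/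
def phi (ν : ℝ) (hν : ν ∈ nuRange) (θ : ℝ) (N₁ : ℂ) (n : ℕ × ℕ) : L2 :=
  toL2 (ladder (B ν θ) (N₁ • vacuum ν hν) n)

/-- `Ψ_{n₁,n₂} = (A₁†)^{n₁} (A₂†)^{n₂} Ψ_{0,0} / √(n₁! n₂!)` with
`Ψ_{0,0} = N₂ exp (-½ e^{-2iν} |x|²)`. -/
def Psi (ν : ℝ) (hν : ν ∈ nuRange) (θ : ℝ) (N₂ : ℂ) (n : ℕ × ℕ) : L2 :=
  toL2 (ladder (Adag ν θ) (N₂ • vacuum (-ν) (neg_mem_nuRange hν)) n)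

/-- The harmonic-oscillator vectors `e_{n₁,n₂} = (a₁†)^{n₁} (a₂†)^{n₂} e_{0,0} / √(n₁! n₂!)` with
`e_{0,0} = π^{-1/2} exp (-½ |x|²)`. -/
def e (n : ℕ × ℕ) : L2 :=
  toL2 (ladder adag (((1 / Real.sqrt Real.pi : ℝ) : ℂ) • vacuum 0 zero_mem_nuRange) n)

/-- The linear span of the harmonic-oscillator vectors. -/
def De : Submodule ℂ L2 := Submodule.span ℂ (Set.range e)

/-! ### Bases and quasi-bases -/

/-- `u` is a Riesz basis: the image of an orthonormal basis under a bounded operator with bounded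
inverse. -/
def IsRieszBasis (u : ℕ × ℕ → L2) : Prop :=
  ∃ (S : L2 ≃L[ℂ] L2) (b : HilbertBasis (ℕ × ℕ) ℂ L2), ∀ n, u n = S (b n)

/-- `u` is a (Schauder) basis with respect to the enumeration `σ` of its index set: every vector
has a unique norm-convergent expansion. -/
def IsSchauderBasis (σ : ℕ ≃ ℕ × ℕ) (u : ℕ × ℕ → L2) : Prop :=
  ∀ f : L2, ∃! c : ℕ × ℕ → ℂ,
    Tendsto (fun N : ℕ => ∑ k ∈ Finset.range N, c (σ k) • u (σ k)) atTop (𝓝 f)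

/-- The biorthogonal families `u`, `v` are `G`-quasi bases, for the dense subspace `G`. -/
def IsQuasiBases (u v : ℕ × ℕ → L2) (G : Submodule ℂ L2) : Prop :=
  (∀ m n, inner ℂ (u m) (v n) = if m = n then (1 : ℂ) else 0) ∧
  Dense (G : Set L2) ∧
  ∀ f ∈ G, ∀ g ∈ G,
    HasSum (fun n => inner ℂ f (u n) * inner ℂ (v n) g) (inner ℂ f g) ∧
    HasSum (fun n => inner ℂ f (v n) * inner ℂ (u n) g) (inner ℂ f g)

/-! ### Unbounded operators -/

/-- A Schwartz operator as an unbounded operator of `L2`, with the Schwartz functions as domain. -/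
def toPMap (C : SOp) : L2 →ₗ.[ℂ] L2 where
  domain := LinearMap.range toL2.toLinearMap
  toFun := toL2.toLinearMap ∘ₗ C.toLinearMap ∘ₗ
    (LinearEquiv.ofInjective toL2.toLinearMap
      (SchwartzMap.injective_toLp 2 (volume : Measure Plane))).symm.toLinearMap

theorem mem_graph_toPMap (C : SOp) (f g : L2) :
    (f, g) ∈ (toPMap C).graph ↔ ∃ u : 𝓢(Plane, ℂ), toL2 u = f ∧ toL2 (C u) = g := by
  have key : ∀ u : 𝓢(Plane, ℂ), toPMap C ⟨toL2 u, u, rfl⟩ = toL2 (C u) := by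
    intro u
    have : (LinearEquiv.ofInjective toL2.toLinearMap
        (SchwartzMap.injective_toLp 2 (volume : Measure Plane))).symm ⟨toL2 u, u, rfl⟩ = u :=
      (LinearEquiv.symm_apply_eq _).2 rfl
    exact congrArg (fun v => toL2 (C v)) this
  rw [LinearPMap.mem_graph_iff]
  constructor
  · rintro ⟨⟨_, u, rfl⟩, rfl, rfl⟩
    exact ⟨u, rfl, (key u).symm⟩
  · rintro ⟨u, rfl, rfl⟩
    exact ⟨⟨toL2 u, u, rfl⟩, rfl, key u⟩

/-- The composition of unbounded operators, on its natural domain. -/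
def pcomp (S R : L2 →ₗ.[ℂ] L2) : L2 →ₗ.[ℂ] L2 :=
  S.comp (R.domRestrict ((S.domain.comap R.toFun).map R.domain.subtype)) (by
    rintro ⟨x, hx', hx⟩
    obtain ⟨y, hy, rfl⟩ := hx'
    exact hy)

theorem mem_graph_pcomp (S R : L2 →ₗ.[ℂ] L2) (x z : L2) :
    (x, z) ∈ (pcomp S R).graph ↔ ∃ y, (x, y) ∈ R.graph ∧ (y, z) ∈ S.graph := by
  simp only [LinearPMap.mem_graph_iff]
  constructor
  · rintro ⟨⟨y, hy', hy⟩, rfl, rfl⟩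
    obtain ⟨w, hw, hwy⟩ := hy'
    exact ⟨R ⟨y, hy⟩, ⟨⟨y, hy⟩, rfl, rfl⟩,
      ⟨R ⟨y, hy⟩, by have : w = ⟨y, hy⟩ := Subtype.ext hwy
                     exact this ▸ hw⟩, rfl, rfl⟩
  · rintro ⟨y, ⟨w, rfl, rfl⟩, ⟨v, hv, rfl⟩⟩
    refine ⟨⟨w, ⟨w, ?_, rfl⟩, w.2⟩, rfl, ?_⟩
    · change R w ∈ S.domain
      exact hv ▸ v.2
    · have : v = ⟨R w, hv ▸ v.2⟩ := Subtype.ext hv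
      exact congrArg (fun u => S u) this.symm

/-- `C` is a bounded operator on its domain. -/
def IsBddOp (C : L2 →ₗ.[ℂ] L2) : Prop := ∃ K : ℝ, ∀ f : C.domain, ‖C f‖ ≤ K * ‖f‖

/-- `C` is everywhere defined on `G` and maps `G` into `G`. -/
def LeavesStable (C : L2 →ₗ.[ℂ] L2) (G : Submodule ℂ L2) : Prop :=
  ∀ f ∈ G, ∃ g ∈ G, (f, g) ∈ C.graph

/-- On `G` the two operators are both defined and they coincide. -/
def AgreeOn (C C' : L2 →ₗ.[ℂ] L2) (G : Submodule ℂ L2) : Prop :=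
  ∀ f ∈ G, ∃ g, (f, g) ∈ C.graph ∧ (f, g) ∈ C'.graph

/-- `C` and `C'` are `M`-conjugate on `G`: `C f = M⁻¹ C' M f` for all `f ∈ G`. -/
def AreConjugate (M C C' : L2 →ₗ.[ℂ] L2) (G : Submodule ℂ L2) : Prop :=
  AgreeOn C (pcomp M.inverse (pcomp C' M)) G

/-! ### The complex dilation -/

/-- The (formal) generator `½ ∑_j (x_j d/dx_j + d/dx_j x_j)` of the dilations. -/
def dilationGenerator : SOp :=
  (1 / 2 : ℂ) • (X 0 ∘L D 0 + D 0 ∘L X 0) + (1 / 2 : ℂ) • (X 1 ∘L D 1 + D 1 ∘L X 1)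

/-- `g = e^{s ∑_j (x_j d/dx_j + d/dx_j x_j)/2} f` for real `s`, that is `g(x) = e^s f(e^s x)`: the
unitary group of dilations. -/
def IsDilate (s : ℝ) (f g : L2) : Prop :=
  g =ᵐ[volume] fun x : Plane => (Real.exp s : ℂ) * f (Real.exp s • x)

theorem IsDilate.add {s : ℝ} {f g f' g' : L2} (h : IsDilate s f g) (h' : IsDilate s f' g') :
    IsDilate s (f + f') (g + g') := by
  have hq := Measure.quasiMeasurePreserving_smul (μ := (volume : Measure Plane))
    (Real.exp_pos s).ne'
  have h1 := hq.ae (Lp.coeFn_add f f')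
  filter_upwards [h, h', Lp.coeFn_add g g', h1] with x hx hx' hg hf
  simp only [Pi.add_apply] at hg hf
  rw [hg, hx, hx', hf]
  ring

theorem IsDilate.smul {s : ℝ} {f g : L2} (c : ℂ) (h : IsDilate s f g) :
    IsDilate s (c • f) (c • g) := by
  have hq := Measure.quasiMeasurePreserving_smul (μ := (volume : Measure Plane))
    (Real.exp_pos s).ne'
  have h1 := hq.ae (Lp.coeFn_smul c f)
  filter_upwards [h, Lp.coeFn_smul c g, h1] with x hx hg hf
  simp only [Pi.smul_apply, smul_eq_mul] at hg hf
  rw [hg, hx, hf]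
  ring

theorem IsDilate.eq {s : ℝ} {f g g' : L2} (h : IsDilate s f g) (h' : IsDilate s f g') :
    g = g' :=
  Lp.ext (h.trans h'.symm)

theorem IsDilate.zero_right {s : ℝ} : IsDilate s 0 0 := by
  have hq := Measure.quasiMeasurePreserving_smul (μ := (volume : Measure Plane))
    (Real.exp_pos s).ne'
  have h0 := Lp.coeFn_zero ℂ 2 (volume : Measure Plane)
  have h1 := hq.ae h0
  filter_upwards [h0, h1] with x hx hf
  simp only [Pi.zero_apply] at hx hf
  rw [hx, hf, mul_zero]

/-- `F` is the continuation of the orbit `s ↦ e^{s ∑_j (x_j d/dx_j + d/dx_j x_j)/2} f` from the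
real line to the closed strip between `Im z = 0` and `Im z = ν`: continuous and bounded on the
closed strip and holomorphic inside. -/
structure IsContinuation (ν : ℝ) (f : L2) (F : ℂ → L2) : Prop where
  diffContOnCl : DiffContOnCl ℂ F (Complex.im ⁻¹' Set.Ioo (min 0 ν) (max 0 ν))
  bounded : ∃ C : ℝ, ∀ z : ℂ, z.im ∈ Set.Icc (min 0 ν) (max 0 ν) → ‖F z‖ ≤ C
  orbit : ∀ s : ℝ, IsDilate s f (F s)

/-- The graph of `T_ν`: `f` is in the domain if its dilation orbit has a continuation `F` to the
strip between `0` and `iν`, and `T_ν f = F(iν)`. -/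
def dilationGraph (ν : ℝ) : Submodule ℂ (L2 × L2) where
  carrier := {p | ∃ F : ℂ → L2, IsContinuation ν p.1 F ∧ F (Complex.I * ν) = p.2}
  add_mem' := by
    rintro p q ⟨F, hF, hp⟩ ⟨G, hG, hq⟩
    refine ⟨F + G, ⟨hF.1.add hG.1, ?_, fun s => (hF.3 s).add (hG.3 s)⟩, by simp [hp, hq]⟩
    obtain ⟨C, hC⟩ := hF.2
    obtain ⟨C', hC'⟩ := hG.2
    exact ⟨C + C', fun z hz => (norm_add_le _ _).trans (add_le_add (hC z hz) (hC' z hz))⟩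
  zero_mem' := by
    refine ⟨0, ⟨diffContOnCl_const (c := (0 : L2)), ⟨0, fun z _ => by simp⟩, fun s => ?_⟩, rfl⟩
    exact IsDilate.zero_right
  smul_mem' := by
    rintro c p ⟨F, hF, hp⟩
    refine ⟨c • F, ⟨hF.1.const_smul c, ?_, fun s => (hF.3 s).smul c⟩, by simp [hp]⟩
    obtain ⟨C, hC⟩ := hF.2
    refine ⟨‖c‖ * C, fun z hz => ?_⟩
    rw [Pi.smul_apply, norm_smul]
    gcongr
    exact hC z hz

theorem dilationGraph_single_valued (ν : ℝ) (p : L2 × L2) (hp : p ∈ dilationGraph ν)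
    (h0 : p.1 = 0) : p.2 = 0 := by
  obtain ⟨F, hF, hFp⟩ := hp
  rw [h0] at hF
  have hreal : ∀ s : ℝ, F s = 0 := fun s => (hF.orbit s).eq IsDilate.zero_right
  rcases eq_or_ne ν 0 with rfl | hν
  · rw [← hFp]
    simpa using hreal 0
  rw [← hFp]
  let q : ℂ → ℂ := fun w => Complex.I * ν * w
  have him : ∀ w : ℂ, (q w).im = ν * w.re := fun w => by simp [q, mul_assoc]
  have hmaps : Set.MapsTo q (Complex.HadamardThreeLines.verticalStrip 0 1)
      (Complex.im ⁻¹' Set.Ioo (min 0 ν) (max 0 ν)) := by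
    rintro w ⟨hw0, hw1⟩
    change (q w).im ∈ Set.Ioo (min 0 ν) (max 0 ν)
    rw [him]
    rcases lt_or_gt_of_ne hν with h | h
    · rw [min_eq_right h.le, max_eq_left h.le]
      exact ⟨by nlinarith, by nlinarith⟩
    · rw [min_eq_left h.le, max_eq_right h.le]
      exact ⟨by nlinarith, by nlinarith⟩
  have hq : Differentiable ℂ q := by fun_prop
  have hd : DiffContOnCl ℂ (F ∘ q) (Complex.HadamardThreeLines.verticalStrip 0 1) :=
    hF.diffContOnCl.comp hq.diffContOnCl hmaps
  obtain ⟨C, hC⟩ := hF.bounded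
  have hbd : ∀ w : ℂ, w.re ∈ Set.Icc (0 : ℝ) 1 → ‖(F ∘ q) w‖ ≤ C := by
    rintro w ⟨hw0, hw1⟩
    refine hC _ ?_
    rw [him]
    rcases lt_or_gt_of_ne hν with h | h
    · rw [min_eq_right h.le, max_eq_left h.le]
      exact ⟨by nlinarith, by nlinarith⟩
    · rw [min_eq_left h.le, max_eq_right h.le]
      exact ⟨by nlinarith, by nlinarith⟩
  have hB : BddAbove ((norm ∘ (F ∘ q)) '' Complex.HadamardThreeLines.verticalClosedStrip 0 1) := by
    refine ⟨C, ?_⟩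
    rintro _ ⟨w, hw, rfl⟩
    exact hbd w hw
  have hzero : ∀ t : ℝ, t ∈ Set.Ico (0 : ℝ) 1 → (F ∘ q) t = 0 := by
    intro t ht
    have h3 := Complex.HadamardThreeLines.norm_le_interp_of_mem_verticalClosedStrip₀₁'
      (F ∘ q) (z := (t : ℂ)) (a := 0) (b := C) ⟨by simpa using ht.1, by simpa using ht.2.le⟩
      hd hB
      (by
        intro w hw
        have hw' : w.re = 0 := hw
        have : q w = ((-(ν * w.im) : ℝ) : ℂ) := by
          apply Complex.ext <;> simp [q, mul_assoc, hw']
        rw [Function.comp_apply, this, hreal, norm_zero])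
      (by
        intro w hw
        have hw' : w.re = 1 := hw
        exact hbd w (by simp [hw']))
    have hpos : (0 : ℝ) < 1 - t := by linarith [ht.2]
    rw [Complex.ofReal_re, Real.zero_rpow hpos.ne', zero_mul] at h3
    exact norm_le_zero_iff.1 h3
  have hcont : ContinuousOn (F ∘ q) (closure (Complex.HadamardThreeLines.verticalStrip 0 1)) :=
    hd.continuousOn
  have hcl : ∀ t : ℝ, t ∈ Set.Icc (0 : ℝ) 1 →
      (t : ℂ) ∈ closure (Complex.HadamardThreeLines.verticalStrip 0 1) := by
    intro t ht
    rw [Complex.HadamardThreeLines.verticalStrip, Complex.closure_preimage_re,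
      closure_Ioo (by norm_num)]
    exact ht
  have hcr : ContinuousOn (fun t : ℝ => (F ∘ q) t) (Set.Icc 0 1) :=
    hcont.comp Complex.continuous_ofReal.continuousOn hcl
  have hlim : Tendsto (fun t : ℝ => (F ∘ q) t) (𝓝[Set.Ico 0 1] 1) (𝓝 ((F ∘ q) (1 : ℝ))) :=
    (hcr 1 ⟨zero_le_one, le_rfl⟩).mono_left (nhdsWithin_mono _ Set.Ico_subset_Icc_self)
  have hlim0 : Tendsto (fun t : ℝ => (F ∘ q) t) (𝓝[Set.Ico 0 1] 1) (𝓝 0) :=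
    tendsto_const_nhds.congr' (by
      filter_upwards [self_mem_nhdsWithin] with t ht
      exact (hzero t ht).symm)
  have : (𝓝[Set.Ico (0 : ℝ) 1] 1).NeBot := by
    rw [← mem_closure_iff_nhdsWithin_neBot, closure_Ico (by norm_num)]
    exact ⟨zero_le_one, le_rfl⟩
  have := tendsto_nhds_unique hlim hlim0
  simpa [q] using this

/-- The complex dilation
`T_ν = e^{iν (x₁ d/dx₁ + d/dx₁ x₁)/2} e^{iν (x₂ d/dx₂ + d/dx₂ x₂)/2}`, as an unbounded operator:
the value at `z = iν` of the analytic continuation of the dilation group `e^{z G}`, with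
`G = ∑_j (x_j d/dx_j + d/dx_j x_j)/2`, on the domain of all `f` for which it exists. -/
def T (ν : ℝ) : L2 →ₗ.[ℂ] L2 := (dilationGraph ν).toLinearPMap

theorem mem_graph_T (ν : ℝ) (f g : L2) :
    (f, g) ∈ (T ν).graph ↔ ∃ F : ℂ → L2, IsContinuation ν f F ∧ F (Complex.I * ν) = g := by
  rw [T, Submodule.toLinearPMap_graph_eq _ (dilationGraph_single_valued ν)]
  rfl

/-- The metric operator `Θ = T_ν⁻² / (π |N₁|²)`. -/
def Theta (ν : ℝ) (N₁ : ℂ) : L2 →ₗ.[ℂ] L2 :=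
  ((1 / (Real.pi * ‖N₁‖ ^ 2) : ℝ) : ℂ) • pcomp (T ν).inverse (T ν).inverse

end Swanson

end

noncomputable section

namespace Swanson

/-! ### The unitary dilation group -/

/-! The Bopp shift cancels in `A` and `B`, so θ disappears: they are (e^{iν} x_j ± e^{-iν} ∂_j)/√2,
the bosonic operators conjugated by the complex dilation T_ν. Everything rests on controlling T_t =
e^{itG} for real t as an operator of L².

Self-adjointness. Along a continuation F, horizontal translation acts by unitary dilations, so norms
are constant on horizontal lines and Phragmén–Lindelöf bounds F on the strip by the larger of ‖f‖
and ‖T_ν f‖ (`IsContinuation.norm_le`). Hence T_ν is closed, and reading the strip from its other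
edge gives T_ν⁻¹ = T_{-ν}. The averages ∫ e^{-as²+bs} e^{sG} ds have entire orbits, because
translating s only changes b. Suitable ones form bounded symmetric operators R_c that tend to the
identity, commute with T_ν and map into its domain, with T_ν R_c bounded and symmetric. This makes
T_ν symmetric, and then self-adjoint by `isSelfAdjoint_of_approx`. The same argument applies to
T_ν², and so to Θ.

Algebra. A dilation module consists of families σ(t) = T_t σ(0) of Schwartz functions, stable under
e^{it} x_j and e^{-it} ∂_j, hence under A_t and B_t. On Schwartz functions A_ν† = B_{-ν} and B_ν† =
A_{-ν}, so each intertwining relation compares the values of one family at 0, ν and -ν. Polynomials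
times Gaussians form a module containing the orbits of the e_n, whose values at ν and -ν are
multiples of φ_n and Ψ_n. Gaussian averages of Schwartz functions form another, whose space of
values does not depend on t; this is the dense subspace stable under all the operators.

Bases. The e_n are complete because polynomials times a Gaussian are dense. Biorthogonality is the
symmetry of T, and the quasi-basis expansions are Parseval's identity for T_ν f and T_{-ν} g.

Divergence. Complex conjugation gives ‖T_{-ν} e_n‖ = ‖T_ν e_n‖, so the orbit of e_n is bounded by
this number for |Im z| ≤ |ν|, and Cauchy's estimate at 0 yields |ν| ‖G e_n‖ ≤ ‖T_ν e_n‖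
(`mul_norm_generator_le`). As G = ½ ∑ (a_j² - a_j†²), ‖G e_n‖ grows at least like n_j/2. This
excludes Riesz bases and makes T_ν unbounded; Banach–Steinhaus excludes Schauder bases, since ‖φ_n‖
‖Ψ_n‖ would have to stay bounded. -/

theorem toL2_coeFn (u : 𝓢(Plane, ℂ)) : toL2 u =ᵐ[volume] u := SchwartzMap.coeFn_toLp u 2 volume

theorem denseRange_toL2 : DenseRange toL2 :=
  SchwartzMap.denseRange_toLpCLM (by norm_num)

theorem memLp_dilate (s : ℝ) (f : L2) :
    MemLp (fun x : Plane => (Real.exp s : ℂ) * f (Real.exp s • x)) 2 volume := by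
  have hr : Real.exp s ≠ 0 := (Real.exp_pos s).ne'
  have h1 : MemLp f 2 (Measure.map (Real.exp s • · : Plane → Plane) volume) := by
    rw [Measure.map_addHaar_smul _ hr]
    exact (Lp.memLp f).smul_measure ENNReal.ofReal_ne_top
  exact ((memLp_map_measure_iff h1.1 (measurable_const_smul _).aemeasurable).1 h1).const_mul _

/-- In dimension two the Jacobian e^{-2s} cancels the square of the prefactor e^s. -/
theorem IsDilate.norm_eq {s : ℝ} {f g : L2} (h : IsDilate s f g) : ‖g‖ = ‖f‖ := by
  have key : ∀ k : L2, ‖k‖ ^ 2 = ∫ x, ‖k x‖ ^ 2 := by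
    intro k
    have := L2.inner_def (𝕜 := ℂ) k k
    rw [inner_self_eq_norm_sq_to_K] at this
    have h2 : ∀ x, inner ℂ (k x) (k x) = ((‖k x‖ ^ 2 : ℝ) : ℂ) := fun x => by
      rw [inner_self_eq_norm_sq_to_K]; simp
    simp_rw [h2] at this
    rw [integral_complex_ofReal] at this
    exact Complex.ofReal_injective (by rw [← this]; simp)
  have h1 : ‖g‖ ^ 2 = ‖f‖ ^ 2 := by
    have h3 : ∫ x, ‖g x‖ ^ 2 = ∫ x, ‖(Real.exp s : ℂ) * f (Real.exp s • x)‖ ^ 2 :=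
      integral_congr_ae (h.fun_comp (fun z : ℂ => ‖z‖ ^ 2))
    rw [key, key, h3]
    simp_rw [norm_mul, mul_pow]
    rw [integral_const_mul,
      Measure.integral_comp_smul volume (fun x : Plane => ‖f x‖ ^ 2) (Real.exp s)]
    have : Module.finrank ℝ Plane = 2 := by simp
    rw [this, smul_eq_mul, abs_of_pos (by positivity), Complex.norm_real,
      Real.norm_of_nonneg (Real.exp_pos s).le, ← mul_assoc, mul_inv_cancel₀ (by positivity),
      one_mul]
  exact (pow_left_inj₀ (norm_nonneg _) (norm_nonneg _) two_ne_zero).1 h1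

/-- The dilation `f ↦ e^s f(e^s ·)` as a linear isometry of `L2`. -/
def dil (s : ℝ) : L2 →ₗᵢ[ℂ] L2 where
  toFun f := (memLp_dilate s f).toLp
  map_add' _ _ := IsDilate.eq (MemLp.coeFn_toLp _)
    (IsDilate.add (MemLp.coeFn_toLp _) (MemLp.coeFn_toLp _))
  map_smul' c f := IsDilate.eq (MemLp.coeFn_toLp _)
    (IsDilate.smul c (MemLp.coeFn_toLp (memLp_dilate s f)))
  norm_map' f := IsDilate.norm_eq (s := s) (MemLp.coeFn_toLp (memLp_dilate s f))

theorem isDilate_dil (s : ℝ) (f : L2) : IsDilate s f (dil s f) :=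
  MemLp.coeFn_toLp (memLp_dilate s f)

theorem isDilate_iff {s : ℝ} {f g : L2} : IsDilate s f g ↔ g = dil s f :=
  ⟨fun h => h.eq (isDilate_dil s f), fun h => h ▸ isDilate_dil s f⟩

theorem dil_zero (f : L2) : dil 0 f = f := by
  symm
  rw [← isDilate_iff]
  exact ae_of_all _ fun x => by simp

theorem dil_add (s t : ℝ) (f : L2) : dil (s + t) f = dil s (dil t f) := by
  symm
  rw [← isDilate_iff]
  have hq := Measure.quasiMeasurePreserving_smul (μ := (volume : Measure Plane))
    (Real.exp_pos s).ne'
  filter_upwards [isDilate_dil s (dil t f), hq.ae (isDilate_dil t f)] with x h1 h2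
  rw [h1, h2, smul_smul, ← Real.exp_add, ← mul_assoc, ← Complex.ofReal_mul, ← Real.exp_add,
    add_comm t s]

theorem dil_neg_dil (s : ℝ) (f : L2) : dil (-s) (dil s f) = f := by
  rw [← dil_add, neg_add_cancel, dil_zero]

theorem inner_dil (s : ℝ) (f g : L2) : inner ℂ f (dil s g) = inner ℂ (dil (-s) f) g := by
  rw [← (dil (-s)).inner_map_map f, dil_neg_dil]

theorem D_apply_eq_fderiv (j : Fin 2) (f : 𝓢(Plane, ℂ)) (x : Plane) :
    D j f x = fderiv ℝ f x (EuclideanSpace.single j (1 : ℝ)) :=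
  SchwartzMap.lineDerivOp_apply_eq_fderiv _ f x

theorem plane_eq_sum (x : Plane) :
    x = x 0 • EuclideanSpace.single 0 (1 : ℝ) + x 1 • EuclideanSpace.single 1 (1 : ℝ) := by
  ext i
  fin_cases i <;> simp

theorem D_X (i j : Fin 2) (u : 𝓢(Plane, ℂ)) :
    D i (X j u) = X j (D i u) + if i = j then u else 0 := by
  ext x
  have h1 : HasFDerivAt (fun x : Plane => ((x j : ℝ) : ℂ))
      (Complex.ofRealCLM.comp (EuclideanSpace.proj (𝕜 := ℝ) j)) x :=
    (Complex.ofRealCLM.comp (EuclideanSpace.proj (𝕜 := ℝ) j)).hasFDerivAt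
  have h2 := h1.mul (u.hasFDerivAt x)
  have h3 : (X j u : Plane → ℂ) = fun x : Plane => (x j : ℂ) * u x := funext (X_apply j u)
  have h4 : D i (X j u) x = (((x j : ℝ) : ℂ) • fderiv ℝ u x +
      u x • Complex.ofRealCLM.comp (EuclideanSpace.proj (𝕜 := ℝ) j))
        (EuclideanSpace.single i (1 : ℝ)) := by
    rw [D_apply_eq_fderiv, h3]
    exact congrArg (fun L : Plane →L[ℝ] ℂ => L (EuclideanSpace.single i (1 : ℝ))) h2.fderiv
  rw [h4]
  rcases eq_or_ne i j with rfl | hij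
  · simp [X_apply, D_apply_eq_fderiv]
  · simp [hij, hij.symm, X_apply, D_apply_eq_fderiv]

/-- Commuting ∂_j past x_j contributes ½ for each coordinate, hence the term u; the rest is the
Euler field. -/
theorem dilationGenerator_apply (u : 𝓢(Plane, ℂ)) (x : Plane) :
    dilationGenerator u x = u x + fderiv ℝ u x x := by
  have h1 : fderiv ℝ u x x = (x 0 : ℂ) * D 0 u x + (x 1 : ℂ) * D 1 u x := by
    rw [D_apply_eq_fderiv, D_apply_eq_fderiv]
    calc fderiv ℝ u x x = fderiv ℝ u x (x 0 • EuclideanSpace.single 0 (1 : ℝ) +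
          x 1 • EuclideanSpace.single 1 (1 : ℝ)) := congrArg _ (plane_eq_sum x)
      _ = _ := by rw [map_add, map_smul, map_smul, Complex.real_smul, Complex.real_smul]
  rw [h1]
  simp [dilationGenerator, D_X, X_apply]
  ring

theorem hasDerivAt_dilate (u : 𝓢(Plane, ℂ)) (x : Plane) (s : ℝ) :
    HasDerivAt (fun s : ℝ => (Real.exp s : ℂ) * u (Real.exp s • x))
      ((Real.exp s : ℂ) * dilationGenerator u (Real.exp s • x)) s := by
  have h1 : HasDerivAt (fun s : ℝ => Real.exp s • x) (Real.exp s • x) s :=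
    (Real.hasDerivAt_exp s).smul_const x
  have h2 := (u.hasFDerivAt (Real.exp s • x)).comp_hasDerivAt s h1
  have h3 := (Real.hasDerivAt_exp s).ofReal_comp.mul h2
  refine h3.congr_deriv ?_
  rw [dilationGenerator_apply]
  simp only [Function.comp]
  ring

/-- A bound uniform in |s| ≤ 1 by a square-integrable function, so that pointwise estimates on
dilates pass to L². -/
theorem exists_dilate_bound (u : 𝓢(Plane, ℂ)) :
    ∃ C : ℝ, 0 ≤ C ∧ ∀ s ∈ Set.Icc (-1 : ℝ) 1, ∀ x : Plane,
      ‖(Real.exp s : ℂ) * u (Real.exp s • x)‖ ≤ C * (1 + ‖x‖) ^ (-2 : ℝ) := by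
  obtain ⟨C, hC⟩ : ∃ C : ℝ, ∀ x, (1 + ‖x‖) ^ 2 * ‖u x‖ ≤ C := by
    have := fun x => SchwartzMap.one_add_le_sup_seminorm_apply (𝕜 := ℂ) (m := (2, 0)) (k := 2)
      (n := 0) le_rfl le_rfl u x
    simp only [norm_iteratedFDeriv_zero] at this
    exact ⟨_, this⟩
  have hC0 : 0 ≤ C := le_trans (by positivity) (hC 0)
  -- One factor e bounds e^s; the other two come from 1 + ‖x‖ ≤ e (1 + ‖e^s x‖), squared.
  refine ⟨Real.exp 1 ^ 3 * C, by positivity, fun s hs x => ?_⟩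
  have hx : 0 ≤ ‖x‖ := norm_nonneg x
  rw [show (-2 : ℝ) = -((2 : ℕ) : ℝ) by norm_num, Real.rpow_neg (by positivity),
    Real.rpow_natCast, ← div_eq_mul_inv, le_div_iff₀ (by positivity), norm_mul, Complex.norm_real,
    Real.norm_of_nonneg (Real.exp_pos s).le]
  have h1 : 1 + ‖x‖ ≤ Real.exp 1 * (1 + ‖Real.exp s • x‖) := by
    rw [norm_smul, Real.norm_of_nonneg (Real.exp_pos s).le]
    have h2 : 1 ≤ Real.exp 1 * Real.exp s := by
      rw [← Real.exp_add]; exact Real.one_le_exp (by linarith [hs.1])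
    have h3 : (1 : ℝ) ≤ Real.exp 1 := Real.one_le_exp zero_le_one
    nlinarith
  calc Real.exp s * ‖u (Real.exp s • x)‖ * (1 + ‖x‖) ^ 2
      ≤ Real.exp 1 * ‖u (Real.exp s • x)‖ * (Real.exp 1 * (1 + ‖Real.exp s • x‖)) ^ 2 := by
        gcongr
        exact hs.2
    _ = Real.exp 1 ^ 3 * ((1 + ‖Real.exp s • x‖) ^ 2 * ‖u (Real.exp s • x)‖) := by ring
    _ ≤ _ := by gcongr; exact hC _

theorem memLp_one_add_norm : MemLp (fun x : Plane => (1 + ‖x‖) ^ (-2 : ℝ)) 2 volume := by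
  have hc : Continuous fun x : Plane => (1 + ‖x‖) ^ (-2 : ℝ) :=
    (continuous_const.add continuous_norm).rpow_const fun x =>
      Or.inl (by linarith [norm_nonneg x] : (0 : ℝ) < 1 + ‖x‖).ne'
  rw [memLp_two_iff_integrable_sq hc.aestronglyMeasurable]
  have := integrable_one_add_norm (E := Plane) (μ := volume) (r := 4) (by simp; norm_num)
  refine this.congr (Eventually.of_forall fun x => ?_)
  change _ = ((1 + ‖x‖) ^ (-2 : ℝ)) ^ 2
  rw [← Real.rpow_natCast, ← Real.rpow_mul (by linarith [norm_nonneg x])]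
  norm_num

/-- The mean value inequality applied twice, with the second derivative in s, the dilate of G²u,
bounded uniformly for |s| ≤ 1. -/
theorem dilate_taylor (u : 𝓢(Plane, ℂ)) :
    ∃ C : ℝ, 0 ≤ C ∧ ∀ s ∈ Set.Icc (-1 : ℝ) 1, ∀ x : Plane,
      ‖(Real.exp s : ℂ) * u (Real.exp s • x) - u x - s * dilationGenerator u x‖ ≤
        C * s ^ 2 * (1 + ‖x‖) ^ (-2 : ℝ) := by
  obtain ⟨C, hC0, hC⟩ := exists_dilate_bound (dilationGenerator (dilationGenerator u))
  refine ⟨C, hC0, fun s hs x => ?_⟩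
  set g := (1 + ‖x‖) ^ (-2 : ℝ)
  have hsub : Set.uIcc 0 s ⊆ Set.Icc (-1 : ℝ) 1 :=
    Set.uIcc_subset_Icc (by constructor <;> norm_num) hs
  have hle : ∀ t ∈ Set.uIcc 0 s, |t| ≤ |s| := fun t ht => by
    simpa using Set.abs_sub_left_of_mem_uIcc ht
  have h1 : ∀ t ∈ Set.uIcc 0 s,
      ‖(Real.exp t : ℂ) * dilationGenerator u (Real.exp t • x) - dilationGenerator u x‖ ≤
        C * g * |s| := by
    intro t ht
    have := (convex_Icc (-1 : ℝ) 1).norm_image_sub_le_of_norm_hasDerivWithin_le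
      (f := fun s : ℝ => (Real.exp s : ℂ) * dilationGenerator u (Real.exp s • x))
      (fun t _ => (hasDerivAt_dilate (dilationGenerator u) x t).hasDerivWithinAt)
      (fun t ht => hC t ht x) (x := 0) (y := t) (by constructor <;> norm_num) (hsub ht)
    simp only [Real.exp_zero, Complex.ofReal_one, one_mul, one_smul, sub_zero,
      Real.norm_eq_abs] at this
    exact this.trans (mul_le_mul_of_nonneg_left (hle t ht) (by positivity))
  have h2 := (convex_uIcc (0 : ℝ) s).norm_image_sub_le_of_norm_hasDerivWithin_le
      (f := fun s : ℝ => (Real.exp s : ℂ) * u (Real.exp s • x) - s * dilationGenerator u x)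
      (fun t _ => ((hasDerivAt_dilate u x t).sub
        ((hasDerivAt_id t).ofReal_comp.mul_const _)).hasDerivWithinAt)
      (C := C * g * |s|)
      (fun t ht => by simpa using h1 t ht) (x := 0) (y := s) (by simp) (by simp)
  simp only [Real.exp_zero, Complex.ofReal_one, one_mul, one_smul, sub_zero,
      Real.norm_eq_abs, Complex.ofReal_zero, zero_mul] at h2
  calc _ = _ := by congr 1; ring
    _ ≤ _ := h2
    _ = C * (|s| * |s|) * g := by ring
    _ = _ := by rw [abs_mul_abs_self]; ring

theorem hasDerivAt_dil_zero (u : 𝓢(Plane, ℂ)) :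
    HasDerivAt (fun s => dil s (toL2 u)) (toL2 (dilationGenerator u)) 0 := by
  obtain ⟨C, hC0, hC⟩ := dilate_taylor u
  let g : Lp ℝ 2 (volume : Measure Plane) := memLp_one_add_norm.toLp
  rw [hasDerivAt_iff_isLittleO_nhds_zero]
  have hO : (fun s : ℝ => dil (0 + s) (toL2 u) - dil 0 (toL2 u) - s • toL2 (dilationGenerator u))
      =O[𝓝 0] fun s : ℝ => s ^ 2 := by
    refine Asymptotics.IsBigO.of_bound (C * ‖g‖) ?_
    filter_upwards [Icc_mem_nhds (show (-1 : ℝ) < 0 by norm_num) zero_lt_one] with s hs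
    rw [zero_add, dil_zero]
    have : ‖dil s (toL2 u) - toL2 u - s • toL2 (dilationGenerator u)‖ ≤ C * s ^ 2 * ‖g‖ := by
      refine Lp.norm_le_mul_norm_of_ae_le_mul ?_
      have hq := Measure.quasiMeasurePreserving_smul (μ := (volume : Measure Plane))
        (Real.exp_pos s).ne'
      filter_upwards [isDilate_dil s (toL2 u), hq.ae (toL2_coeFn u), toL2_coeFn u,
        toL2_coeFn (dilationGenerator u), Lp.coeFn_sub (dil s (toL2 u) - toL2 u)
          (s • toL2 (dilationGenerator u)), Lp.coeFn_sub (dil s (toL2 u)) (toL2 u),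
        Lp.coeFn_smul s (toL2 (dilationGenerator u)), memLp_one_add_norm.coeFn_toLp]
        with x h1 h2 h3 h4 h5 h6 h7 h8
      rw [h5, Pi.sub_apply, h6, Pi.sub_apply, h7, Pi.smul_apply, h1, h2, h3, h4, h8,
        Complex.real_smul, Real.norm_of_nonneg (by positivity)]
      exact hC s hs x
    rw [Real.norm_of_nonneg (by positivity)]
    linarith
  refine hO.trans_isLittleO ?_
  simpa using Asymptotics.isLittleO_pow_id (𝕜 := ℝ) (one_lt_two)

/-- Strong continuity: on Schwartz vectors it follows from differentiability at 0 and the group law,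
and it passes to all of L² because dilations are isometries, so that the approximation is uniform in
s. -/
theorem continuous_dil (f : L2) : Continuous fun s => dil s f := by
  have hS : ∀ u : 𝓢(Plane, ℂ), Continuous fun s => dil s (toL2 u) := by
    intro u
    rw [continuous_iff_continuousAt]
    intro s
    have h1 : ContinuousAt (fun h => dil h (toL2 u)) (s - s) := by
      rw [sub_self]; exact (hasDerivAt_dil_zero u).continuousAt
    have h2 : ContinuousAt (fun t => dil (t - s) (toL2 u)) s :=
      ContinuousAt.comp (f := fun t => t - s) h1 (by fun_prop)
    have h3 := (dil s).continuous.continuousAt.comp h2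
    refine h3.congr (Eventually.of_forall fun t => ?_)
    change dil s (dil (t - s) (toL2 u)) = dil t (toL2 u)
    rw [← dil_add, add_sub_cancel]
  refine continuous_of_uniform_approx_of_continuous fun V hV => ?_
  obtain ⟨ε, hε, hV⟩ := Metric.mem_uniformity_dist.1 hV
  obtain ⟨u, hu⟩ := denseRange_toL2.exists_dist_lt f hε
  exact ⟨_, hS u, fun s => hV (by rwa [(dil s).dist_map])⟩

/-! ### The analytic continuation of the dilation group -/

theorem zero_im_mem (ν : ℝ) : (0 : ℝ) ∈ Set.Icc (min 0 ν) (max 0 ν) := by simp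

theorem strip_subset {ν t : ℝ} (ht : t ∈ Set.Icc (min 0 ν) (max 0 ν)) :
    Set.Ioo (min 0 t) (max 0 t) ⊆ Set.Ioo (min 0 ν) (max 0 ν) :=
  Set.Ioo_subset_Ioo (le_min (by simp) ht.1) (max_le (by simp) ht.2)

theorem closedStrip_subset {ν t : ℝ} (ht : t ∈ Set.Icc (min 0 ν) (max 0 ν)) :
    Set.Icc (min 0 t) (max 0 t) ⊆ Set.Icc (min 0 ν) (max 0 ν) :=
  Set.Icc_subset_Icc (le_min (by simp) ht.1) (max_le (by simp) ht.2)

theorem closure_strip_subset (ν : ℝ) :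
    closure (Complex.im ⁻¹' Set.Ioo (min 0 ν) (max 0 ν)) ⊆
      Complex.im ⁻¹' Set.Icc (min 0 ν) (max 0 ν) :=
  closure_minimal (Set.preimage_mono Set.Ioo_subset_Icc_self)
    (isClosed_Icc.preimage Complex.continuous_im)

theorem isOpen_strip (ν : ℝ) : IsOpen (Complex.im ⁻¹' Set.Ioo (min 0 ν) (max 0 ν)) :=
  isOpen_Ioo.preimage Complex.continuous_im

/-- A bounded continuous function on the closed strip, holomorphic inside, which vanishes on the
real line is zero. -/
theorem eq_zero_of_eq_zero_on_real {ν : ℝ} {K : ℂ → L2}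
    (hd : DiffContOnCl ℂ K (Complex.im ⁻¹' Set.Ioo (min 0 ν) (max 0 ν)))
    (hb : ∃ C : ℝ, ∀ z : ℂ, z.im ∈ Set.Icc (min 0 ν) (max 0 ν) → ‖K z‖ ≤ C)
    (h0 : ∀ s : ℝ, K s = 0) {z : ℂ} (hz : z.im ∈ Set.Icc (min 0 ν) (max 0 ν)) : K z = 0 := by
  have hmaps : Set.MapsTo (fun w : ℂ => w + z.re)
      (Complex.im ⁻¹' Set.Ioo (min 0 z.im) (max 0 z.im))
      (Complex.im ⁻¹' Set.Ioo (min 0 ν) (max 0 ν)) := fun w hw => by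
    have := strip_subset hz hw
    simpa using this
  -- Translating by Re z and narrowing the strip to height Im z makes K z the endpoint value of a
  -- continuation of the zero orbit.
  have h1 := dilationGraph_single_valued z.im (0, K z) ⟨fun w => K (w + z.re),
    ⟨hd.comp (Differentiable.diffContOnCl (by fun_prop)) hmaps, ?_, ?_⟩, ?_⟩ rfl
  · exact h1
  · obtain ⟨C, hC⟩ := hb
    exact ⟨C, fun w hw => hC _ (by simpa using closedStrip_subset hz hw)⟩
  · intro s
    rw [← Complex.ofReal_add, h0]
    exact IsDilate.zero_right
  · change K _ = K z
    congr 1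
    rw [add_comm, mul_comm]
    exact Complex.re_add_im z

theorem IsContinuation.ofReal {ν : ℝ} {f : L2} {F : ℂ → L2} (hF : IsContinuation ν f F) (s : ℝ) :
    F s = dil s f := isDilate_iff.1 (hF.orbit s)

theorem IsContinuation.zero {ν : ℝ} {f : L2} {F : ℂ → L2} (hF : IsContinuation ν f F) :
    F 0 = f := by simpa [dil_zero] using hF.ofReal 0

/-- F(z + s) - e^{sG} F(z) is bounded and holomorphic in z and vanishes on the real line, by the
group law there. -/
theorem IsContinuation.add_ofReal {ν : ℝ} {f : L2} {F : ℂ → L2} (hF : IsContinuation ν f F)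
    {z : ℂ} (hz : z.im ∈ Set.Icc (min 0 ν) (max 0 ν)) (s : ℝ) : F (z + s) = dil s (F z) := by
  rw [← sub_eq_zero]
  have hmaps : Set.MapsTo (fun w : ℂ => w + s)
      (Complex.im ⁻¹' Set.Ioo (min 0 ν) (max 0 ν))
      (Complex.im ⁻¹' Set.Ioo (min 0 ν) (max 0 ν)) := fun w hw => by simpa using hw
  refine eq_zero_of_eq_zero_on_real (ν := ν) (K := fun z => F (z + s) - dil s (F z)) ?_ ?_ ?_ hz
  · refine (hF.diffContOnCl.comp (Differentiable.diffContOnCl (by fun_prop)) hmaps).sub ?_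
    exact (dil s).toContinuousLinearMap.differentiable.comp_diffContOnCl hF.diffContOnCl
  · obtain ⟨C, hC⟩ := hF.bounded
    refine ⟨C + C, fun w hw => (norm_sub_le _ _).trans (add_le_add ?_ ?_)⟩
    · exact hC _ (by simpa using hw)
    · rw [(dil s).norm_map]; exact hC _ hw
  · intro r
    rw [← Complex.ofReal_add, hF.ofReal, hF.ofReal, ← dil_add, add_comm, sub_self]

theorem IsContinuation.norm_add_ofReal {ν : ℝ} {f : L2} {F : ℂ → L2} (hF : IsContinuation ν f F)
    {z : ℂ} (hz : z.im ∈ Set.Icc (min 0 ν) (max 0 ν)) (s : ℝ) : ‖F (z + s)‖ = ‖F z‖ := by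
  rw [hF.add_ofReal hz, (dil s).norm_map]

theorem mk_re_im (z : ℂ) : z = Complex.I * z.im + z.re := by
  rw [add_comm, mul_comm]
  exact (Complex.re_add_im z).symm

/-- The norm is constant on each edge of the strip, where it equals ‖f‖ and ‖F(iν)‖, so
Phragmén–Lindelöf applies. -/
theorem IsContinuation.norm_le {ν : ℝ} {f : L2} {F : ℂ → L2} (hF : IsContinuation ν f F) {M : ℝ}
    (h0 : ‖f‖ ≤ M) (h1 : ‖F (Complex.I * ν)‖ ≤ M) {z : ℂ}
    (hz : z.im ∈ Set.Icc (min 0 ν) (max 0 ν)) : ‖F z‖ ≤ M := by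
  have hb : ∀ w : ℂ, w.im = 0 ∨ w.im = ν → ‖F w‖ ≤ M := by
    rintro w (hw | hw)
    · rw [mk_re_im w, hw, hF.norm_add_ofReal (by simp)]
      simpa [hF.zero] using h0
    · rw [mk_re_im w, hw, hF.norm_add_ofReal (by simp)]
      exact h1
  refine PhragmenLindelof.horizontal_strip hF.diffContOnCl ?_ ?_ ?_ hz.1 hz.2
  · obtain ⟨C, hC⟩ := hF.bounded
    -- F is bounded, so the growth condition holds with zero multiplier and exponent -1. This also
    -- covers ν = 0, where the quotient by the zero width is 0.
    refine ⟨-1, ?_, 0, Asymptotics.IsBigO.of_bound C ?_⟩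
    · have : 0 ≤ max 0 ν - min 0 ν := by linarith [min_le_max (a := (0 : ℝ)) (b := ν)]
      have : 0 ≤ Real.pi / (max 0 ν - min 0 ν) := by positivity
      linarith
    · rw [eventually_inf_principal]
      refine Eventually.of_forall fun w hw => ?_
      simpa using hC w (Set.Ioo_subset_Icc_self hw)
  · intro w hw
    refine hb w ?_
    rcases min_choice 0 ν with h | h <;> rw [h] at hw <;> simp [hw]
  · intro w hw
    refine hb w ?_
    rcases max_choice 0 ν with h | h <;> rw [h] at hw <;> simp [hw]

/-- Translating the continuation by iν exchanges the two edges of the strip. -/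
theorem graph_T_neg {ν : ℝ} {f g : L2} (h : (f, g) ∈ (T ν).graph) : (g, f) ∈ (T (-ν)).graph := by
  rw [mem_graph_T] at h ⊢
  obtain ⟨F, hF, rfl⟩ := h
  have key : ∀ w : ℂ, w.im ∈ Set.Icc (min 0 (-ν)) (max 0 (-ν)) →
      (w + Complex.I * ν).im ∈ Set.Icc (min 0 ν) (max 0 ν) := by
    intro w hw
    rcases le_total 0 ν with h | h <;> simp [h] at hw ⊢ <;> constructor <;> linarith
  have key' : Set.MapsTo (fun w : ℂ => w + Complex.I * ν)
      (Complex.im ⁻¹' Set.Ioo (min 0 (-ν)) (max 0 (-ν)))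
      (Complex.im ⁻¹' Set.Ioo (min 0 ν) (max 0 ν)) := by
    intro w hw
    rcases le_total 0 ν with h | h <;> simp [h] at hw ⊢ <;> constructor <;> linarith
  refine ⟨fun w => F (w + Complex.I * ν),
    ⟨hF.diffContOnCl.comp (Differentiable.diffContOnCl (by fun_prop)) key', ?_, fun s => ?_⟩, ?_⟩
  · obtain ⟨C, hC⟩ := hF.bounded
    exact ⟨C, fun w hw => hC _ (key w hw)⟩
  · rw [add_comm, hF.add_ofReal (by simp)]
    exact isDilate_dil _ _
  · simp [hF.zero]

theorem mem_graph_T_neg {ν : ℝ} {f g : L2} : (f, g) ∈ (T (-ν)).graph ↔ (g, f) ∈ (T ν).graph :=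
  ⟨fun h => by simpa using graph_T_neg h, graph_T_neg⟩

theorem ker_eq_bot_of_graph {S : L2 →ₗ.[ℂ] L2} (h : ∀ f, (f, (0 : L2)) ∈ S.graph → f = 0) :
    LinearMap.ker S.toFun = ⊥ := by
  rw [LinearMap.ker_eq_bot']
  intro m hm
  refine Subtype.ext (h m ?_)
  rw [LinearPMap.mem_graph_iff]
  exact ⟨m, rfl, hm⟩

theorem graph_unique {S : L2 →ₗ.[ℂ] L2} {f g g' : L2} (h : (f, g) ∈ S.graph)
    (h' : (f, g') ∈ S.graph) : g = g' := LinearPMap.mem_graph_snd_inj S h h' rfl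

theorem ker_T (ν : ℝ) : LinearMap.ker (T ν).toFun = ⊥ :=
  ker_eq_bot_of_graph fun _ hf => graph_unique (graph_T_neg hf) (T (-ν)).graph.zero_mem

theorem mem_graph_inverse {S : L2 →ₗ.[ℂ] L2} (hS : LinearMap.ker S.toFun = ⊥) {f g : L2} :
    (f, g) ∈ S.inverse.graph ↔ (g, f) ∈ S.graph := by
  rw [LinearPMap.inverse_graph hS]
  simp only [Submodule.mem_map, Prod.exists]
  constructor
  · rintro ⟨a, b, hab, heq⟩
    simp only [LinearEquiv.coe_coe, LinearEquiv.prodComm_apply, Prod.swap_prod_mk,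
      Prod.mk.injEq] at heq
    rwa [← heq.1, ← heq.2]
  · intro h
    exact ⟨g, f, h, rfl⟩

theorem inverse_T (ν : ℝ) : (T ν).inverse = T (-ν) := by
  refine LinearPMap.eq_of_eq_graph ?_
  ext ⟨f, g⟩
  rw [mem_graph_inverse (ker_T ν), mem_graph_T_neg]

/-- By the bound from the edges, convergence in the graph forces uniform convergence of the
continuations on the closed strip, and the limit is again a continuation. -/
theorem isClosed_T (ν : ℝ) : IsClosed ((T ν).graph : Set (L2 × L2)) := by
  refine IsSeqClosed.isClosed fun p q hp hpq => ?_
  have h1 : ∀ n, ∃ F : ℂ → L2, IsContinuation ν (p n).1 F ∧ F (Complex.I * ν) = (p n).2 :=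
    fun n => (mem_graph_T ν _ _).1 (hp n)
  choose F hF hF' using h1
  set s := Complex.im ⁻¹' Set.Icc (min 0 ν) (max 0 ν) with hs
  have hC : UniformCauchySeqOn F atTop s := by
    rw [Metric.uniformCauchySeqOn_iff]
    intro ε hε
    obtain ⟨N, hN⟩ := Metric.cauchySeq_iff.1 hpq.cauchySeq (ε / 2) (by positivity)
    refine ⟨N, fun m hm n hn z hz => ?_⟩
    have hd := hN m hm n hn
    rw [Prod.dist_eq, max_lt_iff, dist_eq_norm, dist_eq_norm] at hd
    have hneg : (F n - F m) = F n + (-1 : ℂ) • F m := by rw [neg_one_smul, sub_eq_add_neg]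
    have hsub : IsContinuation ν ((p m).1 - (p n).1) (F m - F n) := by
      refine ⟨(hF m).1.sub (hF n).1, ?_, fun s => ?_⟩
      · obtain ⟨C, hC⟩ := (hF m).2
        obtain ⟨C', hC'⟩ := (hF n).2
        exact ⟨C + C', fun z hz => (norm_sub_le _ _).trans (add_le_add (hC z hz) (hC' z hz))⟩
      · rw [isDilate_iff, Pi.sub_apply, (hF m).ofReal, (hF n).ofReal, map_sub]
    have := hsub.norm_le (M := ε / 2) hd.1.le (by rw [Pi.sub_apply, hF', hF']; exact hd.2.le) hz
    rw [dist_eq_norm]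
    exact lt_of_le_of_lt this (by linarith)
  let G : ℂ → L2 := fun z => limUnder atTop fun n => F n z
  have hG : TendstoUniformlyOn F G atTop s :=
    hC.tendstoUniformlyOn_of_tendsto fun z hz => 
      CauchySeq.tendsto_limUnder (u := fun n => F n z) (hC.cauchySeq hz)
  have hcont : ∀ n, ContinuousOn (F n) (closure (Complex.im ⁻¹' Set.Ioo (min 0 ν) (max 0 ν))) :=
    fun n => (hF n).1.continuousOn
  rw [SetLike.mem_coe, show q = (q.1, q.2) from rfl, mem_graph_T]
  refine ⟨G, ⟨⟨?_, ?_⟩, ?_, fun r => ?_⟩, ?_⟩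
  · refine TendstoLocallyUniformlyOn.differentiableOn
      (hG.mono (Set.preimage_mono Set.Ioo_subset_Icc_self)).tendstoLocallyUniformlyOn
      (Eventually.of_forall fun n => (hF n).1.differentiableOn) (isOpen_strip ν)
  · exact (hG.mono (closure_strip_subset ν)).continuousOn
      (Eventually.of_forall hcont).frequently
  · obtain ⟨n, hn⟩ := ((Metric.tendstoUniformlyOn_iff.1 hG) 1 one_pos).exists
    obtain ⟨C, hC⟩ := (hF n).2
    refine ⟨1 + C, fun z hz => ?_⟩
    have := hn z hz
    rw [dist_eq_norm] at this
    calc ‖G z‖ = ‖(G z - F n z) + F n z‖ := by rw [sub_add_cancel]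
      _ ≤ 1 + C := (norm_add_le _ _).trans (add_le_add this.le (hC z hz))
  · rw [isDilate_iff]
    refine tendsto_nhds_unique (hG.tendsto_at (x := (r : ℂ)) (by simp [hs])) ?_
    have : (fun n => F n r) = fun n => dil r (p n).1 := funext fun n => (hF n).ofReal r
    rw [this]
    exact ((dil r).continuous.tendsto _).comp ((continuous_fst.tendsto _).comp hpq)
  · refine tendsto_nhds_unique (hG.tendsto_at (x := Complex.I * ν) (by simp [hs])) ?_
    simp_rw [hF']
    exact (continuous_snd.tendsto _).comp hpq

/-! ### Gaussian averages of the dilation group -/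

/-- The weight `e^{-a s² + b s}`. -/
def weight (a : ℝ) (b : ℂ) (s : ℝ) : ℂ := Complex.exp (-(a : ℂ) * s ^ 2 + b * s)

theorem continuous_weight (a : ℝ) (b : ℂ) : Continuous (weight a b) := by
  unfold weight; fun_prop

theorem integrable_weight {a : ℝ} (ha : 0 < a) (b : ℂ) : Integrable (weight a b) := by
  have := integrable_cexp_quadratic (b := (a : ℂ)) (by simpa using ha) b 0
  simp only [add_zero] at this
  exact this

theorem norm_weight (a : ℝ) (b : ℂ) (s : ℝ) :
    ‖weight a b s‖ = Real.exp (-a * s ^ 2 + b.re * s) := by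
  rw [weight, Complex.norm_exp]
  congr 1
  simp [pow_two]

/-- A weight dominating `(1 + |s|)` times the weights with parameter in the disc of radius `r`. -/
def majorant (a r s : ℝ) : ℝ :=
  Real.exp (-a * s ^ 2 + (r + 1) * s) + Real.exp (-a * s ^ 2 + -(r + 1) * s)

theorem integrable_majorant {a : ℝ} (ha : 0 < a) (r : ℝ) : Integrable (majorant a r) := by
  have h : ∀ b : ℝ, Integrable fun s : ℝ => Real.exp (-a * s ^ 2 + b * s) := by
    intro b
    simpa [norm_weight] using (integrable_weight ha (b : ℂ)).norm
  exact (h _).add (h _)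

theorem one_add_abs_mul_norm_weight_le {a : ℝ} {b : ℂ} {r : ℝ} (hb : ‖b‖ ≤ r) (s : ℝ) :
    (1 + |s|) * ‖weight a b s‖ ≤ majorant a r s := by
  have h1 : 1 + |s| ≤ Real.exp |s| := by linarith [Real.add_one_le_exp |s|]
  have h2 : b.re * s ≤ r * |s| := by
    calc b.re * s ≤ |b.re * s| := le_abs_self _
      _ = |b.re| * |s| := abs_mul _ _
      _ ≤ r * |s| := by gcongr; exact (Complex.abs_re_le_norm b).trans hb
  calc (1 + |s|) * ‖weight a b s‖ ≤ Real.exp |s| * Real.exp (-a * s ^ 2 + r * |s|) := by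
        rw [norm_weight]
        gcongr
    _ = Real.exp (-a * s ^ 2 + (r + 1) * |s|) := by rw [← Real.exp_add]; ring_nf
    _ ≤ _ := by
        unfold majorant
        rcases abs_cases s with ⟨h, _⟩ | ⟨h, _⟩ <;> rw [h]
        · linarith [Real.exp_pos (-a * s ^ 2 + -(r + 1) * s)]
        · rw [show (r + 1) * -s = -(r + 1) * s by ring]
          linarith [Real.exp_pos (-a * s ^ 2 + (r + 1) * s)]

theorem integrable_weight_smul_dil {a : ℝ} (ha : 0 < a) (b : ℂ) (f : L2) :
    Integrable fun s => weight a b s • dil s f := by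
  refine (integrable_weight ha b).smul_bdd ‖f‖
    (continuous_dil f).aestronglyMeasurable (ae_of_all _ fun s => ?_)
  exact ((dil s).norm_map f).le

/-- The average `∫ e^{-a s² + b s} e^{sG} ds` of the dilation group. -/
def average {a : ℝ} (ha : 0 < a) (b : ℂ) : L2 →L[ℂ] L2 :=
  LinearMap.mkContinuous
    { toFun := fun f => ∫ s, weight a b s • dil s f
      map_add' := fun f g => by
        simp_rw [map_add, smul_add]
        exact integral_add (integrable_weight_smul_dil ha b f) (integrable_weight_smul_dil ha b g)
      map_smul' := fun c f => by
        simp_rw [map_smul, smul_comm _ c]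
        exact integral_smul c _ } (∫ s, ‖weight a b s‖) fun f => by
    refine (norm_integral_le_integral_norm _).trans (le_of_eq ?_)
    simp_rw [norm_smul, (dil _).norm_map]
    exact integral_mul_const _ _

theorem average_apply {a : ℝ} (ha : 0 < a) (b : ℂ) (f : L2) :
    average ha b f = ∫ s, weight a b s • dil s f := rfl

theorem average_dil {a : ℝ} (ha : 0 < a) (b : ℂ) (r : ℝ) (f : L2) :
    average ha b (dil r f) = dil r (average ha b f) := by
  rw [average_apply, average_apply]
  refine Eq.trans ?_ ((dil r).toContinuousLinearMap.integral_comp_comm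
    (integrable_weight_smul_dil ha b f))
  refine integral_congr_ae (ae_of_all _ fun s => ?_)
  change weight a b s • dil s (dil r f) = dil r (weight a b s • dil s f)
  rw [map_smul, ← dil_add, ← dil_add, add_comm]

theorem weight_sub (a : ℝ) (b : ℂ) (s r : ℝ) :
    weight a b (s - r) = Complex.exp (-a * r ^ 2 - b * r) * weight a (b + 2 * a * r) s := by
  rw [weight, weight, ← Complex.exp_add]
  congr 1
  push_cast
  ring

/-- Translating the integration variable moves the dilation into the weight, where it only rescales
and shifts b. The right-hand side makes sense for complex r, which is what gives averages an entire
orbit. -/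
theorem dil_average {a : ℝ} (ha : 0 < a) (b : ℂ) (r : ℝ) (f : L2) :
    dil r (average ha b f) =
      Complex.exp (-a * r ^ 2 - b * r) • average ha (b + 2 * a * r) f := by
  rw [← average_dil, average_apply, average_apply, ← integral_smul]
  rw [← integral_sub_right_eq_self (fun s => weight a b s • dil s (dil r f)) r]
  refine integral_congr_ae (ae_of_all _ fun s => ?_)
  change weight a b (s - r) • dil (s - r) (dil r f) = _
  rw [← dil_add, sub_add_cancel, weight_sub, mul_smul]

theorem differentiable_average {a : ℝ} (ha : 0 < a) (f : L2) :
    Differentiable ℂ fun b => average ha b f := by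
  intro b
  have hlt : ∀ x ∈ Metric.ball b 1, ‖x‖ ≤ ‖b‖ + 1 := fun x hx => by
    have h1 : ‖x - b‖ < 1 := by simpa [dist_eq_norm] using hx
    calc ‖x‖ = ‖b + (x - b)‖ := by congr 1; ring
      _ ≤ _ := (norm_add_le _ _).trans (by linarith)
  have hc : Continuous fun s => dil s f := continuous_dil f
  refine (hasDerivAt_integral_of_dominated_loc_of_deriv_le (𝕜 := ℂ)
    (F := fun b s => weight a b s • dil s f)
    (F' := fun b s => ((s : ℂ) * weight a b s) • dil s f)
    (bound := fun s => majorant a (‖b‖ + 1) s * ‖f‖) (Metric.ball_mem_nhds b one_pos)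
    (Eventually.of_forall fun x => (integrable_weight_smul_dil ha x f).aestronglyMeasurable)
    (integrable_weight_smul_dil ha b f) ?_ ?_ ?_ ?_).2.differentiableAt
  · exact (((Complex.continuous_ofReal.mul (continuous_weight a b)).smul hc)).aestronglyMeasurable
  · refine ae_of_all _ fun s x hx => ?_
    rw [norm_smul, norm_mul, (dil s).norm_map, Complex.norm_real, Real.norm_eq_abs]
    gcongr
    refine le_trans ?_ (one_add_abs_mul_norm_weight_le (hlt x hx) s)
    gcongr
    linarith
  · exact (integrable_majorant ha _).mul_const _
  · refine ae_of_all _ fun s x _ => ?_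
    have h1 : HasDerivAt (fun b => weight a b s) (weight a x s * s) x := by
      unfold weight
      refine HasDerivAt.cexp ?_
      simpa using ((hasDerivAt_id x).mul_const (s : ℂ)).const_add (-(a : ℂ) * s ^ 2)
    rw [mul_comm]
    exact h1.smul_const _

/-- The continuation of the orbit of a Gaussian average. -/
def averageOrbit {a : ℝ} (ha : 0 < a) (b : ℂ) (f : L2) (z : ℂ) : L2 :=
  Complex.exp (-a * z ^ 2 - b * z) • average ha (b + 2 * a * z) f

theorem differentiable_averageOrbit {a : ℝ} (ha : 0 < a) (b : ℂ) (f : L2) :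
    Differentiable ℂ (averageOrbit ha b f) := by
  refine Differentiable.smul
    (by fun_prop : Differentiable ℂ fun z : ℂ => Complex.exp (-(a : ℂ) * z ^ 2 - b * z)) ?_
  exact (differentiable_average ha f).comp
    (by fun_prop : Differentiable ℂ fun z : ℂ => b + 2 * (a : ℂ) * z)

theorem averageOrbit_add {a : ℝ} (ha : 0 < a) (b : ℂ) (f : L2) (z : ℂ) (r : ℝ) :
    averageOrbit ha b f (z + r) = dil r (averageOrbit ha b f z) := by
  rw [averageOrbit, averageOrbit, map_smul, dil_average, smul_smul, ← Complex.exp_add]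
  congr 2 <;> ring_nf

/-- An orbit map that is holomorphic near the closed strip is a continuation. -/
theorem isContinuation_of_differentiableOn {ν : ℝ} {f : L2} {F : ℂ → L2} {U : Set ℝ}
    (hνU : Set.Icc (min 0 ν) (max 0 ν) ⊆ U)
    (hd : DifferentiableOn ℂ F (Complex.im ⁻¹' U)) (h0 : F 0 = f)
    (hadd : ∀ z : ℂ, z.im ∈ U → ∀ r : ℝ, F (z + r) = dil r (F z)) : IsContinuation ν f F := by
  have hsub : closure (Complex.im ⁻¹' Set.Ioo (min 0 ν) (max 0 ν)) ⊆ Complex.im ⁻¹' U :=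
    (closure_strip_subset ν).trans (Set.preimage_mono hνU)
  refine ⟨(hd.mono hsub).diffContOnCl, ?_, fun s => ?_⟩
  -- Translation along the real direction preserves norms, so a bound on a compact vertical segment
  -- suffices.
  · have hc : ContinuousOn (fun t : ℝ => F (Complex.I * t)) (Set.Icc (min 0 ν) (max 0 ν)) := by
      refine hd.continuousOn.comp (by fun_prop) fun t ht => ?_
      simpa using hνU ht
    obtain ⟨C, hC⟩ := isCompact_Icc.exists_bound_of_continuousOn hc
    refine ⟨C, fun z hz => ?_⟩
    rw [mk_re_im z, hadd _ (by simpa using hνU hz), (dil _).norm_map]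
    exact hC _ hz
  · rw [isDilate_iff]
    simpa [h0] using hadd 0 (hνU (zero_im_mem ν)) s

theorem isContinuation_averageOrbit {a : ℝ} (ha : 0 < a) (b : ℂ) (f : L2) (ν : ℝ) :
    IsContinuation ν (average ha b f) (averageOrbit ha b f) :=
  isContinuation_of_differentiableOn (Set.subset_univ _)
    (differentiable_averageOrbit ha b f).differentiableOn (by simp [averageOrbit])
    fun z _ r => averageOrbit_add ha b f z r

theorem average_mem_graph_T {a : ℝ} (ha : 0 < a) (b : ℂ) (f : L2) (ν : ℝ) :
    (average ha b f, Complex.exp (a * ν ^ 2 - Complex.I * b * ν) •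
      average ha (b + 2 * Complex.I * a * ν) f) ∈ (T ν).graph := by
  rw [mem_graph_T]
  refine ⟨_, isContinuation_averageOrbit ha b f ν, ?_⟩
  rw [averageOrbit]
  congr 2
  · rw [mul_pow, Complex.I_sq]; ring
  · congr 1; ring

theorem average_comm_T {a : ℝ} (ha : 0 < a) (b : ℂ) {f g : L2} {ν : ℝ}
    (h : (f, g) ∈ (T ν).graph) : (average ha b f, average ha b g) ∈ (T ν).graph := by
  rw [mem_graph_T] at h ⊢
  obtain ⟨F, hF, rfl⟩ := h
  refine ⟨fun z => average ha b (F z), ⟨?_, ?_, fun s => ?_⟩, rfl⟩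
  · exact (average ha b).differentiable.comp_diffContOnCl hF.diffContOnCl
  · obtain ⟨C, hC⟩ := hF.bounded
    exact ⟨‖average ha b‖ * C, fun z hz => (average ha b).le_opNorm_of_le (hC z hz)⟩
  · rw [isDilate_iff, hF.ofReal, average_dil]

theorem weight_neg_conj (a : ℝ) (b : ℂ) (s : ℝ) :
    (starRingEnd ℂ) (weight a b (-s)) = weight a (-(starRingEnd ℂ) b) s := by
  rw [weight, weight, ← Complex.exp_conj]
  congr 1
  simp

/-- The adjoint of e^{sG} is e^{-sG}; substitute -s for s. In particular the average is symmetric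
when b is purely imaginary. -/
theorem inner_average {a : ℝ} (ha : 0 < a) (b : ℂ) (f g : L2) :
    inner ℂ (average ha b f) g = inner ℂ f (average ha (-(starRingEnd ℂ) b) g) := by
  rw [← inner_conj_symm, average_apply, average_apply,
    ← integral_inner (integrable_weight_smul_dil ha b f),
    ← integral_inner (integrable_weight_smul_dil ha _ g), ← integral_conj,
    ← integral_neg_eq_self]
  refine integral_congr_ae (ae_of_all _ fun s => ?_)
  simp only [inner_smul_right, map_mul, inner_conj_symm, weight_neg_conj]
  rw [inner_dil s f g]

theorem real_smul_eq_coe_smul (r : ℝ) (f : L2) : r • f = (r : ℂ) • f :=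
  RCLike.real_smul_eq_coe_smul (K := ℂ) r f

/-- Gaussian averages that approximate the identity. -/
def approxId (c : ℝ) : L2 →L[ℂ] L2 :=
  ((c / Real.sqrt Real.pi : ℝ) : ℂ) • average (a := c ^ 2 + 1) (by positivity) 0

/-- The kernel c π^{-1/2} e^{-c²s²} is an approximate identity. The 1 in c² + 1 supplies a factor
e^{-s²}, which makes the orbit integrable and equals 1 at s = 0. -/
theorem tendsto_approxId (f : L2) : Tendsto (fun c => approxId c f) atTop (𝓝 f) := by
  have h1 : ∫ x : ℝ, Real.exp (-(1 : ℝ) * x ^ 2) / Real.sqrt Real.pi = 1 := by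
    rw [integral_div, integral_gaussian, div_one, div_self]
    positivity
  have h2 : Tendsto (fun x : ℝ => ‖x‖ ^ Module.finrank ℝ ℝ *
      (Real.exp (-(1 : ℝ) * x ^ 2) / Real.sqrt Real.pi)) (Bornology.cobounded ℝ) (𝓝 0) := by
    rw [Metric.cobounded_eq_cocompact]
    have := (tendsto_rpow_abs_mul_exp_neg_mul_sq_cocompact one_pos 1).div_const
      (Real.sqrt Real.pi)
    simpa [mul_div_assoc] using this
  have h3 : Integrable fun s => weight 1 0 s • dil s f := integrable_weight_smul_dil one_pos 0 f
  have h4 := tendsto_integral_comp_smul_smul_of_integrable (fun x => by positivity) h1 h2 h3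
    (((continuous_weight 1 0).smul (continuous_dil f)).continuousAt)
  simp only [Module.finrank_self, pow_one, weight, dil_zero] at h4
  refine Tendsto.congr (fun c => ?_) (h4.trans_eq (by simp))
  rw [approxId, smul_apply, average_apply, ← integral_smul]
  refine integral_congr_ae (ae_of_all _ fun s => ?_)
  simp only [weight]
  rw [real_smul_eq_coe_smul, smul_smul, smul_smul]
  congr 1
  rw [zero_mul, add_zero, add_zero, show -((c ^ 2 + 1 : ℝ) : ℂ) * (s : ℂ) ^ 2 =
    (-(1 : ℝ) * ((c : ℂ) * s) ^ 2) + (-(1 : ℝ) * (s : ℂ) ^ 2) by push_cast; ring,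
    Complex.exp_add]
  push_cast [smul_eq_mul]
  ring

theorem inner_approxId (c : ℝ) (f g : L2) :
    inner ℂ (approxId c f) g = inner ℂ f (approxId c g) := by
  simp only [approxId, smul_apply, inner_smul_left, inner_smul_right,
    inner_average, Complex.conj_ofReal, map_zero, neg_zero]

theorem approxId_comm_T (c : ℝ) {f g : L2} {ν : ℝ} (h : (f, g) ∈ (T ν).graph) :
    (approxId c f, approxId c g) ∈ (T ν).graph :=
  (T ν).graph.smul_mem _ (average_comm_T _ 0 h)

/-- The composition of `T_ν` with the Gaussian averages that approximate the identity. -/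
def approxT (c ν : ℝ) : L2 →L[ℂ] L2 :=
  ((c / Real.sqrt Real.pi * Real.exp ((c ^ 2 + 1) * ν ^ 2) : ℝ) : ℂ) •
    average (a := c ^ 2 + 1) (by positivity) (2 * Complex.I * (c ^ 2 + 1 : ℝ) * ν)

theorem approxId_mem_graph_T (c ν : ℝ) (f : L2) : (approxId c f, approxT c ν f) ∈ (T ν).graph := by
  have := (T ν).graph.smul_mem ((c / Real.sqrt Real.pi : ℝ) : ℂ)
    (average_mem_graph_T (a := c ^ 2 + 1) (by positivity) 0 f ν)
  rw [Prod.smul_mk, smul_smul, zero_add] at this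
  refine (congrArg (fun g => (approxId c f, g) ∈ (T ν).graph) ?_).mpr this
  change ((c / Real.sqrt Real.pi * Real.exp ((c ^ 2 + 1) * ν ^ 2) : ℝ) : ℂ) • average _ _ f = _
  congr 1
  push_cast
  simp

/-- The prefactor is real and the parameter 2i(c² + 1)ν is purely imaginary, hence fixed by b ↦
-conj b. -/
theorem inner_approxT (c ν : ℝ) (f g : L2) :
    inner ℂ (approxT c ν f) g = inner ℂ f (approxT c ν g) := by
  simp only [approxT, smul_apply, inner_smul_left, inner_smul_right,
    inner_average, Complex.conj_ofReal, map_mul, Complex.conj_I, Complex.conj_ofNat, mul_neg,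
    neg_mul, neg_neg]

/-- The approximations also map into the domain of T_ν², as needed for the metric operator. -/
theorem approxT_mem_domain_T (c ν : ℝ) (f : L2) : ∃ g, (approxT c ν f, g) ∈ (T ν).graph := by
  have := (T ν).graph.smul_mem
    ((c / Real.sqrt Real.pi * Real.exp ((c ^ 2 + 1) * ν ^ 2) : ℝ) : ℂ)
    (average_mem_graph_T (a := c ^ 2 + 1) (by positivity)
      (2 * Complex.I * (c ^ 2 + 1 : ℝ) * ν) f ν)
  exact ⟨_, this⟩

/-! ### Self-adjointness -/

theorem dense_domain_of_graph {S : L2 →ₗ.[ℂ] L2} (R : ℝ → L2 →L[ℂ] L2)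
    (hR : ∀ f, Tendsto (fun c => R c f) atTop (𝓝 f)) (hdom : ∀ c f, ∃ g, (R c f, g) ∈ S.graph) :
    Dense (S.domain : Set L2) := fun f =>
  mem_closure_of_tendsto (hR f) (Eventually.of_forall fun c => by
    obtain ⟨g, hg⟩ := hdom c f
    exact LinearPMap.mem_domain_of_mem_graph hg)

theorem isSelfAdjoint_iff_graph {S : L2 →ₗ.[ℂ] L2} (hS : Dense (S.domain : Set L2)) :
    IsSelfAdjoint S ↔ ∀ x y : L2, (x, y) ∈ S.graph ↔
      ∀ f g : L2, (f, g) ∈ S.graph → inner ℂ g x = inner ℂ f y := by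
  rw [LinearPMap.isSelfAdjoint_def]
  have key : ∀ x y : L2, (x, y) ∈ S.adjoint.graph ↔
      ∀ f g : L2, (f, g) ∈ S.graph → inner ℂ g x = inner ℂ f y := by
    intro x y
    rw [LinearPMap.adjoint_graph_eq_graph_adjoint hS, Submodule.mem_adjoint_iff]
    simp only [sub_eq_zero]
  constructor
  · intro h x y
    rw [← key, h]
  · intro h
    refine LinearPMap.eq_of_eq_graph ?_
    ext ⟨x, y⟩
    rw [key, h]

/-- A closed symmetric operator that commutes with bounded self-adjoint operators which converge
strongly to the identity and map into its domain is self-adjoint. -/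
theorem isSelfAdjoint_of_approx {S : L2 →ₗ.[ℂ] L2} (R : ℝ → L2 →L[ℂ] L2)
    (hR : ∀ f, Tendsto (fun c => R c f) atTop (𝓝 f))
    (hRsymm : ∀ c f g, inner ℂ (R c f) g = inner ℂ f (R c g))
    (hdom : ∀ c f, ∃ g, (R c f, g) ∈ S.graph)
    (hcomm : ∀ c f g, (f, g) ∈ S.graph → (R c f, R c g) ∈ S.graph)
    (hsymm : ∀ f g f' g', (f, g) ∈ S.graph → (f', g') ∈ S.graph → inner ℂ g f' = inner ℂ f g')
    (hclosed : IsClosed (S.graph : Set (L2 × L2))) : IsSelfAdjoint S := by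
  have hdense := dense_domain_of_graph R hR hdom
  rw [isSelfAdjoint_iff_graph hdense]
  refine fun x y => ⟨fun h f g hfg => hsymm f g x y hfg h, fun h => ?_⟩
  -- For (x, y) in the adjoint graph it suffices that (R_c x, R_c y) lies in the graph of S, since
  -- this pair tends to (x, y) and the graph is closed. The value of S at R_c x is identified by
  -- pairing with the dense domain.
  refine hclosed.mem_of_tendsto ((hR x).prodMk_nhds (hR y)) (Eventually.of_forall fun c => ?_)
  obtain ⟨z, hz⟩ := hdom c x
  have : z = R c y := by
    refine hdense.eq_of_inner_right ℂ fun f hf => ?_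
    have hfg := LinearPMap.mem_graph S ⟨f, hf⟩
    calc inner ℂ f z = inner ℂ (S ⟨f, hf⟩) (R c x) := (hsymm _ _ _ _ hfg hz).symm
      _ = inner ℂ (R c (S ⟨f, hf⟩)) x := (hRsymm _ _ _).symm
      _ = inner ℂ (R c f) y := h _ _ (hcomm c _ _ hfg)
      _ = _ := hRsymm _ _ _
  exact this ▸ hz

/-- On the domain, `approxT` is R_c T_ν, and it is a bounded symmetric operator; let c tend to
infinity. -/
theorem T_symmetric {ν : ℝ} {f g f' g' : L2} (h : (f, g) ∈ (T ν).graph)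
    (h' : (f', g') ∈ (T ν).graph) : inner ℂ g f' = inner ℂ f g' := by
  have h1 : ∀ {f g : L2}, (f, g) ∈ (T ν).graph → ∀ c, approxT c ν f = approxId c g :=
    fun h c => graph_unique (approxId_mem_graph_T c ν _) (approxId_comm_T c h)
  have h2 : ∀ c, inner ℂ (approxId c g) f' = inner ℂ f (approxId c g') := fun c => by
    rw [← h1 h, ← h1 h', inner_approxT]
  have h3 : Tendsto (fun c => inner ℂ (approxId c g) f') atTop (𝓝 (inner ℂ g f')) :=
    (tendsto_approxId g).inner tendsto_const_nhds
  have h4 : Tendsto (fun c => inner ℂ f (approxId c g')) atTop (𝓝 (inner ℂ f g')) :=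
    tendsto_const_nhds.inner (tendsto_approxId g')
  simp_rw [h2] at h3
  exact tendsto_nhds_unique h3 h4

theorem isSelfAdjoint_T (ν : ℝ) : IsSelfAdjoint (T ν) :=
  isSelfAdjoint_of_approx approxId tendsto_approxId inner_approxId
    (fun c f => ⟨_, approxId_mem_graph_T c ν f⟩) (fun c _ _ h => approxId_comm_T c h)
    (fun _ _ _ _ => T_symmetric) (isClosed_T ν)

theorem dense_domain_T (ν : ℝ) : Dense ((T ν).domain : Set L2) := (isSelfAdjoint_T ν).dense_domain

theorem adjoint_inverse_T (ν : ℝ) : (T ν).inverse.adjoint = T (-ν) := by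
  rw [inverse_T]
  exact isSelfAdjoint_T (-ν)

theorem T_sq_symmetric {ν : ℝ} {f g f' g' : L2} (h : (f, g) ∈ (pcomp (T ν) (T ν)).graph)
    (h' : (f', g') ∈ (pcomp (T ν) (T ν)).graph) : inner ℂ g f' = inner ℂ f g' := by
  rw [mem_graph_pcomp] at h h'
  obtain ⟨k, h1, h2⟩ := h
  obtain ⟨k', h1', h2'⟩ := h'
  rw [T_symmetric h2 h1', T_symmetric h1 h2']

/-- Since ‖T f‖² = ⟨f, T² f⟩ ≤ ‖f‖ ‖T² f‖, convergence of f and T² f makes the intermediate vectors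
T f Cauchy. -/
theorem isClosed_T_sq (ν : ℝ) : IsClosed ((pcomp (T ν) (T ν)).graph : Set (L2 × L2)) := by
  refine IsSeqClosed.isClosed fun p q hp hpq => ?_
  have hp' : ∀ n, ∃ k, ((p n).1, k) ∈ (T ν).graph ∧ (k, (p n).2) ∈ (T ν).graph :=
    fun n => (mem_graph_pcomp _ _ _ _).1 (hp n)
  choose k hk hk' using hp'
  have hb : ∀ m n, dist (k m) (k n) ≤ dist (p m) (p n) := by
    intro m n
    have h1 := (T ν).graph.sub_mem (hk m) (hk n)
    have h2 := (T ν).graph.sub_mem (hk' m) (hk' n)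
    have h3 : ‖k m - k n‖ ^ 2 ≤ dist (p m) (p n) ^ 2 := by
      have h4 : ‖k m - k n‖ ^ 2 = (inner ℂ ((p m).1 - (p n).1) ((p m).2 - (p n).2) : ℂ).re := by
        rw [← T_symmetric h1 h2, inner_self_eq_norm_sq_to_K]
        simp [pow_two]
      rw [h4, pow_two]
      refine (Complex.re_le_norm _).trans ((norm_inner_le_norm _ _).trans ?_)
      rw [← dist_eq_norm, ← dist_eq_norm, Prod.dist_eq]
      gcongr
      · exact le_max_left _ _
      · exact le_max_right _ _
    rw [dist_eq_norm]
    exact (pow_le_pow_iff_left₀ (norm_nonneg _) dist_nonneg two_ne_zero).1 h3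
  have hC : CauchySeq k := by
    rw [Metric.cauchySeq_iff]
    intro ε hε
    obtain ⟨N, hN⟩ := Metric.cauchySeq_iff.1 hpq.cauchySeq ε hε
    exact ⟨N, fun m hm n hn => (hb m n).trans_lt (hN m hm n hn)⟩
  obtain ⟨l, hl⟩ := cauchySeq_tendsto_of_complete hC
  rw [SetLike.mem_coe, show q = (q.1, q.2) from rfl, mem_graph_pcomp]
  exact ⟨l, (isClosed_T ν).mem_of_tendsto
    (((continuous_fst.tendsto _).comp hpq).prodMk_nhds hl) (Eventually.of_forall hk),
    (isClosed_T ν).mem_of_tendsto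
    (hl.prodMk_nhds ((continuous_snd.tendsto _).comp hpq)) (Eventually.of_forall hk')⟩

theorem approxId_mem_domain_T_sq (c ν : ℝ) (f : L2) :
    ∃ g, (approxId c f, g) ∈ (pcomp (T ν) (T ν)).graph := by
  obtain ⟨g, hg⟩ := approxT_mem_domain_T c ν f
  exact ⟨g, (mem_graph_pcomp _ _ _ _).2 ⟨_, approxId_mem_graph_T c ν f, hg⟩⟩

theorem isSelfAdjoint_T_sq (ν : ℝ) : IsSelfAdjoint (pcomp (T ν) (T ν)) := by
  refine isSelfAdjoint_of_approx approxId tendsto_approxId inner_approxId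
    (fun c f => approxId_mem_domain_T_sq c ν f) (fun c f g h => ?_)
    (fun _ _ _ _ => T_sq_symmetric) (isClosed_T_sq ν)
  rw [mem_graph_pcomp] at h ⊢
  obtain ⟨k, h1, h2⟩ := h
  exact ⟨_, approxId_comm_T c h1, approxId_comm_T c h2⟩

/-! ### The metric operator -/

/-- The normalisation of the metric operator. -/
def metricConst (N₁ : ℂ) : ℝ := 1 / (Real.pi * ‖N₁‖ ^ 2)

theorem metricConst_pos {N₁ : ℂ} (hN : N₁ ≠ 0) : 0 < metricConst N₁ := by
  have := Real.pi_pos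
  have := norm_pos_iff.2 hN
  unfold metricConst
  positivity

theorem mem_graph_smul {S : L2 →ₗ.[ℂ] L2} {c : ℂ} {f g : L2} :
    (f, g) ∈ (c • S).graph ↔ ∃ k, (f, k) ∈ S.graph ∧ g = c • k := by
  simp only [LinearPMap.mem_graph_iff]
  constructor
  · rintro ⟨x, rfl, rfl⟩
    exact ⟨_, ⟨x, rfl, rfl⟩, rfl⟩
  · rintro ⟨_, ⟨x, rfl, rfl⟩, rfl⟩
    exact ⟨x, rfl, rfl⟩

theorem isSelfAdjoint_smul {S : L2 →ₗ.[ℂ] L2} (hS : IsSelfAdjoint S) {r : ℝ} (hr : r ≠ 0) :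
    IsSelfAdjoint ((r : ℂ) • S) := by
  have hr' : (r : ℂ) ≠ 0 := Complex.ofReal_ne_zero.2 hr
  have h := (isSelfAdjoint_iff_graph hS.dense_domain).1 hS
  rw [isSelfAdjoint_iff_graph (S := (r : ℂ) • S) hS.dense_domain]
  intro x y
  rw [mem_graph_smul]
  constructor
  · rintro ⟨k, hk, rfl⟩ f g hfg
    obtain ⟨l, hl, rfl⟩ := mem_graph_smul.1 hfg
    rw [inner_smul_left, inner_smul_right, Complex.conj_ofReal, (h _ _).1 hk _ _ hl]
  · intro H
    refine ⟨(r : ℂ)⁻¹ • y, (h _ _).2 fun f g hfg => ?_, by rw [smul_inv_smul₀ hr']⟩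
    have := H f _ (mem_graph_smul.2 ⟨g, hfg, rfl⟩)
    rw [inner_smul_left, Complex.conj_ofReal] at this
    rw [inner_smul_right, ← this, inv_mul_cancel_left₀ hr']

theorem Theta_eq (ν : ℝ) (N₁ : ℂ) :
    Theta ν N₁ = ((metricConst N₁ : ℝ) : ℂ) • pcomp (T (-ν)) (T (-ν)) := by
  rw [Theta, inverse_T, metricConst]

theorem mem_graph_Theta {ν : ℝ} {N₁ : ℂ} {f g : L2} :
    (f, g) ∈ (Theta ν N₁).graph ↔ ∃ k l, (f, k) ∈ (T (-ν)).graph ∧ (k, l) ∈ (T (-ν)).graph ∧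
      g = ((metricConst N₁ : ℝ) : ℂ) • l := by
  rw [Theta_eq, mem_graph_smul]
  simp only [mem_graph_pcomp]
  constructor
  · rintro ⟨l, ⟨k, h1, h2⟩, h3⟩
    exact ⟨k, l, h1, h2, h3⟩
  · rintro ⟨k, l, h1, h2, h3⟩
    exact ⟨l, ⟨k, h1, h2⟩, h3⟩

theorem isSelfAdjoint_Theta (ν : ℝ) {N₁ : ℂ} (hN : N₁ ≠ 0) : IsSelfAdjoint (Theta ν N₁) := by
  rw [Theta_eq]
  exact isSelfAdjoint_smul (isSelfAdjoint_T_sq (-ν)) (metricConst_pos hN).ne'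

theorem eq_zero_of_graph_T {ν : ℝ} {f : L2} (h : (f, (0 : L2)) ∈ (T ν).graph) : f = 0 :=
  graph_unique (graph_T_neg h) (T (-ν)).graph.zero_mem

/-- By symmetry, ⟨f, Θ f⟩ is a positive multiple of ‖T_{-ν} f‖², and T_{-ν} is injective. -/
theorem Theta_pos (ν : ℝ) {N₁ : ℂ} (hN : N₁ ≠ 0) (f : (Theta ν N₁).domain) (hf : (f : L2) ≠ 0) :
    0 < (inner ℂ (f : L2) (Theta ν N₁ f)).re := by
  obtain ⟨k, l, h1, h2, h3⟩ := mem_graph_Theta.1 (LinearPMap.mem_graph (Theta ν N₁) f)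
  rw [h3, inner_smul_right, ← T_symmetric h1 h2, inner_self_eq_norm_sq_to_K]
  have hk : k ≠ 0 := by
    rintro rfl
    exact hf (eq_zero_of_graph_T h1)
  have h4 := norm_pos_iff.2 hk
  have h5 := metricConst_pos hN
  have : ((metricConst N₁ : ℝ) : ℂ) * (RCLike.ofReal ‖k‖ : ℂ) ^ 2 =
      ((metricConst N₁ * ‖k‖ ^ 2 : ℝ) : ℂ) := by simp
  rw [this, Complex.ofReal_re]
  positivity

theorem ker_Theta (ν : ℝ) {N₁ : ℂ} (hN : N₁ ≠ 0) : LinearMap.ker (Theta ν N₁).toFun = ⊥ := by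
  refine ker_eq_bot_of_graph fun f hf => ?_
  obtain ⟨k, l, h1, h2, h3⟩ := mem_graph_Theta.1 hf
  have : l = 0 := by
    refine (smul_eq_zero.1 h3.symm).resolve_left ?_
    exact Complex.ofReal_ne_zero.2 (metricConst_pos hN).ne'
  subst this
  have hk := eq_zero_of_graph_T h2
  subst hk
  exact eq_zero_of_graph_T h1

theorem mem_graph_Theta_inverse {ν : ℝ} {N₁ : ℂ} (hN : N₁ ≠ 0) {f g : L2} :
    (f, g) ∈ (Theta ν N₁).inverse.graph ↔ (g, f) ∈ (Theta ν N₁).graph :=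
  mem_graph_inverse (ker_Theta ν hN)

/-! ### Unboundedness -/

theorem IsBddOp.graph {S : L2 →ₗ.[ℂ] L2} (h : IsBddOp S) :
    ∃ K : ℝ, 0 ≤ K ∧ ∀ f g, (f, g) ∈ S.graph → ‖g‖ ≤ K * ‖f‖ := by
  obtain ⟨K, hK⟩ := h
  refine ⟨max K 0, le_max_right _ _, fun f g hfg => ?_⟩
  rw [LinearPMap.mem_graph_iff] at hfg
  obtain ⟨x, rfl, rfl⟩ := hfg
  refine (hK x).trans ?_
  gcongr
  exacts [le_max_left _ _, le_rfl]

theorem IsBddOp.of_graph {S : L2 →ₗ.[ℂ] L2} {K : ℝ}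
    (h : ∀ f g, (f, g) ∈ S.graph → ‖g‖ ≤ K * ‖f‖) : IsBddOp S :=
  ⟨K, fun f => h _ _ (LinearPMap.mem_graph S f)⟩

/-- On vectors R_c f, which lie in the domain of T², one has ‖T R_c f‖² = ⟨R_c f, T² R_c f⟩ ≤ K ‖R_c
f‖²; then c tends to infinity. -/
theorem isBddOp_T_of_sq {ν K : ℝ}
    (h : ∀ f g, (f, g) ∈ (pcomp (T ν) (T ν)).graph → ‖g‖ ≤ K * ‖f‖) : IsBddOp (T ν) := by
  refine IsBddOp.of_graph (K := Real.sqrt K) fun f g hfg => ?_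
  have h1 : ∀ c, ‖approxId c g‖ ^ 2 ≤ K * ‖approxId c f‖ ^ 2 := by
    intro c
    obtain ⟨w, hw⟩ := approxId_mem_domain_T_sq c ν f
    have h2 := approxId_comm_T c hfg
    obtain ⟨k, hk, hk'⟩ := (mem_graph_pcomp _ _ _ _).1 hw
    have hkg := graph_unique hk h2
    subst hkg
    have h4 : ‖approxId c g‖ ^ 2 = (inner ℂ (approxId c f) w : ℂ).re := by
      rw [← T_symmetric hk hk', inner_self_eq_norm_sq_to_K]
      simp [pow_two]
    rw [h4]
    refine (Complex.re_le_norm _).trans ((norm_inner_le_norm _ _).trans ?_)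
    nlinarith [h _ _ hw, norm_nonneg (approxId c f)]
  have h2 : ‖g‖ ^ 2 ≤ K * ‖f‖ ^ 2 :=
    le_of_tendsto_of_tendsto' ((tendsto_approxId g).norm.pow 2)
      (((tendsto_approxId f).norm.pow 2).const_mul K) h1
  have h3 := Real.sqrt_le_sqrt h2
  rwa [Real.sqrt_sq (norm_nonneg _), Real.sqrt_mul' _ (by positivity),
    Real.sqrt_sq (norm_nonneg _)] at h3

theorem isBddOp_of_isBddOp_Theta {ν : ℝ} {N₁ : ℂ} (hN : N₁ ≠ 0) (h : IsBddOp (Theta ν N₁)) :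
    IsBddOp (T (-ν)) := by
  obtain ⟨K, -, hK⟩ := h.graph
  have hc := metricConst_pos hN
  refine isBddOp_T_of_sq (K := (metricConst N₁)⁻¹ * K) fun f g hfg => ?_
  obtain ⟨k, h1, h2⟩ := (mem_graph_pcomp _ _ _ _).1 hfg
  have := hK _ _ (mem_graph_Theta.2 ⟨k, g, h1, h2, rfl⟩)
  rw [norm_smul, Complex.norm_real, Real.norm_of_nonneg hc.le] at this
  rwa [mul_assoc, ← div_eq_inv_mul, le_div_iff₀' hc]

theorem isBddOp_of_isBddOp_Theta_inverse {ν : ℝ} {N₁ : ℂ} (hN : N₁ ≠ 0)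
    (h : IsBddOp (Theta ν N₁).inverse) : IsBddOp (T ν) := by
  obtain ⟨K, -, hK⟩ := h.graph
  have hc := metricConst_pos hN
  refine isBddOp_T_of_sq (K := K * metricConst N₁) fun f g hfg => ?_
  obtain ⟨k, h1, h2⟩ := (mem_graph_pcomp _ _ _ _).1 hfg
  have := hK _ _ ((mem_graph_Theta_inverse hN).2
    (mem_graph_Theta.2 ⟨k, f, graph_T_neg h2, graph_T_neg h1, rfl⟩))
  rwa [norm_smul, Complex.norm_real, Real.norm_of_nonneg hc.le, ← mul_assoc] at this

/-- Hellinger–Toeplitz: an everywhere defined symmetric operator is bounded. -/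
theorem isBddOp_T_of_domain {ν : ℝ} (h : (T ν).domain = ⊤) : IsBddOp (T ν) := by
  let L : L2 →ₗ[ℂ] L2 := (T ν).toFun ∘ₗ (LinearEquiv.ofTop _ h).symm.toLinearMap
  have hL : ∀ f, (f, L f) ∈ (T ν).graph := fun f =>
    LinearPMap.mem_graph (T ν) ((LinearEquiv.ofTop _ h).symm f)
  have hs : L.IsSymmetric := fun f g => T_symmetric (hL f) (hL g)
  let L' : L2 →L[ℂ] L2 := ⟨L, hs.continuous⟩
  refine IsBddOp.of_graph (K := ‖L'‖) fun f g hfg => ?_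
  rw [graph_unique hfg (hL f)]
  exact L'.le_opNorm f

/-! ### The ladder operators on Schwartz functions -/

/-- The added momentum terms undo the Bopp shift, so none of the later operators depends on θ. -/
theorem Xshift_eq (θ : ℝ) (j : Fin 2) : Xshift θ j = X j := by
  fin_cases j <;> simp [Xshift, Xhat, Phat]

theorem phase_mul (s t : ℝ) : phase s * phase t = phase (s + t) := by
  rw [phase, phase, phase, ← Complex.exp_add]
  congr 1
  push_cast
  ring

theorem phase_zero : phase 0 = 1 := by simp [phase]

theorem phase_neg_mul (s : ℝ) : phase (-s) * phase s = 1 := by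
  rw [phase_mul, neg_add_cancel, phase_zero]

theorem phase_mul_neg (s : ℝ) : phase s * phase (-s) = 1 := by
  rw [phase_mul, add_neg_cancel, phase_zero]

theorem conj_phase (s : ℝ) : (starRingEnd ℂ) (phase s) = phase (-s) := by
  rw [phase, phase, ← Complex.exp_conj]
  simp

theorem phase_ne_zero (s : ℝ) : phase s ≠ 0 := Complex.exp_ne_zero _

theorem rsqrtTwo_mul_self : rsqrtTwo * rsqrtTwo = 1 / 2 := by
  rw [rsqrtTwo, ← Complex.ofReal_mul, div_mul_div_comm, Real.mul_self_sqrt (by norm_num)]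
  norm_num

theorem conj_rsqrtTwo : (starRingEnd ℂ) rsqrtTwo = rsqrtTwo := Complex.conj_ofReal _

theorem A_apply (ν θ : ℝ) (j : Fin 2) (u : 𝓢(Plane, ℂ)) :
    A ν θ j u = rsqrtTwo • (phase ν • X j u + phase (-ν) • D j u) := by
  simp [A, Xshift_eq, Phat, P, smul_smul, mul_right_comm]

theorem B_apply (ν θ : ℝ) (j : Fin 2) (u : 𝓢(Plane, ℂ)) :
    B ν θ j u = rsqrtTwo • (phase ν • X j u - phase (-ν) • D j u) := by
  simp [B, Xshift_eq, Phat, P, smul_smul, mul_right_comm, sub_eq_add_neg]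

theorem Adag_eq (ν θ : ℝ) : Adag ν θ = B (-ν) θ := by
  funext j
  simp [Adag, B]

theorem a_eq (θ : ℝ) : a = A 0 θ := by
  funext j
  simp [a, A, phase_zero, Xshift_eq, Phat]

theorem adag_eq (θ : ℝ) : adag = B 0 θ := by
  funext j
  simp [adag, B, phase_zero, Xshift_eq, Phat]

theorem H_apply (ν θ : ℝ) (u : 𝓢(Plane, ℂ)) :
    H ν θ u = ((1 / Real.cos (2 * ν) : ℝ) : ℂ) •
      (B ν θ 0 (A ν θ 0 u) + B ν θ 1 (A ν θ 1 u) + u) := rfl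

theorem h_apply (ν θ : ℝ) (u : 𝓢(Plane, ℂ)) :
    h ν u = ((1 / Real.cos (2 * ν) : ℝ) : ℂ) •
      (B 0 θ 0 (A 0 θ 0 u) + B 0 θ 1 (A 0 θ 1 u) + u) := by
  rw [← adag_eq, ← a_eq]
  rfl

theorem X_eq_A_add_B (ν θ : ℝ) (j : Fin 2) (u : 𝓢(Plane, ℂ)) :
    X j u = (rsqrtTwo * phase (-ν)) • (A ν θ j u + B ν θ j u) := by
  rw [A_apply, B_apply, ← smul_add, smul_smul, add_add_sub_cancel, ← add_smul, smul_smul,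
    show rsqrtTwo * phase (-ν) * rsqrtTwo * (phase ν + phase ν) =
      rsqrtTwo * rsqrtTwo * 2 * (phase (-ν) * phase ν) by ring,
    phase_neg_mul, rsqrtTwo_mul_self]
  norm_num

theorem X_X_comm (i j : Fin 2) (u : 𝓢(Plane, ℂ)) : X i (X j u) = X j (X i u) := by
  ext x
  simp only [X_apply]
  ring

theorem D_D_comm (i j : Fin 2) (u : 𝓢(Plane, ℂ)) : D i (D j u) = D j (D i u) := by
  have h : ∀ (i j : Fin 2) (x : Plane), D i (D j u) x = fderiv ℝ (fderiv ℝ u) x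
      (EuclideanSpace.single i (1 : ℝ)) (EuclideanSpace.single j (1 : ℝ)) := by
    intro i j x
    have h1 : (D j u : Plane → ℂ) = fun y => fderiv ℝ u y (EuclideanSpace.single j (1 : ℝ)) :=
      funext (D_apply_eq_fderiv j u)
    have h2 : DifferentiableAt ℝ (fderiv ℝ u) x :=
      ((u.smooth 2).fderiv_right (m := 1) (by norm_num)).differentiable (by norm_num) x
    rw [D_apply_eq_fderiv, h1, fderiv_clm_apply h2 (differentiableAt_const _)]
    simp
  ext x
  rw [h, h]
  exact ((u.smooth 2).contDiffAt.isSymmSndFDerivAt (by simp)).eq _ _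

/-- The pseudo-bosonic commutation relations: the phases e^{iν} and e^{-iν} cancel in the mixed
terms, leaving the bosonic commutator. -/
theorem A_B_comm (ν θ : ℝ) (i j : Fin 2) (u : 𝓢(Plane, ℂ)) :
    A ν θ i (B ν θ j u) = B ν θ j (A ν θ i u) + if i = j then u else 0 := by
  simp only [A_apply, B_apply, map_smul, map_add, map_sub, D_X, X_X_comm i j, D_D_comm i j,
    smul_add, smul_sub, smul_smul, eq_comm (a := j)]
  have hc : 2 * (rsqrtTwo * rsqrtTwo) * (phase ν * phase (-ν)) = 1 := by
    rw [rsqrtTwo_mul_self, phase_mul_neg]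
    norm_num
  split_ifs with hij
  · subst hij
    linear_combination (norm := module) hc • u
  · module

theorem B_B_comm (ν θ : ℝ) (i j : Fin 2) (u : 𝓢(Plane, ℂ)) :
    B ν θ i (B ν θ j u) = B ν θ j (B ν θ i u) := by
  simp only [B_apply, map_smul, map_sub, D_X, X_X_comm i j, D_D_comm i j,
    smul_add, smul_sub, smul_smul, eq_comm (a := j)]
  module

/-! ### Adjoints -/

theorem inner_toL2 (u v : 𝓢(Plane, ℂ)) :
    inner ℂ (toL2 u) (toL2 v) = ∫ x, (starRingEnd ℂ) (u x) * v x := by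
  rw [L2.inner_def]
  refine integral_congr_ae ?_
  filter_upwards [toL2_coeFn u, toL2_coeFn v] with x h1 h2
  rw [h1, h2, RCLike.inner_apply, mul_comm]

theorem inner_X (j : Fin 2) (u v : 𝓢(Plane, ℂ)) :
    inner ℂ (toL2 (X j u)) (toL2 v) = inner ℂ (toL2 u) (toL2 (X j v)) := by
  rw [inner_toL2, inner_toL2]
  refine integral_congr_ae (ae_of_all _ fun x => ?_)
  simp only [X_apply, map_mul, Complex.conj_ofReal]
  ring

theorem inner_D (j : Fin 2) (u v : 𝓢(Plane, ℂ)) :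
    inner ℂ (toL2 (D j u)) (toL2 v) = -inner ℂ (toL2 u) (toL2 (D j v)) := by
  let L : ℂ →L[ℝ] ℂ →L[ℝ] ℂ :=
    (ContinuousLinearMap.mul ℝ ℂ).comp Complex.conjCLE.toContinuousLinearMap
  have := SchwartzMap.integral_bilinear_lineDerivOp_right_eq_neg_left (μ := volume) u v L
    (EuclideanSpace.single j (1 : ℝ))
  rw [inner_toL2, inner_toL2, eq_neg_iff_add_eq_zero, add_comm, ← eq_neg_iff_add_eq_zero]
  exact this

/-- Taking adjoints conjugates the phases and changes the sign of ∂_j, which turns A with parameter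
ν into B with parameter -ν. This links adjoints to the reversed dilation. -/
theorem inner_A (ν θ : ℝ) (j : Fin 2) (u v : 𝓢(Plane, ℂ)) :
    inner ℂ (toL2 (A ν θ j u)) (toL2 v) = inner ℂ (toL2 u) (toL2 (B (-ν) θ j v)) := by
  simp only [A_apply, B_apply, map_smul, map_add, map_sub, inner_smul_left, inner_smul_right,
    inner_add_left, inner_sub_right, inner_X, inner_D, conj_rsqrtTwo, conj_phase, neg_neg]
  ring

theorem inner_B (ν θ : ℝ) (j : Fin 2) (u v : 𝓢(Plane, ℂ)) :
    inner ℂ (toL2 (B ν θ j u)) (toL2 v) = inner ℂ (toL2 u) (toL2 (A (-ν) θ j v)) := by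
  simp only [A_apply, B_apply, map_smul, map_add, map_sub, inner_smul_left, inner_smul_right,
    inner_add_right, inner_sub_left, inner_X, inner_D, conj_rsqrtTwo, conj_phase, neg_neg]
  ring

theorem mem_graph_toPMap_toL2 (C : SOp) (u : 𝓢(Plane, ℂ)) :
    (toL2 u, toL2 (C u)) ∈ (toPMap C).graph := (mem_graph_toPMap C _ _).2 ⟨u, rfl, rfl⟩

theorem dense_domain_toPMap (C : SOp) : Dense ((toPMap C).domain : Set L2) := denseRange_toL2

theorem mem_graph_adjoint_iff {S : L2 →ₗ.[ℂ] L2} (hS : Dense (S.domain : Set L2)) {x y : L2} :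
    (x, y) ∈ S.adjoint.graph ↔ ∀ f g : L2, (f, g) ∈ S.graph → inner ℂ g x = inner ℂ f y := by
  rw [LinearPMap.adjoint_graph_eq_graph_adjoint hS, Submodule.mem_adjoint_iff]
  simp only [sub_eq_zero]

theorem mem_graph_adjoint_toPMap {C C' : SOp}
    (hC : ∀ u v, inner ℂ (toL2 (C u)) (toL2 v) = inner ℂ (toL2 u) (toL2 (C' v)))
    (u : 𝓢(Plane, ℂ)) : (toL2 u, toL2 (C' u)) ∈ (toPMap C).adjoint.graph := by
  rw [mem_graph_adjoint_iff (dense_domain_toPMap C)]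
  intro f g hfg
  obtain ⟨v, rfl, rfl⟩ := (mem_graph_toPMap C _ _).1 hfg
  exact hC v u

theorem toPMap_le_adjoint {C C' : SOp}
    (hC : ∀ u v, inner ℂ (toL2 (C u)) (toL2 v) = inner ℂ (toL2 u) (toL2 (C' v))) :
    toPMap C' ≤ (toPMap C).adjoint := by
  refine LinearPMap.le_of_le_graph ?_
  rintro ⟨f, g⟩ hfg
  obtain ⟨v, rfl, rfl⟩ := (mem_graph_toPMap C' _ _).1 hfg
  exact mem_graph_adjoint_toPMap hC v

theorem mem_graph_adjoint_A (ν θ : ℝ) (j : Fin 2) (u : 𝓢(Plane, ℂ)) :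
    (toL2 u, toL2 (B (-ν) θ j u)) ∈ (toPMap (A ν θ j)).adjoint.graph :=
  mem_graph_adjoint_toPMap (inner_A ν θ j) u

theorem mem_graph_adjoint_B (ν θ : ℝ) (j : Fin 2) (u : 𝓢(Plane, ℂ)) :
    (toL2 u, toL2 (A (-ν) θ j u)) ∈ (toPMap (B ν θ j)).adjoint.graph :=
  mem_graph_adjoint_toPMap (inner_B ν θ j) u

theorem inner_H (ν θ : ℝ) (u v : 𝓢(Plane, ℂ)) :
    inner ℂ (toL2 (H ν θ u)) (toL2 v) = inner ℂ (toL2 u) (toL2 (H (-ν) θ v)) := by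
  simp only [H_apply, map_smul, map_add, inner_smul_left, inner_smul_right,
    inner_add_left, inner_add_right, inner_A, inner_B, Complex.conj_ofReal, mul_neg,
    Real.cos_neg]

theorem inner_h (ν : ℝ) (u v : 𝓢(Plane, ℂ)) :
    inner ℂ (toL2 (h ν u)) (toL2 v) = inner ℂ (toL2 u) (toL2 (h ν v)) := by
  simp only [h_apply ν 0, map_smul, map_add, inner_smul_left, inner_smul_right,
    inner_add_left, inner_add_right, inner_A, inner_B, neg_zero, Complex.conj_ofReal]

/-! ### The oscillator vectors -/

theorem vacuum_apply (ν : ℝ) (hν : ν ∈ nuRange) (x : Plane) :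
    vacuum ν hν x = Complex.exp (-(Complex.exp (2 * Complex.I * ν) / 2) * ((‖x‖ ^ 2 : ℝ) : ℂ)) :=
  rfl

theorem gaussian_apply (c : ℂ) (hc : 0 < c.re) (x : Plane) :
    gaussian c hc x = Complex.exp (-c * ((‖x‖ ^ 2 : ℝ) : ℂ)) := rfl

theorem D_gaussian (c : ℂ) (hc : 0 < c.re) (j : Fin 2) :
    D j (gaussian c hc) = (-2 * c) • X j (gaussian c hc) := by
  ext x
  have h1 : HasFDerivAt (fun x : Plane => ‖x‖ ^ 2) (2 • (innerSL ℝ x)) x :=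
    (hasStrictFDerivAt_norm_sq x).hasFDerivAt
  have h2 := ((Complex.ofRealCLM.hasFDerivAt.comp x h1).const_mul (-c)).cexp
  have h3 : D j (gaussian c hc) x = _ :=
    (D_apply_eq_fderiv j (gaussian c hc) x).trans
      (congrArg (fun L : Plane →L[ℝ] ℂ => L (EuclideanSpace.single j (1 : ℝ))) h2.fderiv)
  rw [h3]
  change _ = (-2 * c) * X j (gaussian c hc) x
  rw [X_apply]
  simp [gaussian_apply, EuclideanSpace.inner_single_right]
  ring

theorem A_vacuum (ν : ℝ) (hν : ν ∈ nuRange) (θ : ℝ) (j : Fin 2) : A ν θ j (vacuum ν hν) = 0 := by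
  have h1 : phase (-ν) * Complex.exp (2 * Complex.I * ν) = phase ν := by
    rw [phase, phase, ← Complex.exp_add]
    congr 1
    push_cast
    ring
  rw [A_apply, vacuum, D_gaussian, smul_smul, ← add_smul,
    show phase ν + phase (-ν) * (-2 * (Complex.exp (2 * Complex.I * ν) / 2)) =
      phase ν - phase (-ν) * Complex.exp (2 * Complex.I * ν) by ring, h1, sub_self, zero_smul,
    smul_zero]

/-- The occupation number of the `j`-th mode. -/
def occ (j : Fin 2) (n : ℕ × ℕ) : ℕ := if j = 0 then n.1 else n.2

/-- Raise the occupation number of the `j`-th mode by one. -/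
def raise (j : Fin 2) (n : ℕ × ℕ) : ℕ × ℕ := if j = 0 then (n.1 + 1, n.2) else (n.1, n.2 + 1)

/-- Lower the occupation number of the `j`-th mode by one. -/
def lower (j : Fin 2) (n : ℕ × ℕ) : ℕ × ℕ := if j = 0 then (n.1 - 1, n.2) else (n.1, n.2 - 1)

theorem occ_raise (i j : Fin 2) (n : ℕ × ℕ) :
    occ i (raise j n) = occ i n + if i = j then 1 else 0 := by
  fin_cases i <;> fin_cases j <;> simp [occ, raise]

theorem occ_lower (i j : Fin 2) (n : ℕ × ℕ) :
    occ i (lower j n) = occ i n - if i = j then 1 else 0 := by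
  fin_cases i <;> fin_cases j <;> simp [occ, lower]

theorem eq_of_occ {m n : ℕ × ℕ} (h : ∀ j, occ j m = occ j n) : m = n :=
  Prod.ext (by simpa [occ] using h 0) (by simpa [occ] using h 1)

theorem raise_lower {j : Fin 2} {n : ℕ × ℕ} (h : occ j n ≠ 0) : raise j (lower j n) = n := by
  refine eq_of_occ fun i => ?_
  rw [occ_raise, occ_lower]
  split_ifs with hij
  · subst hij; omega
  · omega

theorem B_pow_comm (ν θ : ℝ) (i j : Fin 2) (k : ℕ) (u : 𝓢(Plane, ℂ)) :
    B ν θ i ((B ν θ j ^ k) u) = (B ν θ j ^ k) (B ν θ i u) := by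
  induction k generalizing u with
  | zero => rfl
  | succ k ih =>
    rw [pow_succ]
    change B ν θ i ((B ν θ j ^ k) (B ν θ j u)) = (B ν θ j ^ k) (B ν θ j (B ν θ i u))
    rw [ih, B_B_comm]

theorem A_pow_comm (ν θ : ℝ) {i j : Fin 2} (hij : i ≠ j) (k : ℕ) (u : 𝓢(Plane, ℂ)) :
    A ν θ i ((B ν θ j ^ k) u) = (B ν θ j ^ k) (A ν θ i u) := by
  induction k generalizing u with
  | zero => rfl
  | succ k ih =>
    rw [pow_succ]
    change A ν θ i ((B ν θ j ^ k) (B ν θ j u)) = (B ν θ j ^ k) (B ν θ j (A ν θ i u))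
    rw [ih, A_B_comm, if_neg hij, add_zero]

theorem A_pow_self (ν θ : ℝ) (i : Fin 2) (k : ℕ) {u : 𝓢(Plane, ℂ)} (hu : A ν θ i u = 0) :
    A ν θ i ((B ν θ i ^ k) u) = (k : ℂ) • (B ν θ i ^ (k - 1)) u := by
  induction k with
  | zero => simpa using hu
  | succ k ih =>
    have h1 : (B ν θ i ^ (k + 1)) u = B ν θ i ((B ν θ i ^ k) u) := by rw [pow_succ']; rfl
    rw [h1, A_B_comm, if_pos rfl, ih, map_smul, Nat.add_sub_cancel, Nat.cast_succ, add_smul,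
      one_smul]
    congr 1
    -- For k = 0 the truncated exponent k - 1 is harmless, because its coefficient is zero.
    rcases k with _ | k
    · simp
    · congr 1
      rw [Nat.add_sub_cancel, pow_succ']
      rfl

theorem sqrt_factorial_succ (k l : ℕ) :
    ((1 / Real.sqrt (k.factorial * l) : ℝ) : ℂ) =
      (Real.sqrt (k + 1) : ℂ) * ((1 / Real.sqrt ((k + 1).factorial * l) : ℝ) : ℂ) := by
  rw [← Complex.ofReal_mul, Nat.factorial_succ, Nat.cast_mul, mul_assoc, Nat.cast_succ,
    Real.sqrt_mul (x := (k : ℝ) + 1) (by positivity)]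
  have : Real.sqrt ((k : ℝ) + 1) ≠ 0 := by positivity
  congr 1
  rw [mul_one_div, div_mul_cancel_left₀ this, one_div]

theorem B_ladder (ν θ : ℝ) (v : 𝓢(Plane, ℂ)) (j : Fin 2) (n : ℕ × ℕ) :
    B ν θ j (ladder (B ν θ) v n) =
      (Real.sqrt (occ j n + 1) : ℂ) • ladder (B ν θ) v (raise j n) := by
  have h1 : ∀ (i : Fin 2) (k : ℕ) u, (B ν θ i ^ (k + 1)) u = B ν θ i ((B ν θ i ^ k) u) :=
    fun i k u => by rw [pow_succ']; rfl
  obtain ⟨k, l⟩ := n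
  fin_cases j
  · simp only [ladder, raise, occ, Fin.zero_eta, if_true, map_smul, smul_smul, h1]
    rw [sqrt_factorial_succ]
  · simp only [ladder, raise, occ, Fin.mk_one, one_ne_zero, if_false, map_smul, smul_smul, h1,
      B_pow_comm ν θ 1 0]
    rw [mul_comm (k.factorial : ℝ), mul_comm (k.factorial : ℝ), sqrt_factorial_succ]

/-- In an empty mode `lower` leaves the index unchanged, and the factor √0 makes the right-hand side
vanish as it should. -/
theorem A_ladder (ν θ : ℝ) {v : 𝓢(Plane, ℂ)} (hv : ∀ j, A ν θ j v = 0) (j : Fin 2) (n : ℕ × ℕ) :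
    A ν θ j (ladder (B ν θ) v n) =
      (Real.sqrt (occ j n) : ℂ) • ladder (B ν θ) v (lower j n) := by
  have hs : ∀ k : ℕ, ((k + 1 : ℕ) : ℂ) = (Real.sqrt (k + 1) : ℂ) * (Real.sqrt (k + 1) : ℂ) := by
    intro k
    rw [← Complex.ofReal_mul, Real.mul_self_sqrt (by positivity)]
    push_cast
    ring
  obtain ⟨k, l⟩ := n
  fin_cases j
  · have h0 : A ν θ 0 ((B ν θ 1 ^ l) v) = 0 := by
      rw [A_pow_comm ν θ (by decide), hv, map_zero]
    simp only [ladder, lower, occ, Fin.zero_eta, if_true, map_smul, smul_smul,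
      A_pow_self ν θ 0 k h0]
    rcases k with _ | k
    · simp
    · rw [Nat.add_sub_cancel, sqrt_factorial_succ k, hs]
      push_cast
      congr 1
      ring
  · simp only [ladder, lower, occ, Fin.mk_one, one_ne_zero, if_false, map_smul, smul_smul,
      A_pow_comm ν θ (show (1 : Fin 2) ≠ 0 by decide), A_pow_self ν θ 1 l (hv 1)]
    rcases l with _ | l
    · simp
    · rw [Nat.add_sub_cancel, mul_comm (k.factorial : ℝ), mul_comm (k.factorial : ℝ),
        sqrt_factorial_succ l, hs]
      push_cast
      congr 1
      ring

theorem number_ladder (ν θ : ℝ) {v : 𝓢(Plane, ℂ)} (hv : ∀ j, A ν θ j v = 0) (j : Fin 2)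
    (n : ℕ × ℕ) :
    B ν θ j (A ν θ j (ladder (B ν θ) v n)) = (occ j n : ℂ) • ladder (B ν θ) v n := by
  rw [A_ladder ν θ hv, map_smul, B_ladder, smul_smul]
  rcases eq_or_ne (occ j n) 0 with h | h
  · simp [h]
  · rw [raise_lower h, occ_lower, if_pos rfl, ← Complex.ofReal_mul]
    congr 1
    have : ((occ j n - 1 : ℕ) : ℝ) + 1 = occ j n := by
      exact_mod_cast Nat.sub_add_cancel (Nat.one_le_iff_ne_zero.2 h)
    rw [this, Real.mul_self_sqrt (by positivity)]
    simp

/-- The normalised Gaussian. -/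
def ground : 𝓢(Plane, ℂ) := ((1 / Real.sqrt Real.pi : ℝ) : ℂ) • vacuum 0 zero_mem_nuRange

theorem A_ground (j : Fin 2) : A 0 0 j ground = 0 := by
  rw [ground, map_smul, A_vacuum, smul_zero]

/-- The oscillator vectors as Schwartz functions. -/
def eS (n : ℕ × ℕ) : 𝓢(Plane, ℂ) := ladder (B 0 0) ground n

theorem e_eq (n : ℕ × ℕ) : e n = toL2 (eS n) := by
  rw [e, adag_eq 0]
  rfl

theorem norm_ground : ‖toL2 ground‖ = 1 := by
  have h1 : ‖toL2 ground‖ ^ 2 = 1 := by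
    have h2 : ((‖toL2 ground‖ ^ 2 : ℝ) : ℂ) = inner ℂ (toL2 ground) (toL2 ground) := by
      rw [inner_self_eq_norm_sq_to_K]; simp
    rw [inner_toL2] at h2
    have h3 : ∀ x, (starRingEnd ℂ) (ground x) * ground x =
        ((Real.pi⁻¹ * Real.exp (-1 * ‖x‖ ^ 2) : ℝ) : ℂ) := by
      intro x
      have hg : ground x = (((1 / Real.sqrt Real.pi) * Real.exp (-(1 / 2) * ‖x‖ ^ 2) : ℝ) : ℂ) := by
        rw [ground, smul_apply, vacuum_apply]
        simp
      rw [hg, Complex.conj_ofReal, ← Complex.ofReal_mul]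
      congr 1
      rw [mul_mul_mul_comm, ← Real.exp_add, div_mul_div_comm, Real.mul_self_sqrt Real.pi_pos.le]
      ring_nf
    simp_rw [h3] at h2
    rw [integral_complex_ofReal] at h2
    have h4 := Complex.ofReal_injective h2
    rw [h4, integral_const_mul, GaussianFourier.integral_rexp_neg_mul_sq_norm one_pos]
    have : Module.finrank ℝ Plane = 2 := by simp
    rw [this]
    norm_num [Real.pi_ne_zero]
  exact (pow_eq_one_iff_of_nonneg (norm_nonneg _) two_ne_zero).1 h1

theorem inner_B_zero (j : Fin 2) (u v : 𝓢(Plane, ℂ)) :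
    inner ℂ (toL2 (B 0 0 j u)) (toL2 v) = inner ℂ (toL2 u) (toL2 (A 0 0 j v)) := by
  simpa using inner_B 0 0 j u v

theorem inner_A_zero (j : Fin 2) (u v : 𝓢(Plane, ℂ)) :
    inner ℂ (toL2 (A 0 0 j u)) (toL2 v) = inner ℂ (toL2 u) (toL2 (B 0 0 j v)) := by
  simpa using inner_A 0 0 j u v

/-- Compute ‖a_j† e_n‖² both as (n_j + 1)‖e_{n+1_j}‖² and as ⟨e_n, a_j a_j† e_n⟩ = (n_j + 1)‖e_n‖².
-/
theorem norm_eS_raise (j : Fin 2) (n : ℕ × ℕ) : ‖toL2 (eS (raise j n))‖ = ‖toL2 (eS n)‖ := by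
  have h1 : inner ℂ (toL2 (B 0 0 j (eS n))) (toL2 (B 0 0 j (eS n))) =
      ((occ j n + 1 : ℝ) : ℂ) * inner ℂ (toL2 (eS n)) (toL2 (eS n)) := by
    rw [inner_B_zero, A_B_comm, if_pos rfl, eS, number_ladder 0 0 A_ground, map_add, map_smul,
      inner_add_right, inner_smul_right]
    push_cast
    ring
  rw [eS, B_ladder, map_smul, inner_smul_left, inner_smul_right, Complex.conj_ofReal, ← mul_assoc,
    ← Complex.ofReal_mul, Real.mul_self_sqrt (by positivity)] at h1
  have h2 := mul_left_cancel₀ (by exact_mod_cast (by positivity : (occ j n + 1 : ℝ) ≠ 0)) h1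
  rw [inner_self_eq_norm_sq_to_K, inner_self_eq_norm_sq_to_K] at h2
  have h3 : ‖toL2 (eS (raise j n))‖ ^ 2 = ‖toL2 (eS n)‖ ^ 2 := by exact_mod_cast h2
  exact (pow_left_inj₀ (norm_nonneg _) (norm_nonneg _) two_ne_zero).1 h3

theorem norm_eS (n : ℕ × ℕ) : ‖toL2 (eS n)‖ = 1 := by
  obtain ⟨k, l⟩ := n
  induction k with
  | zero =>
    induction l with
    | zero =>
      have : eS (0, 0) = ground := by simp [eS, ladder]
      rw [this, norm_ground]
    | succ l ih => rw [← ih]; exact norm_eS_raise 1 (0, l)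
  | succ k ih => rw [← ih]; exact norm_eS_raise 0 (k, l)

/-- The vectors are eigenvectors of the symmetric number operators, and the pair of eigenvalues
determines the index. -/
theorem inner_eS_of_ne {m n : ℕ × ℕ} (h : m ≠ n) : inner ℂ (toL2 (eS m)) (toL2 (eS n)) = 0 := by
  by_contra hne
  refine h (eq_of_occ fun j => ?_)
  have h1 : inner ℂ (toL2 (B 0 0 j (A 0 0 j (eS m)))) (toL2 (eS n)) =
      inner ℂ (toL2 (eS m)) (toL2 (B 0 0 j (A 0 0 j (eS n)))) := by
    rw [inner_B_zero, inner_A_zero]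
  rw [eS, eS, number_ladder 0 0 A_ground, number_ladder 0 0 A_ground, map_smul, map_smul,
    inner_smul_left, inner_smul_right, Complex.conj_natCast] at h1
  exact_mod_cast mul_right_cancel₀ hne h1

theorem orthonormal_e : Orthonormal ℂ e := by
  constructor
  · intro n
    rw [e_eq, norm_eS]
  · intro m n hmn
    change inner ℂ (e m) (e n) = 0
    rw [e_eq, e_eq, inner_eS_of_ne hmn]

theorem inner_eS (m n : ℕ × ℕ) :
    inner ℂ (toL2 (eS m)) (toL2 (eS n)) = if m = n then (1 : ℂ) else 0 := by
  rw [← e_eq, ← e_eq]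
  exact orthonormal_iff_ite.1 orthonormal_e m n

theorem h_eS (ν : ℝ) (n : ℕ × ℕ) :
    h ν (eS n) = ((1 / Real.cos (2 * ν) * (n.1 + n.2 + 1) : ℝ) : ℂ) • eS n := by
  rw [h_apply ν 0, eS, number_ladder 0 0 A_ground, number_ladder 0 0 A_ground, ← add_smul]
  nth_rewrite 2 [← one_smul ℂ (ladder (B 0 0) ground n)]
  rw [← add_smul, smul_smul]
  simp [occ]

/-! ### The dilation generator on the oscillator vectors -/

/-- In a_j² - a_j†² the terms x_j² and ∂_j² cancel. Hence G changes the occupation of a single mode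
by two. -/
theorem dilationGenerator_eq (u : 𝓢(Plane, ℂ)) :
    dilationGenerator u = (1 / 2 : ℂ) • (A 0 0 0 (A 0 0 0 u) - B 0 0 0 (B 0 0 0 u)) +
      (1 / 2 : ℂ) • (A 0 0 1 (A 0 0 1 u) - B 0 0 1 (B 0 0 1 u)) := by
  have h1 : ∀ j, X j (D j u) + D j (X j u) = A 0 0 j (A 0 0 j u) - B 0 0 j (B 0 0 j u) := by
    intro j
    have hr := rsqrtTwo_mul_self
    simp only [A_apply, B_apply, neg_zero, phase_zero, one_smul, map_smul, map_add, map_sub,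
      smul_smul, smul_add, smul_sub, hr]
    module
  rw [← h1, ← h1]
  rfl

/-- Pair G e_n with the unit vector two steps up in mode j. Only -½ a_j†² contributes, giving
modulus ½ √((n_j + 1)(n_j + 2)). -/
theorem norm_generator_le (j : Fin 2) (n : ℕ × ℕ) :
    (occ j n + 1 : ℝ) / 2 ≤ ‖toL2 (dilationGenerator (eS n))‖ := by
  have h1 : inner ℂ (toL2 (eS (raise j (raise j n)))) (toL2 (dilationGenerator (eS n))) =
      ((-(1 / 2) * (Real.sqrt (occ j n + 1) * Real.sqrt (occ j n + 1 + 1)) : ℝ) : ℂ) := by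
    have hA : ∀ i, inner ℂ (toL2 (eS (raise j (raise j n)))) (toL2 (A 0 0 i (A 0 0 i (eS n)))) =
        0 := by
      intro i
      rw [eS, eS, A_ladder 0 0 A_ground, map_smul, A_ladder 0 0 A_ground, map_smul, map_smul,
        inner_smul_right, inner_smul_right, ← eS, ← eS, inner_eS_of_ne, mul_zero, mul_zero]
      intro h
      have := congrArg (occ j) h
      rw [occ_raise, occ_raise, occ_lower, occ_lower, if_pos rfl] at this
      omega
    have hB : ∀ i, inner ℂ (toL2 (eS (raise j (raise j n)))) (toL2 (B 0 0 i (B 0 0 i (eS n)))) =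
        if i = j then
          ((Real.sqrt (occ j n + 1) * Real.sqrt (occ j n + 1 + 1) : ℝ) : ℂ) else 0 := by
      intro i
      rw [eS, eS, B_ladder, map_smul, B_ladder, map_smul, map_smul,
        inner_smul_right, inner_smul_right, ← eS, ← eS, inner_eS]
      split_ifs with h1 h2 h2
      · subst h2
        simp [occ_raise]
      · exfalso
        have := congrArg (occ j) h1
        simp only [occ_raise, if_pos, if_neg (Ne.symm h2)] at this
        omega
      · subst h2
        exact absurd rfl h1
      · simp
    rw [dilationGenerator_eq, map_add, map_smul, map_smul, map_sub, map_sub, inner_add_right,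
      inner_smul_right, inner_smul_right, inner_sub_right, inner_sub_right, hA, hA, hB, hB]
    fin_cases j <;> simp
  have h2 := norm_inner_le_norm (𝕜 := ℂ) (toL2 (eS (raise j (raise j n))))
    (toL2 (dilationGenerator (eS n)))
  rw [h1, norm_eS, one_mul, Complex.norm_real, norm_mul, norm_neg,
    Real.norm_of_nonneg (by positivity), Real.norm_of_nonneg (by positivity)] at h2
  refine le_trans ?_ h2
  have h3 : Real.sqrt (occ j n + 1) * Real.sqrt (occ j n + 1) = occ j n + 1 :=
    Real.mul_self_sqrt (by positivity)
  have h4 : Real.sqrt (occ j n + 1) ≤ Real.sqrt (occ j n + 1 + 1) :=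
    Real.sqrt_le_sqrt (by linarith)
  nlinarith [Real.sqrt_nonneg ((occ j n : ℝ) + 1)]

theorem tendsto_norm_generator :
    Tendsto (fun n => ‖toL2 (dilationGenerator (eS n))‖) cofinite atTop := by
  rw [tendsto_atTop]
  intro K
  obtain ⟨N, hN⟩ := exists_nat_gt (2 * K)
  have hfin : ((Set.Iio N) ×ˢ (Set.Iio N) : Set (ℕ × ℕ)).Finite :=
    (Set.finite_Iio N).prod (Set.finite_Iio N)
  filter_upwards [hfin.compl_mem_cofinite] with n hn
  have h1 : ∃ j, N ≤ occ j n := by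
    by_contra hcon
    push Not at hcon
    exact hn ⟨by simpa [occ] using hcon 0, by simpa [occ] using hcon 1⟩
  obtain ⟨j, hj⟩ := h1
  have h2 := norm_generator_le j n
  have h3 : (N : ℝ) ≤ occ j n := by exact_mod_cast hj
  linarith

/-! ### Modules of Schwartz orbits of the complex dilations -/

/-- A space of families `t ↦ σ(t)` of Schwartz functions with `σ(t) = T_t σ(0)` for `t ∈ I`, stable
under the position and momentum operators. -/
structure IsDilationModule (S : Submodule ℂ (ℝ → 𝓢(Plane, ℂ))) (I : Set ℝ) : Prop where
  X_mem : ∀ σ ∈ S, ∀ j, (fun t => phase t • X j (σ t)) ∈ S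
  D_mem : ∀ σ ∈ S, ∀ j, (fun t => phase (-t) • D j (σ t)) ∈ S
  graph : ∀ σ ∈ S, ∀ t ∈ I, (toL2 (σ 0), toL2 (σ t)) ∈ (T t).graph

/-- The values at `t` of the families in `S`. -/
def fiber (S : Submodule ℂ (ℝ → 𝓢(Plane, ℂ))) (t : ℝ) : Submodule ℂ L2 :=
  S.map (toL2.toLinearMap ∘ₗ LinearMap.proj t)

theorem mem_fiber {S : Submodule ℂ (ℝ → 𝓢(Plane, ℂ))} {t : ℝ} {f : L2} :
    f ∈ fiber S t ↔ ∃ σ ∈ S, toL2 (σ t) = f := Iff.rfl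

namespace IsDilationModule

variable {S : Submodule ℂ (ℝ → 𝓢(Plane, ℂ))} {I : Set ℝ} {ν : ℝ} {σ : ℝ → 𝓢(Plane, ℂ)}

/-- A_t carries exactly the phases e^{it} and e^{-it} by which x_j and ∂_j act on families, so
membership encodes the intertwining of A_t with T_t. -/
theorem A_mem (hS : IsDilationModule S I) (θ : ℝ) (hσ : σ ∈ S) (j : Fin 2) :
    (fun t => A t θ j (σ t)) ∈ S := by
  simp_rw [A_apply]
  exact S.smul_mem _ (S.add_mem (hS.X_mem σ hσ j) (hS.D_mem σ hσ j))

theorem B_mem (hS : IsDilationModule S I) (θ : ℝ) (hσ : σ ∈ S) (j : Fin 2) :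
    (fun t => B t θ j (σ t)) ∈ S := by
  simp_rw [B_apply]
  exact S.smul_mem _ (S.sub_mem (hS.X_mem σ hσ j) (hS.D_mem σ hσ j))

theorem BA_mem (hS : IsDilationModule S I) (θ : ℝ) (hσ : σ ∈ S) :
    (fun t => B t θ 0 (A t θ 0 (σ t)) + B t θ 1 (A t θ 1 (σ t)) + σ t) ∈ S :=
  S.add_mem (S.add_mem (hS.B_mem θ (hS.A_mem θ hσ 0) 0) (hS.B_mem θ (hS.A_mem θ hσ 1) 1)) hσ

theorem ladder_mem (hS : IsDilationModule S I) (θ : ℝ) (hσ : σ ∈ S) (n : ℕ × ℕ) :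
    (fun t => ladder (B t θ) (σ t) n) ∈ S := by
  have hpow : ∀ (j : Fin 2) (k : ℕ) (σ : ℝ → 𝓢(Plane, ℂ)), σ ∈ S →
      (fun t => (B t θ j ^ k) (σ t)) ∈ S := by
    intro j k
    induction k with
    | zero => exact fun σ hσ => hσ
    | succ k ih =>
      intro σ hσ
      simp_rw [pow_succ]
      exact ih _ (hS.B_mem θ hσ j)
  exact S.smul_mem _ (hpow 0 n.1 _ (hpow 1 n.2 _ hσ))

theorem graph_sub (hS : IsDilationModule S I) (hν : ν ∈ I) (hσ : σ ∈ S) :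
    (toL2 (σ ν), toL2 (σ 0)) ∈ (T (-ν)).graph := graph_T_neg (hS.graph σ hσ ν hν)

/-- Θ is a multiple of T_{-ν}², whose two factors carry σ(ν) to σ(0) and σ(0) to σ(-ν). -/
theorem Theta_graph (hS : IsDilationModule S I) (hν : ν ∈ I) (hν' : -ν ∈ I) (N₁ : ℂ)
    (hσ : σ ∈ S) :
    (toL2 (σ ν), ((metricConst N₁ : ℝ) : ℂ) • toL2 (σ (-ν))) ∈ (Theta ν N₁).graph :=
  mem_graph_Theta.2 ⟨_, _, hS.graph_sub hν hσ, hS.graph σ hσ _ hν', rfl⟩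

/-- Θ carries the value at ν of t ↦ A_t σ(t) to a multiple of its value at -ν, and A_{-ν} is B_ν† on
Schwartz functions. -/
theorem areConjugate (hS : IsDilationModule S I) (hν : ν ∈ I) (hν' : -ν ∈ I) {N₁ : ℂ}
    (hN : N₁ ≠ 0) (θ : ℝ) (j : Fin 2) :
    AreConjugate (Theta ν N₁) (toPMap (A ν θ j)) (toPMap (B ν θ j)).adjoint (fiber S ν) := by
  rintro f ⟨σ, hσ, rfl⟩
  refine ⟨toL2 (A ν θ j (σ ν)), mem_graph_toPMap_toL2 _ _, ?_⟩
  rw [mem_graph_pcomp]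
  refine ⟨_, (mem_graph_pcomp _ _ _ _).2 ⟨_, hS.Theta_graph hν hν' N₁ hσ,
    Submodule.smul_mem _ ((metricConst N₁ : ℝ) : ℂ) (mem_graph_adjoint_B ν θ j (σ (-ν)))⟩, ?_⟩
  rw [mem_graph_Theta_inverse hN]
  exact hS.Theta_graph hν hν' N₁ (hS.A_mem θ hσ j)

/-- As for `areConjugate`, applied to the family of B_t A_t terms: on Schwartz functions H_ν† is
H_{-ν}, since cos 2ν is even. -/
theorem intertwines_H (hS : IsDilationModule S I) (hν : ν ∈ I) (hν' : -ν ∈ I) (N₁ : ℂ) (θ : ℝ) :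
    AgreeOn (pcomp (Theta ν N₁) (toPMap (H ν θ))) (pcomp (toPMap (H ν θ)).adjoint (Theta ν N₁))
      (fiber S ν) := by
  rintro f ⟨σ, hσ, rfl⟩
  have hG := hS.Theta_graph hν hν' N₁ (S.smul_mem ((1 / Real.cos (2 * ν) : ℝ) : ℂ)
    (hS.BA_mem θ hσ))
  refine ⟨_, (mem_graph_pcomp _ _ _ _).2 ⟨_, mem_graph_toPMap_toL2 _ _, hG⟩, ?_⟩
  rw [mem_graph_pcomp]
  refine ⟨_, hS.Theta_graph hν hν' N₁ hσ, ?_⟩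
  have := Submodule.smul_mem _ ((metricConst N₁ : ℝ) : ℂ)
    (mem_graph_adjoint_toPMap (inner_H ν θ) (σ (-ν)))
  have hH : H (-ν) θ (σ (-ν)) = ((1 / Real.cos (2 * ν) : ℝ) : ℂ) •
      (B (-ν) θ 0 (A (-ν) θ 0 (σ (-ν))) + B (-ν) θ 1 (A (-ν) θ 1 (σ (-ν))) + σ (-ν)) := by
    rw [H_apply, mul_neg, Real.cos_neg]
  rw [hH] at this
  exact this

/-- The family of B_t A_t terms gives h_ν at t = 0 and H_ν at t = ν; the scalar 1/cos 2ν is fixed.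
-/
theorem similar_h (hS : IsDilationModule S I) (hν : ν ∈ I) (θ : ℝ) :
    AgreeOn (toPMap (h ν)) (pcomp (T ν).inverse (pcomp (toPMap (H ν θ)) (T ν))) (fiber S 0) := by
  rintro f ⟨σ, hσ, rfl⟩
  refine ⟨_, mem_graph_toPMap_toL2 _ _, ?_⟩
  rw [mem_graph_pcomp, inverse_T]
  refine ⟨_, (mem_graph_pcomp _ _ _ _).2 ⟨_, hS.graph σ hσ ν hν, mem_graph_toPMap_toL2 _ _⟩, ?_⟩
  have hG := hS.graph_sub hν (S.smul_mem ((1 / Real.cos (2 * ν) : ℝ) : ℂ) (hS.BA_mem θ hσ))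
  rw [h_apply ν θ]
  exact hG

end IsDilationModule

/-! ### Polynomials times Gaussians -/

/-- Multiplication by the monomial `x₁^{α₁} x₂^{α₂}`. -/
def mono (α : ℕ × ℕ) (u : 𝓢(Plane, ℂ)) : 𝓢(Plane, ℂ) := (X 0 ^ α.1) ((X 1 ^ α.2) u)

theorem X_pow_apply (j : Fin 2) (k : ℕ) (u : 𝓢(Plane, ℂ)) (x : Plane) :
    (X j ^ k) u x = (x j : ℂ) ^ k * u x := by
  induction k generalizing u with
  | zero => simp
  | succ k ih =>
    rw [pow_succ]
    change (X j ^ k) (X j u) x = _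
    rw [ih, X_apply]
    ring

theorem mono_apply (α : ℕ × ℕ) (u : 𝓢(Plane, ℂ)) (x : Plane) :
    mono α u x = (x 0 : ℂ) ^ α.1 * (x 1 : ℂ) ^ α.2 * u x := by
  rw [mono, X_pow_apply, X_pow_apply, mul_assoc]

theorem mono_smul (α : ℕ × ℕ) (c : ℂ) (u : 𝓢(Plane, ℂ)) : mono α (c • u) = c • mono α u := by
  simp [mono]

theorem X_mono (j : Fin 2) (α : ℕ × ℕ) (u : 𝓢(Plane, ℂ)) :
    X j (mono α u) = mono (raise j α) u := by
  ext x
  rw [X_apply, mono_apply, mono_apply]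
  fin_cases j <;> simp [raise] <;> ring

theorem D_X_pow (i j : Fin 2) (k : ℕ) (u : 𝓢(Plane, ℂ)) :
    D i ((X j ^ k) u) = (X j ^ k) (D i u) +
      (if i = j then (k : ℂ) else 0) • (X j ^ (k - 1)) u := by
  induction k with
  | zero => simp
  | succ k ih =>
    have h1 : ∀ u, (X j ^ (k + 1)) u = X j ((X j ^ k) u) := fun u => by rw [pow_succ']; rfl
    rw [h1, D_X, ih, map_add, map_smul, h1, add_assoc]
    congr 1
    split_ifs with hij
    · rw [Nat.add_sub_cancel, Nat.cast_succ, add_smul, one_smul]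
      congr 1
      rcases k with _ | k
      · simp
      · congr 1
        rw [Nat.add_sub_cancel, pow_succ']
        rfl
    · simp

theorem D_mono (j : Fin 2) (α : ℕ × ℕ) (u : 𝓢(Plane, ℂ)) :
    D j (mono α u) = mono α (D j u) + (occ j α : ℂ) • mono (lower j α) u := by
  rw [mono, D_X_pow, D_X_pow, map_add, map_smul]
  fin_cases j <;> simp [mono, occ, lower]

theorem exp_two_re_pos {z : ℂ} (hz : z.im ∈ nuRange) : 0 < (Complex.exp (2 * z) / 2).re := by
  have h2 : (Complex.exp (2 * z) / 2).re = Real.exp (2 * z.re) * Real.cos (2 * z.im) / 2 := by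
    rw [show (2 : ℂ) = ((2 : ℝ) : ℂ) by norm_num, Complex.div_ofReal_re, Complex.exp_re,
      Complex.re_ofReal_mul, Complex.im_ofReal_mul]
  rw [h2]
  have := Real.cos_pos_of_mem_Ioo (x := 2 * z.im) ⟨by linarith [hz.1], by linarith [hz.2]⟩
  positivity

theorem D_vacuum (ν : ℝ) (hν : ν ∈ nuRange) (j : Fin 2) :
    D j (vacuum ν hν) = (-Complex.exp (2 * Complex.I * ν)) • X j (vacuum ν hν) := by
  rw [vacuum, D_gaussian]
  congr 1
  ring

/-- A monomial times the Gaussian `e^{-c|x|²}`, in `L2`. -/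
def monoGauss (α : ℕ × ℕ) (c : ℂ) : L2 :=
  if hc : 0 < c.re then toL2 (mono α (gaussian c hc)) else 0

theorem monoGauss_of_pos (α : ℕ × ℕ) {c : ℂ} (hc : 0 < c.re) :
    monoGauss α c = toL2 (mono α (gaussian c hc)) := dif_pos hc

/-- Multiplication by `|x|²`. -/
def normSq (u : 𝓢(Plane, ℂ)) : 𝓢(Plane, ℂ) := X 0 (X 0 u) + X 1 (X 1 u)

theorem normSq_apply (u : 𝓢(Plane, ℂ)) (x : Plane) :
    normSq u x = ((‖x‖ ^ 2 : ℝ) : ℂ) * u x := by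
  rw [EuclideanSpace.norm_sq_eq, normSq, add_apply, X_apply, X_apply, X_apply, X_apply,
    Fin.sum_univ_two]
  simp
  ring

/-- Uses |e^u - 1 - u| ≤ |u|² e^{|u|} at u = -wr; half of the decay of e^{-cr} absorbs e^{|w|r}. -/
theorem norm_exp_taylor_le {c w : ℂ} {r : ℝ} (hr : 0 ≤ r) (hw : ‖w‖ ≤ c.re / 2) :
    ‖Complex.exp (-(c + w) * r) - Complex.exp (-c * r) + w * (r * Complex.exp (-c * r))‖ ≤
      ‖w‖ ^ 2 * ‖(r : ℂ) * (r * Complex.exp (-((c.re / 2 : ℝ) : ℂ) * r))‖ := by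
  have h1 := Complex.norm_exp_sub_sum_le_norm_mul_exp (-w * r) 2
  have h2 : Complex.exp (-(c + w) * r) - Complex.exp (-c * r) + w * (r * Complex.exp (-c * r)) =
      Complex.exp (-c * r) *
        (Complex.exp (-w * r) - ∑ m ∈ Finset.range 2, (-w * r) ^ m / m.factorial) := by
    rw [Finset.sum_range_succ, Finset.sum_range_one, show -(c + w) * (r : ℂ) = -c * r + -w * r by
      ring, Complex.exp_add]
    simp
    ring
  have h3 : ‖-w * (r : ℂ)‖ = ‖w‖ * r := by
    rw [norm_mul, norm_neg, Complex.norm_real, Real.norm_of_nonneg hr]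
  rw [h2, norm_mul]
  rw [h3] at h1
  have h4 : ∀ a : ℂ, ‖Complex.exp (-a * r)‖ = Real.exp (-a.re * r) := fun a => by
    rw [Complex.norm_exp, Complex.re_mul_ofReal, Complex.neg_re]
  rw [norm_mul, norm_mul, h4, h4, Complex.norm_real, Real.norm_of_nonneg hr, Complex.ofReal_re]
  calc Real.exp (-c.re * r) * _ ≤ Real.exp (-c.re * r) *
        ((‖w‖ * r) ^ 2 * Real.exp (‖w‖ * r)) := by gcongr
    _ = ‖w‖ ^ 2 * (r * (r * Real.exp (-c.re * r + ‖w‖ * r))) := by rw [Real.exp_add]; ring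
    _ ≤ _ := by
      gcongr
      nlinarith

theorem norm_toL2_le_of_le {u v : 𝓢(Plane, ℂ)} {K : ℝ} (huv : ∀ x, ‖u x‖ ≤ K * ‖v x‖) :
    ‖toL2 u‖ ≤ K * ‖toL2 v‖ := by
  refine Lp.norm_le_mul_norm_of_ae_le_mul ?_
  filter_upwards [toL2_coeFn u, toL2_coeFn v] with x h1 h2
  rw [h1, h2]
  exact huv x

/-- The derivative in c multiplies by -|x|², and the quadratic Taylor remainder is dominated by the
L² function x^α |x|⁴ e^{-(Re c/2)|x|²}, uniformly for |w| ≤ Re c/2. -/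
theorem differentiableAt_monoGauss (α : ℕ × ℕ) {c : ℂ} (hc : 0 < c.re) :
    DifferentiableAt ℂ (monoGauss α) c := by
  have hc2 : 0 < ((c.re / 2 : ℝ) : ℂ).re := by rw [Complex.ofReal_re]; linarith
  set g := mono α (normSq (normSq (gaussian ((c.re / 2 : ℝ) : ℂ) hc2)))
  set d := mono α (normSq (gaussian c hc))
  have hd : HasDerivAt (monoGauss α) (-toL2 d) c := by
    rw [hasDerivAt_iff_isLittleO_nhds_zero]
    have hO : (fun w : ℂ => monoGauss α (c + w) - monoGauss α c - w • -toL2 d)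
        =O[𝓝 0] fun w : ℂ => w ^ 2 := by
      refine Asymptotics.IsBigO.of_bound ‖toL2 g‖ ?_
      filter_upwards [Metric.closedBall_mem_nhds (0 : ℂ) (show 0 < c.re / 2 by linarith)]
        with w hw
      have hw' : ‖w‖ ≤ c.re / 2 := by simpa using hw
      have hcw : 0 < (c + w).re := by
        have := (abs_le.1 ((Complex.abs_re_le_norm w).trans hw')).1
        rw [Complex.add_re]
        linarith
      rw [monoGauss_of_pos α hc, monoGauss_of_pos α hcw, ← map_neg, ← map_smul, ← map_sub,
        ← map_sub, norm_pow, mul_comm]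
      refine norm_toL2_le_of_le fun x => ?_
      have h1 := norm_exp_taylor_le (c := c) (w := w) (r := ‖x‖ ^ 2) (by positivity) hw'
      have h2 : (mono α (gaussian (c + w) hcw) - mono α (gaussian c hc) - w • -d) x =
          (x 0 : ℂ) ^ α.1 * (x 1 : ℂ) ^ α.2 * (Complex.exp (-(c + w) * (‖x‖ ^ 2 : ℝ)) -
            Complex.exp (-c * (‖x‖ ^ 2 : ℝ)) +
            w * ((‖x‖ ^ 2 : ℝ) * Complex.exp (-c * (‖x‖ ^ 2 : ℝ)))) := by
        simp only [sub_apply, smul_apply, neg_apply, d, mono_apply, normSq_apply, gaussian_apply,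
          smul_eq_mul]
        ring
      have h3 : g x = (x 0 : ℂ) ^ α.1 * (x 1 : ℂ) ^ α.2 * ((‖x‖ ^ 2 : ℝ) *
          ((‖x‖ ^ 2 : ℝ) * Complex.exp (-((c.re / 2 : ℝ) : ℂ) * (‖x‖ ^ 2 : ℝ)))) := by
        simp only [g, mono_apply, normSq_apply, gaussian_apply]
      rw [h2, h3, norm_mul, norm_mul (_ * _) (_ * (_ * _)), mul_left_comm (‖w‖ ^ 2)]
      gcongr
    refine hO.trans_isLittleO ?_
    simpa using Asymptotics.isLittleO_pow_id (𝕜 := ℂ) (one_lt_two)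
  exact hd.differentiableAt

/-- The orbit of a monomial times the Gaussian `e^{-|x|²/2}` under complex dilations. -/
def gaussOrbit (α : ℕ × ℕ) (z : ℂ) : L2 :=
  Complex.exp (z * (1 + α.1 + α.2)) • monoGauss α (Complex.exp (2 * z) / 2)

theorem gaussOrbit_of_mem (α : ℕ × ℕ) {z : ℂ} (hz : z.im ∈ nuRange) :
    gaussOrbit α z = toL2 (Complex.exp (z * (1 + α.1 + α.2)) •
      mono α (gaussian (Complex.exp (2 * z) / 2) (exp_two_re_pos hz))) := by
  rw [gaussOrbit, monoGauss_of_pos α (exp_two_re_pos hz), map_smul]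

/-- Under dilation by e^r the monomial scales by e^{r|α|} and the unitary prefactor is e^r, whence
the exponent z(1 + |α|). -/
theorem gaussOrbit_add (α : ℕ × ℕ) {z : ℂ} (hz : z.im ∈ nuRange) (r : ℝ) :
    gaussOrbit α (z + r) = dil r (gaussOrbit α z) := by
  have hz' : (z + r).im ∈ nuRange := by simpa using hz
  rw [← isDilate_iff, gaussOrbit_of_mem α hz, gaussOrbit_of_mem α hz']
  have hq := Measure.quasiMeasurePreserving_smul (μ := (volume : Measure Plane))
    (Real.exp_pos r).ne'
  refine (toL2_coeFn _).trans ?_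
  filter_upwards [hq.ae (toL2_coeFn (Complex.exp (z * (1 + α.1 + α.2)) •
      mono α (gaussian (Complex.exp (2 * z) / 2) (exp_two_re_pos hz))))] with x hx
  rw [hx]
  simp only [smul_apply, mono_apply, gaussian_apply, smul_eq_mul, PiLp.smul_apply, norm_smul,
    Real.norm_of_nonneg (Real.exp_pos r).le]
  push_cast
  have h1 : Complex.exp ((z + r) * (1 + α.1 + α.2)) =
      Complex.exp r * Complex.exp r ^ α.1 * Complex.exp r ^ α.2 *
        Complex.exp (z * (1 + α.1 + α.2)) := by
    rw [← Complex.exp_nat_mul, ← Complex.exp_nat_mul, ← Complex.exp_add, ← Complex.exp_add,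
      ← Complex.exp_add]
    ring_nf
  have h2 : Complex.exp (2 * (z + r)) = Complex.exp (2 * z) * Complex.exp r ^ 2 := by
    rw [← Complex.exp_nat_mul, ← Complex.exp_add]
    push_cast
    ring_nf
  rw [h1, h2, mul_pow, mul_pow, mul_pow]
  rw [show -(Complex.exp (2 * z) * Complex.exp r ^ 2 / 2) * (‖x‖ : ℂ) ^ 2 =
    -(Complex.exp (2 * z) / 2) * (Complex.exp r ^ 2 * (‖x‖ : ℂ) ^ 2) by ring]
  ring

theorem differentiableOn_gaussOrbit (α : ℕ × ℕ) :
    DifferentiableOn ℂ (gaussOrbit α) (Complex.im ⁻¹' nuRange) := by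
  intro z hz
  have h1 : DifferentiableAt ℂ (fun z : ℂ => Complex.exp (2 * z) / 2) z := by fun_prop
  have h2 : DifferentiableAt ℂ (fun z : ℂ => Complex.exp (z * (1 + α.1 + α.2))) z := by
    fun_prop
  exact (h2.smul ((differentiableAt_monoGauss α (exp_two_re_pos hz)).comp z h1)
    ).differentiableWithinAt

theorem isContinuation_gaussOrbit (α : ℕ × ℕ) {ν : ℝ} (hν : ν ∈ nuRange) :
    IsContinuation ν (gaussOrbit α 0) (gaussOrbit α) := by
  refine isContinuation_of_differentiableOn (U := nuRange) (fun t ht => ?_)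
    (differentiableOn_gaussOrbit α) rfl fun z hz r => gaussOrbit_add α hz r
  have h0 := zero_mem_nuRange
  exact ⟨lt_of_lt_of_le (lt_min h0.1 hν.1) ht.1, lt_of_le_of_lt ht.2 (max_lt h0.2 hν.2)⟩

open Classical in
/-- The family `t ↦ T_t (x^α e^{-|x|²/2})`. -/
def gaussFamily (α : ℕ × ℕ) (t : ℝ) : 𝓢(Plane, ℂ) :=
  if ht : t ∈ nuRange then
    Complex.exp (Complex.I * t * (1 + α.1 + α.2)) • mono α (vacuum t ht) else 0

theorem gaussFamily_of_mem (α : ℕ × ℕ) {t : ℝ} (ht : t ∈ nuRange) :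
    gaussFamily α t = Complex.exp (Complex.I * t * (1 + α.1 + α.2)) • mono α (vacuum t ht) :=
  dif_pos ht

theorem toL2_gaussFamily (α : ℕ × ℕ) {t : ℝ} (ht : t ∈ nuRange) :
    toL2 (gaussFamily α t) = gaussOrbit α (Complex.I * t) := by
  rw [gaussFamily_of_mem α ht, map_smul, vacuum, ← monoGauss_of_pos, gaussOrbit, mul_assoc 2]

/-- The span of the orbits of the monomials times the Gaussian. -/
def gaussModule : Submodule ℂ (ℝ → 𝓢(Plane, ℂ)) := Submodule.span ℂ (Set.range gaussFamily)

theorem isDilationModule_gaussModule : IsDilationModule gaussModule nuRange where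
  X_mem σ hσ j := by
    induction hσ using Submodule.span_induction with
    | mem σ hσ =>
      obtain ⟨α, rfl⟩ := hσ
      refine Submodule.subset_span ⟨raise j α, ?_⟩
      funext t
      by_cases ht : t ∈ nuRange
      · rw [gaussFamily_of_mem _ ht, gaussFamily_of_mem _ ht, map_smul, X_mono, smul_smul, phase,
          ← Complex.exp_add]
        congr 2
        fin_cases j <;> simp [raise] <;> ring
      · simp [gaussFamily, ht]
    | zero => convert gaussModule.zero_mem; simp
    | add σ τ _ _ h1 h2 => convert gaussModule.add_mem h1 h2 using 1; funext t; simp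
    | smul c σ _ h1 =>
      convert gaussModule.smul_mem c h1 using 1; funext t; simp [smul_comm c]
  D_mem σ hσ j := by
    induction hσ using Submodule.span_induction with
    | mem σ hσ =>
      obtain ⟨α, rfl⟩ := hσ
      -- By Leibniz, ∂_j gives α_j times the lowered monomial and -e^{2it} times the raised one. The
      -- phase e^{-it} turns e^{it(1+|α|)} into the factor belonging to each new degree.
      have key : (fun t => phase (-t) • D j (gaussFamily α t)) =
          (occ j α : ℂ) • gaussFamily (lower j α) - gaussFamily (raise j α) := by
        funext t
        by_cases ht : t ∈ nuRange
        · rw [Pi.sub_apply, Pi.smul_apply, gaussFamily_of_mem _ ht, gaussFamily_of_mem _ ht,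
            gaussFamily_of_mem _ ht, map_smul, D_mono]
          rw [D_vacuum, mono_smul, smul_add, smul_smul, smul_add, smul_smul, smul_smul,
            smul_smul, smul_smul, add_comm, sub_eq_add_neg, ← neg_smul]
          have hX : mono α (X j (vacuum t ht)) = mono (raise j α) (vacuum t ht) := by
            ext x
            rw [mono_apply, X_apply, mono_apply]
            fin_cases j <;> simp [raise] <;> ring
          rw [hX]
          congr 2
          -- If α_j = 0 the truncated index does not matter, as the coefficient vanishes.
          · rcases eq_or_ne (occ j α) 0 with h0 | h0
            · simp [h0]
            · rw [phase, ← Complex.exp_add, mul_comm]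
              congr 2
              have h1 : α = raise j (lower j α) := (raise_lower h0).symm
              have h2 : (1 + α.1 + α.2 : ℂ) = 1 + (lower j α).1 + (lower j α).2 + 1 := by
                conv_lhs => rw [h1]
                generalize lower j α = β
                fin_cases j <;> simp [raise] <;> ring
              rw [h2]
              push_cast
              ring
          · rw [phase, ← mul_assoc, ← Complex.exp_add]
            have h3 : Complex.exp (Complex.I * t * (1 + (raise j α).1 + (raise j α).2)) =
                Complex.exp (Complex.I * (-t : ℝ) + Complex.I * t * (1 + α.1 + α.2)) *
                  Complex.exp (2 * Complex.I * t) := by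
              rw [← Complex.exp_add]
              congr 1
              fin_cases j <;> simp [raise] <;> ring
            rw [h3]
            ring
        · simp [gaussFamily, ht]
      rw [key]
      exact gaussModule.sub_mem (gaussModule.smul_mem _ (Submodule.subset_span ⟨_, rfl⟩))
        (Submodule.subset_span ⟨_, rfl⟩)
    | zero => convert gaussModule.zero_mem; simp
    | add σ τ _ _ h1 h2 => convert gaussModule.add_mem h1 h2 using 1; funext t; simp
    | smul c σ _ h1 =>
      convert gaussModule.smul_mem c h1 using 1; funext t; simp [smul_comm c]
  graph σ hσ t ht := by
    induction hσ using Submodule.span_induction with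
    | mem σ hσ =>
      obtain ⟨α, rfl⟩ := hσ
      rw [mem_graph_T, toL2_gaussFamily α zero_mem_nuRange, toL2_gaussFamily α ht]
      refine ⟨_, ?_, rfl⟩
      simpa using isContinuation_gaussOrbit α ht
    | zero => simp
    | add σ τ _ _ h1 h2 => simpa using (T t).graph.add_mem h1 h2
    | smul c σ _ h1 => simpa using (T t).graph.smul_mem c h1

/-! ### Totality of polynomials times a Gaussian -/

/-- An integrable function with vanishing Fourier transform is zero. -/
theorem ae_eq_zero_of_fourier_eq_zero {f : Plane → ℂ} (hf : Integrable f)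
    (h : ∀ ξ, FourierTransform.fourier f ξ = 0) : ∀ᵐ x, f x = 0 := by
  refine ae_eq_zero_of_integral_contDiff_smul_eq_zero hf.locallyIntegrable fun g hg hgs => ?_
  have hgs' : HasCompactSupport fun x => (g x : ℂ) := hgs.comp_left (g := Complex.ofReal) (by simp)
  have hg' : ContDiff ℝ ((⊤ : ℕ∞) : WithTop ℕ∞) fun x => (g x : ℂ) := Complex.ofRealCLM.contDiff.comp hg
  -- Write the test function g as the Fourier transform of a Schwartz function v; then ∫ f g = ∫ f̂
  -- v = 0.
  let u : 𝓢(Plane, ℂ) := hgs'.toSchwartzMap hg'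
  let v : 𝓢(Plane, ℂ) := FourierTransformInv.fourierInv u
  have hv : ∀ x, FourierTransform.fourier (v : Plane → ℂ) x = (g x : ℂ) := fun x => by
    rw [← SchwartzMap.fourier_coe, FourierTransform.fourier_fourierInv_eq]
    rfl
  have key := VectorFourier.integral_fourierIntegral_smul_eq_flip (L := innerₗ Plane)
    (μ := volume) (ν := volume) Real.continuous_fourierChar continuous_inner hf v.integrable
  have h1 : ∀ ξ, VectorFourier.fourierIntegral Real.fourierChar volume (innerₗ Plane) f ξ = 0 := h
  have h2 : ∀ x, VectorFourier.fourierIntegral Real.fourierChar volume (innerₗ Plane).flip v x =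
      (g x : ℂ) := by
    intro x
    rw [flip_innerₗ]
    exact hv x
  simp only [h1, h2, zero_smul, integral_zero] at key
  rw [key]
  refine integral_congr_ae (ae_of_all _ fun x => ?_)
  simp [mul_comm]

/-- Half of Re c is given up to absorb e^{M‖x‖}; completing the square yields the constant e^{M²/(2
Re c)}. -/
theorem exp_mul_norm_gaussian_le (c : ℂ) (hc : 0 < c.re) (M : ℝ) :
    ∃ (c' : ℂ) (hc' : 0 < c'.re) (K : ℝ), ∀ x : Plane,
      Real.exp (M * ‖x‖) * ‖gaussian c hc x‖ ≤ K * ‖gaussian c' hc' x‖ := by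
  refine ⟨((c.re / 2 : ℝ) : ℂ), by rw [Complex.ofReal_re]; linarith,
    Real.exp (M ^ 2 / (2 * c.re)), fun x => ?_⟩
  rw [gaussian_apply, gaussian_apply, Complex.norm_exp, Complex.norm_exp, Complex.re_mul_ofReal,
    Complex.re_mul_ofReal, Complex.neg_re, Complex.neg_re, Complex.ofReal_re, ← Real.exp_add,
    ← Real.exp_add]
  refine Real.exp_le_exp.2 ?_
  have h1 : M ^ 2 / (2 * c.re) + -(c.re / 2) * ‖x‖ ^ 2 - (M * ‖x‖ + -c.re * ‖x‖ ^ 2) =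
      (M - c.re * ‖x‖) ^ 2 / (2 * c.re) := by
    field_simp
    ring
  have h2 : 0 ≤ (M - c.re * ‖x‖) ^ 2 / (2 * c.re) := by positivity
  linarith

theorem integrable_exp_mul_gaussian (c : ℂ) (hc : 0 < c.re) (M : ℝ) (g : L2) :
    Integrable fun x : Plane => Real.exp (M * ‖x‖) * ‖gaussian c hc x‖ * ‖g x‖ := by
  obtain ⟨c', hc', K, hK⟩ := exp_mul_norm_gaussian_le c hc M
  have h1 : MemLp (fun x : Plane => Real.exp (M * ‖x‖) * ‖gaussian c hc x‖) 2 volume := by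
    refine MemLp.of_le_mul (c := K) ((gaussian c' hc').memLp 2 volume) ?_
      (ae_of_all _ fun x => ?_)
    · exact (by
        have := (gaussian c hc).continuous
        fun_prop : Continuous _).aestronglyMeasurable
    · rw [Real.norm_of_nonneg (by positivity)]
      exact hK x
  exact h1.integrable_mul (Lp.memLp g).norm

theorem inner_toL2_left (u : 𝓢(Plane, ℂ)) (g : L2) :
    inner ℂ (toL2 u) g = ∫ x, (starRingEnd ℂ) (u x) * g x := by
  rw [L2.inner_def]
  refine integral_congr_ae ?_
  filter_upwards [toL2_coeFn u] with x h1
  rw [h1, RCLike.inner_apply, mul_comm]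

/-- A space of Schwartz functions that contains a Gaussian and is stable under multiplication by
the coordinates is dense in `L2`. -/
theorem dense_map_of_gaussian_mem {c : ℂ} (hc : 0 < c.re) (W : Submodule ℂ 𝓢(Plane, ℂ))
    (hW : gaussian c hc ∈ W) (hX : ∀ u ∈ W, ∀ j, X j u ∈ W) :
    Dense (W.map toL2.toLinearMap : Set L2) := by
  rw [Submodule.dense_iff_topologicalClosure_eq_top, Submodule.topologicalClosure_eq_top_iff,
    Submodule.eq_bot_iff]
  intro g hg
  have horth : ∀ u ∈ W, ∫ x, (starRingEnd ℂ) (u x) * g x = 0 := fun u hu => by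
    rw [← inner_toL2_left]
    exact (Submodule.mem_orthogonal _ _).1 hg _ ⟨u, hu, rfl⟩
  -- It is enough that f = conj(Gaussian) · g vanishes. It has all exponential moments, so its
  -- Fourier transform can be expanded in polynomial moments.
  set f : Plane → ℂ := fun x => (starRingEnd ℂ) (gaussian c hc x) * g x with hf
  have hmeas : AEStronglyMeasurable f volume := by
    refine AEStronglyMeasurable.mul ?_ (Lp.aestronglyMeasurable g)
    exact (Complex.continuous_conj.comp (gaussian c hc).continuous).aestronglyMeasurable
  have hnorm : ∀ x, ‖f x‖ = ‖gaussian c hc x‖ * ‖g x‖ := fun x => by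
    rw [hf, norm_mul, RCLike.norm_conj]
  have hint : ∀ M : ℝ, Integrable fun x => Real.exp (M * ‖x‖) * ‖f x‖ := fun M => by
    simp_rw [hnorm, ← mul_assoc]
    exact integrable_exp_mul_gaussian c hc M g
  have hfi : Integrable f := by
    rw [← integrable_norm_iff hmeas]
    simpa using hint 0
  -- Powers of ⟨x, ξ⟩ times the Gaussian lie in W by stability under the coordinates, hence are
  -- orthogonal to g.
  have hmom : ∀ (ξ : Plane) (k : ℕ), ∫ x, ((inner ℝ x ξ : ℝ) : ℂ) ^ k * f x = 0 := by
    intro ξ k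
    have hu : ∀ k : ℕ, ∃ u ∈ W, ∀ x, u x = ((inner ℝ x ξ : ℝ) : ℂ) ^ k * gaussian c hc x := by
      intro k
      induction k with
      | zero => exact ⟨_, hW, fun x => by simp⟩
      | succ k ih =>
        obtain ⟨u, hu, hux⟩ := ih
        refine ⟨(ξ 0 : ℂ) • X 0 u + (ξ 1 : ℂ) • X 1 u,
          W.add_mem (W.smul_mem _ (hX u hu 0)) (W.smul_mem _ (hX u hu 1)), fun x => ?_⟩
        rw [add_apply, smul_apply, smul_apply, X_apply, X_apply, hux, pow_succ,
          PiLp.inner_apply, Fin.sum_univ_two]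
        simp
        ring
    obtain ⟨u, hu, hux⟩ := hu k
    rw [← horth u hu]
    refine integral_congr_ae (ae_of_all _ fun x => ?_)
    simp only [hux, hf, map_mul, map_pow, Complex.conj_ofReal]
    ring
  have hfour : ∀ ξ, FourierTransform.fourier f ξ = 0 := by
    intro ξ
    rw [Real.fourier_eq']
    -- Expand e^{-2πi⟨x,ξ⟩} in its power series; the terms are dominated by those of e^{M‖x‖}‖f x‖,
    -- which is integrable, and every term integrates to zero.
    set M : ℝ := 2 * Real.pi * ‖ξ‖
    have hs := hasSum_integral_of_dominated_convergence
      (F := fun (k : ℕ) (x : Plane) =>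
        ((((-2 * Real.pi * inner ℝ x ξ : ℝ) : ℂ) * Complex.I) ^ k / k.factorial) * f x)
      (f := fun x => Complex.exp (((-2 * Real.pi * inner ℝ x ξ : ℝ) : ℂ) * Complex.I) • f x)
      (μ := volume)
      (fun k x => (M * ‖x‖) ^ k / k.factorial * ‖f x‖) ?_ ?_ ?_ ?_ ?_
    · refine hs.unique ?_
      convert hasSum_zero with k
      have : ∀ x, ((((-2 * Real.pi * inner ℝ x ξ : ℝ) : ℂ) * Complex.I) ^ k / k.factorial) * f x =
          ((-2 * Real.pi * Complex.I) ^ k / k.factorial) *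
            (((inner ℝ x ξ : ℝ) : ℂ) ^ k * f x) := fun x => by
        push_cast
        ring
      simp_rw [this]
      rw [integral_const_mul, hmom, mul_zero]
    · intro k
      refine AEStronglyMeasurable.mul ?_ hmeas
      exact (by fun_prop : Continuous _).aestronglyMeasurable
    · refine fun k => ae_of_all _ fun x => ?_
      rw [norm_mul, norm_div, norm_pow, norm_mul, Complex.norm_I, mul_one, Complex.norm_real,
        Complex.norm_natCast]
      have : ‖-2 * Real.pi * inner ℝ x ξ‖ ≤ M * ‖x‖ := by
        rw [norm_mul, Real.norm_eq_abs (-2 * Real.pi), neg_mul, abs_neg,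
          abs_of_pos Real.two_pi_pos, mul_assoc (2 * Real.pi), mul_comm ‖ξ‖]
        exact mul_le_mul_of_nonneg_left (norm_inner_le_norm x ξ) Real.two_pi_pos.le
      gcongr
    · exact ae_of_all _ fun x => (Real.summable_pow_div_factorial _).mul_right _
    · refine (hint M).congr (ae_of_all _ fun x => ?_)
      change _ = ∑' k : ℕ, (M * ‖x‖) ^ k / k.factorial * ‖f x‖
      rw [tsum_mul_right, Real.exp_eq_exp_ℝ, NormedSpace.exp_eq_tsum_div]
    · refine ae_of_all _ fun x => ?_
      have := NormedSpace.expSeries_div_hasSum_exp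
        (((-2 * Real.pi * inner ℝ x ξ : ℝ) : ℂ) * Complex.I)
      rw [← Complex.exp_eq_exp_ℂ] at this
      exact this.mul_right _
  refine Lp.ext ?_
  filter_upwards [ae_eq_zero_of_fourier_eq_zero hfi hfour, Lp.coeFn_zero ℂ 2 (volume : Measure Plane)]
    with x hx h0
  rw [h0, Pi.zero_apply]
  refine (mul_eq_zero.1 hx).resolve_left ?_
  refine (map_ne_zero (starRingEnd ℂ)).2 ?_
  rw [gaussian_apply]
  exact Complex.exp_ne_zero _

theorem ladder_smul (C : Fin 2 → SOp) (c : ℂ) (v : 𝓢(Plane, ℂ)) (n : ℕ × ℕ) :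
    ladder C (c • v) n = c • ladder C v n := by
  simp only [ladder, map_smul, smul_comm c]

/-- Multiplication by x_j is a combination of raising and lowering, so the span of the ladder
vectors is stable under the coordinates and the Gaussian criterion applies. -/
theorem dense_span_ladder (ν : ℝ) (hν : ν ∈ nuRange) (θ : ℝ) {N : ℂ} (hN : N ≠ 0) :
    Dense (Submodule.span ℂ
      (Set.range fun n => toL2 (ladder (B ν θ) (N • vacuum ν hν) n)) : Set L2) := by
  have hA : ∀ j, A ν θ j (N • vacuum ν hν) = 0 := fun j => by rw [map_smul, A_vacuum, smul_zero]
  have := dense_map_of_gaussian_mem (gaussian_param_pos hν)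
    (Submodule.span ℂ (Set.range (ladder (B ν θ) (N • vacuum ν hν)))) ?_ ?_
  · rw [Submodule.map_span, ← Set.range_comp] at this
    exact this
  · have h0 : ladder (B ν θ) (N • vacuum ν hν) (0, 0) = N • vacuum ν hν := by simp [ladder]
    have h1 : N • vacuum ν hν ∈ Submodule.span ℂ (Set.range (ladder (B ν θ) (N • vacuum ν hν))) :=
      Submodule.subset_span ⟨(0, 0), h0⟩
    have h2 := Submodule.smul_mem _ N⁻¹ h1
    rwa [inv_smul_smul₀ hN] at h2
  · intro u hu j
    induction hu using Submodule.span_induction with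
    | mem u hu =>
      obtain ⟨n, rfl⟩ := hu
      rw [X_eq_A_add_B ν θ, A_ladder ν θ hA, B_ladder]
      exact Submodule.smul_mem _ _ (Submodule.add_mem _
        (Submodule.smul_mem _ _ (Submodule.subset_span ⟨_, rfl⟩))
        (Submodule.smul_mem _ _ (Submodule.subset_span ⟨_, rfl⟩)))
    | zero => rw [map_zero]; exact Submodule.zero_mem _
    | add u v _ _ h1 h2 => rw [map_add]; exact Submodule.add_mem _ h1 h2
    | smul c u _ h1 => rw [map_smul]; exact Submodule.smul_mem _ _ h1

/-! ### Complex conjugation -/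

/-- `v` is the complex conjugate of `u`. -/
def IsConj (u v : 𝓢(Plane, ℂ)) : Prop := ∀ x, v x = (starRingEnd ℂ) (u x)

theorem IsConj.smul {u v : 𝓢(Plane, ℂ)} (h : IsConj u v) {c d : ℂ} (hc : d = (starRingEnd ℂ) c) :
    IsConj (c • u) (d • v) := fun x => by
  rw [smul_apply, smul_apply, smul_eq_mul, smul_eq_mul, map_mul, h x, hc]

theorem IsConj.sub {u v u' v' : 𝓢(Plane, ℂ)} (h : IsConj u v) (h' : IsConj u' v') :
    IsConj (u - u') (v - v') := fun x => by
  rw [sub_apply, sub_apply, map_sub, h x, h' x]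

theorem IsConj.X {u v : 𝓢(Plane, ℂ)} (h : IsConj u v) (j : Fin 2) : IsConj (X j u) (X j v) :=
  fun x => by rw [X_apply, X_apply, map_mul, h x, Complex.conj_ofReal]

theorem IsConj.D {u v : 𝓢(Plane, ℂ)} (h : IsConj u v) (j : Fin 2) : IsConj (D j u) (D j v) := by
  intro x
  have h1 : (v : Plane → ℂ) = Complex.conjCLE ∘ u := funext h
  rw [D_apply_eq_fderiv, D_apply_eq_fderiv, h1, ContinuousLinearEquiv.comp_fderiv]
  rfl

/-- Conjugation commutes with x_j and ∂_j and inverts the phases, so it exchanges ν and -ν. -/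
theorem IsConj.B {u v : 𝓢(Plane, ℂ)} (h : IsConj u v) (ν θ : ℝ) (j : Fin 2) :
    IsConj (B ν θ j u) (B (-ν) θ j v) := by
  rw [B_apply, B_apply]
  exact (((h.X j).smul (conj_phase _).symm).sub
    ((h.D j).smul (conj_phase _).symm)).smul conj_rsqrtTwo.symm

theorem IsConj.ladder {u v : 𝓢(Plane, ℂ)} (h : IsConj u v) (ν θ : ℝ) (n : ℕ × ℕ) :
    IsConj (ladder (Swanson.B ν θ) u n) (ladder (Swanson.B (-ν) θ) v n) := by
  have hpow : ∀ (j : Fin 2) (k : ℕ) (u v : 𝓢(Plane, ℂ)), IsConj u v →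
      IsConj ((Swanson.B ν θ j ^ k) u) ((Swanson.B (-ν) θ j ^ k) v) := by
    intro j k
    induction k with
    | zero => exact fun u v h => h
    | succ k ih =>
      intro u v h
      simp_rw [pow_succ]
      exact ih _ _ (h.B ν θ j)
  exact (hpow 0 n.1 _ _ (hpow 1 n.2 _ _ h)).smul (Complex.conj_ofReal _).symm

theorem isConj_vacuum (ν : ℝ) (hν : ν ∈ nuRange) (hν' : -ν ∈ nuRange) :
    IsConj (vacuum ν hν) (vacuum (-ν) hν') := fun x => by
  rw [vacuum_apply, vacuum_apply, ← Complex.exp_conj]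
  congr 1
  rw [map_mul, Complex.conj_ofReal, map_neg, map_div₀, ← Complex.exp_conj]
  simp [Complex.conj_ofNat]

theorem IsConj.norm_eq {u v : 𝓢(Plane, ℂ)} (h : IsConj u v) : ‖toL2 v‖ = ‖toL2 u‖ := by
  refine le_antisymm ?_ ?_
  · simpa using norm_toL2_le_of_le (K := 1) (u := v) (v := u) fun x => by
      rw [h x, RCLike.norm_conj, one_mul]
  · simpa using norm_toL2_le_of_le (K := 1) (u := u) (v := v) fun x => by
      rw [h x, RCLike.norm_conj, one_mul]

/-! ### The oscillator vectors and their images under the complex dilations -/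

theorem B_eq (ν θ : ℝ) : B ν θ = B ν 0 := by
  funext j
  ext u : 1
  rw [B_apply, B_apply]

/-- The family `t ↦ T_t e_n`. -/
def eFamily (n : ℕ × ℕ) (t : ℝ) : 𝓢(Plane, ℂ) :=
  ladder (B t 0) (((1 / Real.sqrt Real.pi : ℝ) : ℂ) • gaussFamily (0, 0) t) n

theorem eFamily_mem (n : ℕ × ℕ) : eFamily n ∈ gaussModule :=
  isDilationModule_gaussModule.ladder_mem 0
    (gaussModule.smul_mem _ (Submodule.subset_span ⟨(0, 0), rfl⟩)) n

theorem gaussFamily_zero {t : ℝ} (ht : t ∈ nuRange) :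
    gaussFamily (0, 0) t = phase t • vacuum t ht := by
  rw [gaussFamily_of_mem _ ht, phase]
  simp [mono]

theorem eFamily_zero (n : ℕ × ℕ) : eFamily n 0 = eS n := by
  rw [eFamily, eS, gaussFamily_zero zero_mem_nuRange, phase_zero, one_smul]
  rfl

theorem eFamily_of_mem (n : ℕ × ℕ) {t : ℝ} (ht : t ∈ nuRange) :
    eFamily n t = (((1 / Real.sqrt Real.pi : ℝ) : ℂ) * phase t) •
      ladder (B t 0) (vacuum t ht) n := by
  rw [eFamily, gaussFamily_zero ht, smul_smul, ladder_smul]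

theorem e_eq_eFamily (n : ℕ × ℕ) : e n = toL2 (eFamily n 0) := by
  rw [e_eq, eFamily_zero]

theorem mem_graph_T_e (n : ℕ × ℕ) {t : ℝ} (ht : t ∈ nuRange) :
    (e n, toL2 (eFamily n t)) ∈ (T t).graph := by
  rw [e_eq_eFamily]
  exact isDilationModule_gaussModule.graph _ (eFamily_mem n) t ht

/-- T_ν e_{0,0} carries the constant π^{-1/2} e^{iν}; the coefficient here replaces it by N. -/
theorem phi_eq (ν : ℝ) (hν : ν ∈ nuRange) (θ : ℝ) (N : ℂ) (n : ℕ × ℕ) :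
    phi ν hν θ N n = (N * Real.sqrt Real.pi * phase (-ν)) • toL2 (eFamily n ν) := by
  have h1 : ((Real.sqrt Real.pi : ℝ) : ℂ) ≠ 0 :=
    Complex.ofReal_ne_zero.2 (Real.sqrt_pos.2 Real.pi_pos).ne'
  rw [phi, B_eq, ladder_smul, eFamily_of_mem n hν, map_smul, map_smul, smul_smul]
  congr 1
  have h2 : phase (-ν) * phase ν = 1 := by rw [phase_mul, neg_add_cancel, phase_zero]
  push_cast
  field_simp
  linear_combination (-N) * h2

theorem Psi_eq (ν : ℝ) (hν : ν ∈ nuRange) (θ : ℝ) (N : ℂ) (n : ℕ × ℕ) :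
    Psi ν hν θ N n = (N * Real.sqrt Real.pi * phase ν) • toL2 (eFamily n (-ν)) := by
  have := phi_eq (-ν) (neg_mem_nuRange hν) θ N n
  rw [neg_neg] at this
  rw [← this, Psi, Adag_eq]
  rfl

theorem norm_eFamily_neg (n : ℕ × ℕ) {t : ℝ} (ht : t ∈ nuRange) :
    ‖toL2 (eFamily n (-t))‖ = ‖toL2 (eFamily n t)‖ := by
  rw [eFamily_of_mem n ht, eFamily_of_mem n (neg_mem_nuRange ht)]
  refine (((isConj_vacuum t ht (neg_mem_nuRange ht)).ladder t 0 n).smul ?_).norm_eq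
  rw [map_mul, Complex.conj_ofReal, conj_phase]

/-- Moving T_{-t} across the inner product undoes T_t and leaves ⟨e_m, e_n⟩. -/
theorem inner_eFamily (m n : ℕ × ℕ) {t : ℝ} (ht : t ∈ nuRange) :
    inner ℂ (toL2 (eFamily m t)) (toL2 (eFamily n (-t))) = if m = n then (1 : ℂ) else 0 := by
  rw [← T_symmetric (graph_T_neg (mem_graph_T_e m ht)) (mem_graph_T_e n (neg_mem_nuRange ht))]
  exact orthonormal_iff_ite.1 orthonormal_e m n

/-! ### Divergence of the norms -/

theorem exists_orbit_of_mem_gaussModule {σ : ℝ → 𝓢(Plane, ℂ)} (hσ : σ ∈ gaussModule) :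
    ∃ F : ℂ → L2, DifferentiableOn ℂ F (Complex.im ⁻¹' nuRange) ∧
      (∀ t ∈ nuRange, F (Complex.I * t) = toL2 (σ t)) ∧
      ∀ z : ℂ, z.im ∈ nuRange → ∀ r : ℝ, F (z + r) = dil r (F z) := by
  induction hσ using Submodule.span_induction with
  | mem σ hσ =>
    obtain ⟨α, rfl⟩ := hσ
    exact ⟨gaussOrbit α, differentiableOn_gaussOrbit α,
      fun t ht => (toL2_gaussFamily α ht).symm, fun z hz r => gaussOrbit_add α hz r⟩
  | zero => exact ⟨0, differentiableOn_const 0, fun t _ => by simp, fun z _ r => by simp⟩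
  | add σ τ _ _ h1 h2 =>
    obtain ⟨F, hF, hF', hF''⟩ := h1
    obtain ⟨G, hG, hG', hG''⟩ := h2
    exact ⟨F + G, hF.add hG, fun t ht => by simp [hF' t ht, hG' t ht],
      fun z hz r => by simp [hF'' z hz, hG'' z hz]⟩
  | smul c σ _ h1 =>
    obtain ⟨F, hF, hF', hF''⟩ := h1
    exact ⟨c • F, hF.const_smul c, fun t ht => by simp [hF' t ht],
      fun z hz r => by simp [hF'' z hz]⟩

/-- The orbit of σ(0) is bounded by M on |Im z| ≤ ν, by its values at the two edges. Cauchy's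
estimate on the disc of radius ν then bounds its derivative at 0, which is Gσ(0). -/
theorem mul_norm_generator_le {σ : ℝ → 𝓢(Plane, ℂ)} (hσ : σ ∈ gaussModule) {ν M : ℝ}
    (hν : ν ∈ nuRange) (hpos : 0 < ν) (h1 : ‖toL2 (σ (-ν))‖ ≤ M) (h2 : ‖toL2 (σ ν)‖ ≤ M) :
    ν * ‖toL2 (dilationGenerator (σ 0))‖ ≤ M := by
  obtain ⟨F, hF, hFσ, hFr⟩ := exists_orbit_of_mem_gaussModule hσ
  have h0 : F 0 = toL2 (σ 0) := by simpa using hFσ 0 zero_mem_nuRange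
  have hball : Metric.closedBall (0 : ℂ) ν ⊆ Complex.im ⁻¹' Set.Icc (-ν) ν := fun z hz =>
    abs_le.1 ((Complex.abs_im_le_norm z).trans (by simpa using hz))
  have hsub : Set.Icc (-ν) ν ⊆ nuRange := fun t ht =>
    ⟨lt_of_lt_of_le (neg_mem_nuRange hν).1 ht.1, lt_of_le_of_lt ht.2 hν.2⟩
  -- Shifted by iν, the orbit becomes a continuation from σ(-ν) over the strip of height 2ν, to
  -- which the edge bound applies.
  have hcont : IsContinuation (2 * ν) (toL2 (σ (-ν))) fun z => F (z - Complex.I * ν) := by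
    refine isContinuation_of_differentiableOn (U := (fun t => t - ν) ⁻¹' nuRange) ?_ ?_ ?_ ?_
    · intro t ht
      rw [min_eq_left (by linarith), max_eq_right (by linarith)] at ht
      exact hsub ⟨by linarith [ht.1], by linarith [ht.2]⟩
    · refine hF.comp (by fun_prop) fun z hz => ?_
      simpa using hz
    · rw [← hFσ _ (neg_mem_nuRange hν)]
      congr 1
      push_cast
      ring
    · intro z hz r
      rw [← hFr _ (by simpa using hz)]
      congr 1
      ring
  have hbound : ∀ z : ℂ, z.im ∈ Set.Icc (-ν) ν → ‖F z‖ ≤ M := by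
    intro z hz
    have := hcont.norm_le (M := M) (z := z + Complex.I * ν) h1 ?_ ?_
    · simpa using this
    · have h3 : Complex.I * ((2 * ν : ℝ) : ℂ) - Complex.I * ν = Complex.I * ν := by
        push_cast
        ring
      rw [h3, hFσ ν hν]
      exact h2
    · rw [min_eq_left (by linarith), max_eq_right (by linarith)]
      simp only [Complex.add_im, Complex.mul_im, Complex.I_re, Complex.I_im, Complex.ofReal_re,
        Complex.ofReal_im]
      constructor <;> linarith [hz.1, hz.2]
  have hd : DifferentiableOn ℂ F (Metric.closedBall 0 ν) :=
    hF.mono (hball.trans (Set.preimage_mono hsub))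
  have hcauchy := Complex.norm_deriv_le_of_forall_mem_sphere_norm_le hpos
    (hd.mono Metric.closure_ball_subset_closedBall).diffContOnCl
    fun z hz => hbound z (hball (Metric.sphere_subset_closedBall hz))
  -- The complex derivative agrees with the derivative along the real axis, where F is the dilation
  -- orbit.
  have hder : deriv F 0 = toL2 (dilationGenerator (σ 0)) := by
    have hd0 : DifferentiableAt ℂ F ((0 : ℝ) : ℂ) :=
      hd.differentiableAt (by simpa using Metric.closedBall_mem_nhds _ hpos)
    have h3 := hd0.hasDerivAt.scomp (0 : ℝ) Complex.ofRealCLM.hasDerivAt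
    have h4 : (F ∘ Complex.ofReal) = fun s => dil s (toL2 (σ 0)) := by
      funext s
      rw [← h0, ← hFr 0 (by simpa using zero_mem_nuRange), zero_add]
      rfl
    rw [h4] at h3
    simpa using h3.unique (hasDerivAt_dil_zero (σ 0))
  rw [hder, le_div_iff₀ hpos] at hcauchy
  linarith

theorem tendsto_norm_eFamily {ν : ℝ} (hν : ν ∈ nuRange) (h0 : ν ≠ 0) :
    Tendsto (fun n => ‖toL2 (eFamily n ν)‖) cofinite atTop := by
  wlog hpos : 0 < ν generalizing ν
  · have := this (neg_mem_nuRange hν) (neg_ne_zero.2 h0)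
      (neg_pos.2 (lt_of_le_of_ne (not_lt.1 hpos) h0))
    simpa only [norm_eFamily_neg _ hν] using this
  refine tendsto_atTop_mono (fun n => ?_) (tendsto_norm_generator.const_mul_atTop hpos)
  have := mul_norm_generator_le (eFamily_mem n) hν hpos (norm_eFamily_neg n hν).le le_rfl
  rwa [eFamily_zero] at this

theorem tendsto_norm_phi {ν : ℝ} (hν : ν ∈ nuRange) (h0 : ν ≠ 0) (θ : ℝ) {N : ℂ} (hN : N ≠ 0) :
    Tendsto (fun n => ‖phi ν hν θ N n‖) cofinite atTop := by
  simp_rw [phi_eq, norm_smul]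
  refine (tendsto_norm_eFamily hν h0).const_mul_atTop (norm_pos_iff.2 ?_)
  exact mul_ne_zero (mul_ne_zero hN
    (Complex.ofReal_ne_zero.2 (Real.sqrt_pos.2 Real.pi_pos).ne')) (phase_ne_zero _)

theorem Psi_eq_phi (ν : ℝ) (hν : ν ∈ nuRange) (θ : ℝ) (N : ℂ) :
    Psi ν hν θ N = phi (-ν) (neg_mem_nuRange hν) θ N := by
  funext n
  rw [Psi, Adag_eq]
  rfl

/-! ### Riesz bases and Schauder bases -/

theorem not_isRieszBasis {u : ℕ × ℕ → L2} (hu : Tendsto (fun n => ‖u n‖) cofinite atTop) :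
    ¬ IsRieszBasis u := by
  rintro ⟨S, b, h⟩
  obtain ⟨n, hn⟩ := (hu.eventually_gt_atTop ‖(S : L2 →L[ℂ] L2)‖).exists
  have := (S : L2 →L[ℂ] L2).le_opNorm (b n)
  rw [b.orthonormal.1 n, mul_one] at this
  exact absurd (h n ▸ hn) (not_lt.2 this)

/-- In a basis the rank-one maps f ↦ ⟨v_k, f⟩ u_k are differences of consecutive partial sums, so
they are pointwise bounded, hence uniformly bounded by Banach–Steinhaus. Their norms ‖v_k‖ ‖u_k‖
diverge. -/
theorem not_isSchauderBasis {u v : ℕ × ℕ → L2}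
    (huv : ∀ m n, inner ℂ (v m) (u n) = if m = n then (1 : ℂ) else 0)
    (hu : Tendsto (fun n => ‖u n‖) cofinite atTop)
    (hv : Tendsto (fun n => ‖v n‖) cofinite atTop) (σ : ℕ ≃ ℕ × ℕ) : ¬ IsSchauderBasis σ u := by
  intro h
  let g : ℕ → L2 →L[ℂ] L2 := fun k => (innerSL ℂ (v (σ k))).smulRight (u (σ k))
  have hg : ∀ k f, g k f = (inner ℂ (v (σ k)) f : ℂ) • u (σ k) := fun k f => by simp [g]
  have hbdd : ∀ f, ∃ C, ∀ k, ‖g k f‖ ≤ C := by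
    intro f
    obtain ⟨c, hc, -⟩ := h f
    -- Biorthogonality forces the coefficients: pairing with v_k is eventually constant along the
    -- partial sums.
    have hcoef : ∀ k, inner ℂ (v (σ k)) f = c (σ k) := by
      intro k
      refine tendsto_nhds_unique ((continuous_const.inner continuous_id).continuousAt.tendsto.comp
        hc) ?_
      refine tendsto_const_nhds.congr' ?_
      filter_upwards [eventually_gt_atTop k] with N hN
      simp [inner_sum, inner_smul_right, huv, hN]
    have h0 : Tendsto (fun k => g k f) atTop (𝓝 0) := by
      have := (hc.comp (tendsto_add_atTop_nat 1)).sub hc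
      rw [sub_self] at this
      refine this.congr fun k => ?_
      simp [Finset.sum_range_succ, hg, hcoef]
    obtain ⟨C, hC⟩ := h0.norm.bddAbove_range
    exact ⟨C, fun k => hC ⟨k, rfl⟩⟩
  obtain ⟨C, hC⟩ := banach_steinhaus hbdd
  -- Evaluating the uniform bound at v_k gives ‖v_k‖² ‖u_k‖ ≤ C ‖v_k‖, impossible once ‖u_k‖ > C and
  -- ‖v_k‖ ≥ 1.
  obtain ⟨n, hn1, hn2⟩ := ((hu.eventually_gt_atTop C).and (hv.eventually_ge_atTop 1)).exists
  obtain ⟨k, rfl⟩ := σ.surjective n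
  have h1 := (g k).le_of_opNorm_le (hC k) (v (σ k))
  rw [hg, norm_smul, inner_self_eq_norm_sq_to_K, norm_pow, RCLike.norm_ofReal, abs_norm] at h1
  have h2 : ‖u (σ k)‖ ≤ ‖v (σ k)‖ * ‖u (σ k)‖ := le_mul_of_one_le_left (norm_nonneg _) hn2
  have h3 : 0 < ‖v (σ k)‖ * (‖v (σ k)‖ * ‖u (σ k)‖ - C) :=
    mul_pos (by linarith) (by linarith)
  linarith

/-! ### Gaussian averages of dilations of Schwartz functions -/

section

variable {E : Type} [NormedAddCommGroup E] [NormedSpace ℝ E] [NormedSpace ℂ E] {a : ℝ}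

theorem weight_add_one (a : ℝ) (b : ℂ) (s : ℝ) :
    weight a (b + 1) s = weight a b s * (Real.exp s : ℝ) := by
  rw [weight, weight, Complex.ofReal_exp, ← Complex.exp_add]
  congr 1
  ring

theorem integrable_weight_smul_comp_dilation (ha : 0 < a) (b : ℂ) (u : 𝓢(Plane, E)) (x : Plane) :
    Integrable fun s : ℝ => weight a b s • u (Real.exp s • x) := by
  obtain ⟨C, hC⟩ := u.decay 0 0
  refine (integrable_weight ha b).smul_bdd C ?_ (ae_of_all _ fun s => ?_)
  · exact (u.continuous.comp (by fun_prop)).aestronglyMeasurable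
  · simpa using hC.2 (Real.exp s • x)

/-- The pointwise average `∫ e^{-a s² + b s} u(e^s x) ds`. -/
def pointAverage (a : ℝ) (b : ℂ) (u : 𝓢(Plane, E)) (x : Plane) : E :=
  ∫ s : ℝ, weight a b s • u (Real.exp s • x)

/-- ‖x‖^k = e^{-ks} ‖e^s x‖^k: the decay of u takes the second factor, and the first only shifts b
by -k. -/
theorem exists_pow_mul_norm_pointAverage_le (ha : 0 < a) (b : ℂ) (u : 𝓢(Plane, E)) (k : ℕ) :
    ∃ C, ∀ x, ‖x‖ ^ k * ‖pointAverage a b u x‖ ≤ C := by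
  obtain ⟨C, hC⟩ := u.decay k 0
  refine ⟨∫ s, ‖weight a (b - k) s‖ * C, fun x => ?_⟩
  have h1 : ‖x‖ ^ k * ‖pointAverage a b u x‖ ≤
      ‖x‖ ^ k * ∫ s : ℝ, ‖weight a b s • u (Real.exp s • x)‖ := by
    gcongr
    exact norm_integral_le_integral_norm _
  refine h1.trans ?_
  rw [← integral_const_mul]
  refine integral_mono ((integrable_weight_smul_comp_dilation ha b u x).norm.const_mul _)
    ((integrable_weight ha _).norm.mul_const C) fun s => ?_
  have h2 : ‖weight a b s‖ = ‖weight a (b - k) s‖ * Real.exp s ^ k := by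
    rw [norm_weight, norm_weight, ← Real.exp_nat_mul, ← Real.exp_add, Complex.sub_re,
      Complex.natCast_re]
    ring_nf
  have h3 := hC.2 (Real.exp s • x)
  rw [norm_iteratedFDeriv_zero, norm_smul, Real.norm_of_nonneg (Real.exp_pos s).le, mul_pow] at h3
  calc ‖x‖ ^ k * ‖weight a b s • u (Real.exp s • x)‖
      = ‖weight a (b - k) s‖ * (Real.exp s ^ k * ‖x‖ ^ k * ‖u (Real.exp s • x)‖) := by
        rw [norm_smul, h2]
        ring
    _ ≤ _ := by gcongr

theorem hasFDerivAt_pointAverage [IsScalarTower ℝ ℂ E] (ha : 0 < a) (b : ℂ) (u : 𝓢(Plane, E)) (x : Plane) :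
    HasFDerivAt (pointAverage a b u)
      (pointAverage a (b + 1) (SchwartzMap.fderivCLM ℝ Plane E u) x) x := by
  set u' := SchwartzMap.fderivCLM ℝ Plane E u with hu'
  obtain ⟨C, hC⟩ := u'.decay 0 0
  refine hasFDerivAt_integral_of_dominated_of_fderiv_le (𝕜 := ℝ) (μ := volume)
    (F := fun x s => weight a b s • u (Real.exp s • x))
    (F' := fun x s => weight a (b + 1) s • u' (Real.exp s • x))
    (bound := fun s => ‖weight a (b + 1) s‖ * C) (s := Set.univ) univ_mem
    (Eventually.of_forall fun y => (integrable_weight_smul_comp_dilation ha b u y).aestronglyMeasurable)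
    (integrable_weight_smul_comp_dilation ha b u x)
    (integrable_weight_smul_comp_dilation ha (b + 1) u' x).aestronglyMeasurable ?_
    ((integrable_weight ha _).norm.mul_const C) ?_
  · refine ae_of_all _ fun s y _ => ?_
    rw [norm_smul]
    gcongr
    simpa using hC.2 (Real.exp s • y)
  · refine ae_of_all _ fun s y _ => ?_
    have h1 : HasFDerivAt u (u' (Real.exp s • y)) (Real.exp s • y) :=
      u.differentiableAt.hasFDerivAt
    have h2 := (h1.comp y ((hasFDerivAt_id y).const_smul (Real.exp s))).const_smul (weight a b s)
    refine h2.congr_fderiv ?_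
    rw [weight_add_one, mul_smul]
    congr 1
    ext v
    rw [ContinuousLinearMap.comp_apply, smul_apply, ContinuousLinearMap.id_apply, map_smul]
    exact (algebraMap_smul ℂ (Real.exp s) _).symm

/-- The derivative is again a point average, with b + 1 and values in a space of linear maps, so the
induction must range over all target spaces. -/
theorem contDiff_pointAverage (ha : 0 < a) (n : ℕ) : ∀ {E : Type} [NormedAddCommGroup E]
    [NormedSpace ℝ E] [NormedSpace ℂ E] [IsScalarTower ℝ ℂ E] (b : ℂ) (u : 𝓢(Plane, E)),
    ContDiff ℝ n (pointAverage a b u) := by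
  induction n with
  | zero =>
    intro E _ _ _ _ b u
    exact contDiff_zero.2 (continuous_iff_continuousAt.2 fun x =>
      (hasFDerivAt_pointAverage ha b u x).continuousAt)
  | succ n ih =>
    intro E _ _ _ _ b u
    push_cast
    rw [contDiff_succ_iff_hasFDerivAt]
    exact ⟨_, ih (b + 1) _, hasFDerivAt_pointAverage ha b u⟩

theorem decay_pointAverage (ha : 0 < a) (k n : ℕ) : ∀ {E : Type} [NormedAddCommGroup E]
    [NormedSpace ℝ E] [NormedSpace ℂ E] [IsScalarTower ℝ ℂ E] (b : ℂ) (u : 𝓢(Plane, E)),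
    ∃ C, ∀ x, ‖x‖ ^ k * ‖iteratedFDeriv ℝ n (pointAverage a b u) x‖ ≤ C := by
  induction n with
  | zero =>
    intro E _ _ _ _ b u
    simpa using exists_pow_mul_norm_pointAverage_le ha b u k
  | succ n ih =>
    intro E _ _ _ _ b u
    obtain ⟨C, hC⟩ := ih (b + 1) (SchwartzMap.fderivCLM ℝ Plane E u)
    refine ⟨C, fun x => ?_⟩
    have h1 : fderiv ℝ (pointAverage a b u) =
        pointAverage a (b + 1) (SchwartzMap.fderivCLM ℝ Plane E u) :=
      funext fun x => (hasFDerivAt_pointAverage ha b u x).fderiv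
    rw [← norm_iteratedFDeriv_fderiv, h1]
    exact hC x

end

/-- The Gaussian average of the dilates of a Schwartz function, as a Schwartz function. -/
def averageS {a : ℝ} (ha : 0 < a) (b : ℂ) (u : 𝓢(Plane, ℂ)) : 𝓢(Plane, ℂ) where
  toFun := pointAverage a (b + 1) u
  smooth' := contDiff_infty.2 fun n => contDiff_pointAverage ha n (b + 1) u
  decay' k n := decay_pointAverage ha k n (b + 1) u

theorem averageS_apply {a : ℝ} (ha : 0 < a) (b : ℂ) (u : 𝓢(Plane, ℂ)) (x : Plane) :
    averageS ha b u x = ∫ s : ℝ, weight a (b + 1) s • u (Real.exp s • x) := rfl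

/-- Since x_j = e^{-s}(e^s x)_j, multiplication lowers b by one, while differentiation raises it by
one. Through e^{-ibt} in `averageFamily` these shifts become the phases e^{it} and e^{-it}. -/
theorem X_averageS {a : ℝ} (ha : 0 < a) (b : ℂ) (u : 𝓢(Plane, ℂ)) (j : Fin 2) :
    X j (averageS ha b u) = averageS ha (b - 1) (X j u) := by
  ext x
  rw [X_apply, averageS_apply, averageS_apply, ← integral_const_mul, sub_add_cancel]
  refine integral_congr_ae (ae_of_all _ fun s => ?_)
  simp only [weight_add_one, X_apply, smul_eq_mul, PiLp.smul_apply]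
  push_cast
  ring

theorem D_averageS {a : ℝ} (ha : 0 < a) (b : ℂ) (u : 𝓢(Plane, ℂ)) (j : Fin 2) :
    D j (averageS ha b u) = averageS ha (b + 1) (D j u) := by
  ext x
  have h1 : fderiv ℝ (averageS ha b u) x =
      pointAverage a (b + 1 + 1) (SchwartzMap.fderivCLM ℝ Plane ℂ u) x :=
    (hasFDerivAt_pointAverage ha (b + 1) u x).fderiv
  rw [D_apply_eq_fderiv, h1, averageS_apply, pointAverage,
    ContinuousLinearMap.integral_apply (integrable_weight_smul_comp_dilation ha _ _ x)]
  refine integral_congr_ae (ae_of_all _ fun s => ?_)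
  simp only [D_apply_eq_fderiv]
  rfl

/-- Fubini against Schwartz test functions. The b + 1 in `averageS` accounts for the prefactor e^s
of the unitary dilation. -/
theorem toL2_averageS {a : ℝ} (ha : 0 < a) (b : ℂ) (u : 𝓢(Plane, ℂ)) :
    toL2 (averageS ha b u) = average ha b (toL2 u) := by
  refine denseRange_toL2.eq_of_inner_right ℂ fun v => ?_
  obtain ⟨C, hC⟩ := u.decay 0 0
  have hint : Integrable (Function.uncurry fun (x : Plane) (s : ℝ) =>
      (starRingEnd ℂ) (v x) * (weight a (b + 1) s * u (Real.exp s • x)))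
      ((volume : Measure Plane).prod volume) := by
    refine Integrable.mono' (g := fun p => ‖v p.1‖ * (‖weight a (b + 1) p.2‖ * C))
      (v.integrable.norm.mul_prod ((integrable_weight ha _).norm.mul_const C)) ?_
      (ae_of_all _ fun p => ?_)
    · have h1 := v.continuous
      have h2 := u.continuous
      have h3 := continuous_weight a (b + 1)
      exact (by unfold Function.uncurry; fun_prop : Continuous _).aestronglyMeasurable
    · simp only [Function.uncurry, norm_mul, RCLike.norm_conj]
      gcongr
      simpa using hC.2 (Real.exp p.2 • p.1)
  have h1 : inner ℂ (toL2 v) (toL2 (averageS ha b u)) = ∫ x : Plane, ∫ s : ℝ,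
      (starRingEnd ℂ) (v x) * (weight a (b + 1) s * u (Real.exp s • x)) := by
    rw [inner_toL2_left]
    refine integral_congr_ae ?_
    filter_upwards [toL2_coeFn (averageS ha b u)] with x hx
    rw [hx, averageS_apply, ← integral_const_mul]
    rfl
  have h2 : inner ℂ (toL2 v) (average ha b (toL2 u)) = ∫ s : ℝ, ∫ x : Plane,
      (starRingEnd ℂ) (v x) * (weight a (b + 1) s * u (Real.exp s • x)) := by
    rw [average_apply, ← integral_inner (integrable_weight_smul_dil ha b _)]
    refine integral_congr_ae (ae_of_all _ fun s => ?_)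
    have hq := Measure.quasiMeasurePreserving_smul (μ := (volume : Measure Plane))
      (Real.exp_pos s).ne'
    simp only
    rw [inner_smul_right, inner_toL2_left, ← integral_const_mul]
    refine integral_congr_ae ?_
    filter_upwards [isDilate_dil s (toL2 u), hq.ae (toL2_coeFn u)] with x hx hx'
    rw [hx, hx', weight_add_one]
    ring
  rw [h1, h2, integral_integral_swap hint]

/-! ### The module of Gaussian averages -/

/-- The family `t ↦ T_t (averageS b u)`. -/
def averageFamily {a : ℝ} (ha : 0 < a) (b : ℂ) (u : 𝓢(Plane, ℂ)) (t : ℝ) : 𝓢(Plane, ℂ) :=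
  Complex.exp (a * t ^ 2 - Complex.I * b * t) • averageS ha (b + 2 * Complex.I * a * t) u

theorem averageFamily_add {a : ℝ} (ha : 0 < a) (b : ℂ) (u : 𝓢(Plane, ℂ)) (t r : ℝ) :
    averageFamily ha b u (t + r) = Complex.exp (a * r ^ 2 - Complex.I * b * r) •
      averageFamily ha (b + 2 * Complex.I * a * r) u t := by
  rw [averageFamily, averageFamily, smul_smul, ← Complex.exp_add]
  congr 2
  · push_cast
    linear_combination (2 * a * r * t : ℂ) * Complex.I_sq
  · push_cast
    ring

/-- The span of the orbits of the Gaussian averages. -/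
def averageModule : Submodule ℂ (ℝ → 𝓢(Plane, ℂ)) :=
  Submodule.span ℂ {σ | ∃ (a : ℝ) (ha : 0 < a) (b : ℂ) (u : 𝓢(Plane, ℂ)), σ = averageFamily ha b u}

theorem averageFamily_mem {a : ℝ} (ha : 0 < a) (b : ℂ) (u : 𝓢(Plane, ℂ)) :
    averageFamily ha b u ∈ averageModule := Submodule.subset_span ⟨a, ha, b, u, rfl⟩

theorem isDilationModule_averageModule : IsDilationModule averageModule Set.univ where
  X_mem σ hσ j := by
    induction hσ using Submodule.span_induction with
    | mem σ hσ =>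
      obtain ⟨a, ha, b, u, rfl⟩ := hσ
      convert averageFamily_mem ha (b - 1) (X j u) using 1
      funext t
      rw [averageFamily, averageFamily, map_smul, X_averageS, smul_smul, phase, ← Complex.exp_add]
      congr 2 <;> ring
    | zero => convert averageModule.zero_mem; simp
    | add σ τ _ _ h1 h2 => convert averageModule.add_mem h1 h2 using 1; funext t; simp
    | smul c σ _ h1 =>
      convert averageModule.smul_mem c h1 using 1; funext t; simp [smul_comm c]
  D_mem σ hσ j := by
    induction hσ using Submodule.span_induction with
    | mem σ hσ =>
      obtain ⟨a, ha, b, u, rfl⟩ := hσ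
      convert averageFamily_mem ha (b + 1) (D j u) using 1
      funext t
      rw [averageFamily, averageFamily, map_smul, D_averageS, smul_smul, phase, ← Complex.exp_add]
      congr 2
      · push_cast
        ring
      · ring
    | zero => convert averageModule.zero_mem; simp
    | add σ τ _ _ h1 h2 => convert averageModule.add_mem h1 h2 using 1; funext t; simp
    | smul c σ _ h1 =>
      convert averageModule.smul_mem c h1 using 1; funext t; simp [smul_comm c]
  graph σ hσ t ht := by
    induction hσ using Submodule.span_induction with
    | mem σ hσ =>
      obtain ⟨a, ha, b, u, rfl⟩ := hσ
      convert average_mem_graph_T ha b (toL2 u) t using 2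
      · simp [averageFamily, toL2_averageS]
      · simp [averageFamily, toL2_averageS]
    | zero => simp
    | add σ τ _ _ h1 h2 => simpa using (T t).graph.add_mem h1 h2
    | smul c σ _ h1 => simpa using (T t).graph.smul_mem c h1

theorem comp_add_mem_averageModule {σ : ℝ → 𝓢(Plane, ℂ)} (hσ : σ ∈ averageModule) (r : ℝ) :
    (fun t => σ (t + r)) ∈ averageModule := by
  induction hσ using Submodule.span_induction with
  | mem σ hσ =>
    obtain ⟨a, ha, b, u, rfl⟩ := hσ
    simp_rw [averageFamily_add]
    exact averageModule.smul_mem _ (averageFamily_mem ha _ u)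
  | zero => exact averageModule.zero_mem
  | add σ τ _ _ h1 h2 => exact averageModule.add_mem h1 h2
  | smul c σ _ h1 => exact averageModule.smul_mem c h1

/-- The module is invariant under translation of t, so one subspace serves operators with parameters
ν and -ν at once. -/
theorem fiber_averageModule (t r : ℝ) : fiber averageModule t = fiber averageModule r := by
  have key : ∀ t r, fiber averageModule t ≤ fiber averageModule r := by
    rintro t r f ⟨σ, hσ, rfl⟩
    exact ⟨_, comp_add_mem_averageModule hσ (t - r), by simp⟩
  exact le_antisymm (key t r) (key r t)

theorem dense_fiber_averageModule (t : ℝ) : Dense (fiber averageModule t : Set L2) := by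
  rw [fiber_averageModule t 0]
  refine Dense.of_closure (denseRange_toL2.mono ?_)
  rintro _ ⟨u, rfl⟩
  refine mem_closure_of_tendsto (tendsto_approxId (toL2 u)) (Eventually.of_forall fun c => ?_)
  refine (fiber averageModule 0).smul_mem _ ⟨_, averageFamily_mem (a := c ^ 2 + 1)
    (by positivity) 0 u, ?_⟩
  simp [averageFamily, toL2_averageS]

theorem leavesStable_Theta (ν : ℝ) (N₁ : ℂ) (t : ℝ) :
    LeavesStable (Theta ν N₁) (fiber averageModule t) := by
  rw [fiber_averageModule t ν]
  rintro f ⟨σ, hσ, rfl⟩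
  refine ⟨_, ?_, isDilationModule_averageModule.Theta_graph trivial trivial N₁ hσ⟩
  rw [fiber_averageModule ν (-ν)]
  exact Submodule.smul_mem _ _ ⟨σ, hσ, rfl⟩

theorem leavesStable_Theta_inverse (ν : ℝ) {N₁ : ℂ} (hN : N₁ ≠ 0) (t : ℝ) :
    LeavesStable (Theta ν N₁).inverse (fiber averageModule t) := by
  rw [fiber_averageModule t (-ν)]
  rintro f ⟨σ, hσ, rfl⟩
  have hc : ((metricConst N₁ : ℝ) : ℂ) ≠ 0 := Complex.ofReal_ne_zero.2 (metricConst_pos hN).ne'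
  refine ⟨((metricConst N₁ : ℝ) : ℂ)⁻¹ • toL2 (σ ν), ?_, ?_⟩
  · rw [fiber_averageModule (-ν) ν]
    exact Submodule.smul_mem _ _ ⟨σ, hσ, rfl⟩
  · rw [mem_graph_Theta_inverse hN]
    have := (Theta ν N₁).graph.smul_mem ((metricConst N₁ : ℝ) : ℂ)⁻¹
      (isDilationModule_averageModule.Theta_graph (ν := ν) trivial trivial N₁ hσ)
    rwa [Prod.smul_mk, inv_smul_smul₀ hc] at this

/-- Translate the family until its evaluation point agrees with the parameter of A. -/
theorem A_mem_fiber_averageModule (ν θ t : ℝ) {σ : ℝ → 𝓢(Plane, ℂ)} (hσ : σ ∈ averageModule)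
    (j : Fin 2) : toL2 (A ν θ j (σ t)) ∈ fiber averageModule t := by
  have := comp_add_mem_averageModule hσ (t - ν)
  rw [fiber_averageModule t ν]
  exact ⟨_, isDilationModule_averageModule.A_mem θ this j, by simp⟩

theorem B_mem_fiber_averageModule (ν θ t : ℝ) {σ : ℝ → 𝓢(Plane, ℂ)} (hσ : σ ∈ averageModule)
    (j : Fin 2) : toL2 (B ν θ j (σ t)) ∈ fiber averageModule t := by
  have := comp_add_mem_averageModule hσ (t - ν)
  rw [fiber_averageModule t ν]
  exact ⟨_, isDilationModule_averageModule.B_mem θ this j, by simp⟩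

theorem leavesStable_A (ν θ t : ℝ) (j : Fin 2) :
    LeavesStable (toPMap (A ν θ j)) (fiber averageModule t) := by
  rintro f ⟨σ, hσ, rfl⟩
  exact ⟨_, A_mem_fiber_averageModule ν θ t hσ j, mem_graph_toPMap_toL2 _ _⟩

theorem leavesStable_B (ν θ t : ℝ) (j : Fin 2) :
    LeavesStable (toPMap (B ν θ j)) (fiber averageModule t) := by
  rintro f ⟨σ, hσ, rfl⟩
  exact ⟨_, B_mem_fiber_averageModule ν θ t hσ j, mem_graph_toPMap_toL2 _ _⟩

theorem leavesStable_adjoint_A (ν θ t : ℝ) (j : Fin 2) :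
    LeavesStable (toPMap (A ν θ j)).adjoint (fiber averageModule t) := by
  rintro f ⟨σ, hσ, rfl⟩
  exact ⟨_, B_mem_fiber_averageModule (-ν) θ t hσ j, mem_graph_adjoint_A ν θ j (σ t)⟩

theorem leavesStable_adjoint_B (ν θ t : ℝ) (j : Fin 2) :
    LeavesStable (toPMap (B ν θ j)).adjoint (fiber averageModule t) := by
  rintro f ⟨σ, hσ, rfl⟩
  exact ⟨_, A_mem_fiber_averageModule (-ν) θ t hσ j, mem_graph_adjoint_B ν θ j (σ t)⟩

/-! ### The oscillator basis and the quasi-bases -/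

theorem dense_De : Dense (De : Set L2) := by
  have h1 : ((1 / Real.sqrt Real.pi : ℝ) : ℂ) ≠ 0 :=
    Complex.ofReal_ne_zero.2 (one_div_pos.2 (Real.sqrt_pos.2 Real.pi_pos)).ne'
  have h2 := dense_span_ladder 0 zero_mem_nuRange 0 h1
  have h3 : e = fun n => toL2 (ladder (B 0 0)
    (((1 / Real.sqrt Real.pi : ℝ) : ℂ) • vacuum 0 zero_mem_nuRange) n) := funext e_eq
  rw [De, h3]
  exact h2

/-- The oscillator vectors as a Hilbert basis. -/
def eBasis : HilbertBasis (ℕ × ℕ) ℂ L2 :=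
  HilbertBasis.mk orthonormal_e
    (Submodule.dense_iff_topologicalClosure_eq_top.1 dense_De).ge

theorem eBasis_apply (n : ℕ × ℕ) : eBasis n = e n :=
  congrFun (HilbertBasis.coe_mk orthonormal_e _) n

theorem De_le_fiber : De ≤ fiber gaussModule 0 := by
  rw [De, Submodule.span_le]
  rintro _ ⟨n, rfl⟩
  exact ⟨_, eFamily_mem n, (e_eq_eFamily n).symm⟩

theorem span_phi_le_fiber (ν : ℝ) (hν : ν ∈ nuRange) (θ : ℝ) (N : ℂ) :
    Submodule.span ℂ (Set.range (phi ν hν θ N)) ≤ fiber gaussModule ν := by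
  rw [Submodule.span_le]
  rintro _ ⟨n, rfl⟩
  rw [phi_eq]
  exact Submodule.smul_mem _ _ ⟨_, eFamily_mem n, rfl⟩

/-- Parseval's identity in the basis e_n for T_ν f and T_{-ν} g, with the dilations then moved onto
e_n by symmetry. Both images exist because vectors of `De` are polynomials times a Gaussian. -/
theorem hasSum_inner_eFamily {ν : ℝ} (hν : ν ∈ nuRange) {f g : L2} (hf : f ∈ De) (hg : g ∈ De) :
    HasSum (fun n => inner ℂ f (toL2 (eFamily n ν)) * inner ℂ (toL2 (eFamily n (-ν))) g)
      (inner ℂ f g) := by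
  obtain ⟨σ, hσ, rfl⟩ := mem_fiber.1 (De_le_fiber hf)
  obtain ⟨τ, hτ, rfl⟩ := mem_fiber.1 (De_le_fiber hg)
  have h1 := isDilationModule_gaussModule.graph σ hσ ν hν
  have h2 := isDilationModule_gaussModule.graph τ hτ (-ν) (neg_mem_nuRange hν)
  have h3 := eBasis.hasSum_inner_mul_inner (toL2 (σ ν)) (toL2 (τ (-ν)))
  rw [← T_symmetric (isDilationModule_gaussModule.graph_sub hν hσ) h2] at h3
  refine h3.congr_fun fun n => ?_
  rw [eBasis_apply, T_symmetric h1 (mem_graph_T_e n hν),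
    T_symmetric (mem_graph_T_e n (neg_mem_nuRange hν)) h2]

/-- The normalisation of N₁ and N₂ is what makes the coefficients of `phi_eq` and `Psi_eq` dual to
each other. -/
theorem conj_mul_coefficient {ν : ℝ} {N₁ N₂ : ℂ}
    (hN : star N₁ * N₂ = Complex.exp (-2 * Complex.I * ν) / Real.pi) :
    (starRingEnd ℂ) (N₁ * Real.sqrt Real.pi * phase (-ν)) * (N₂ * Real.sqrt Real.pi * phase ν) =
      1 := by
  have h1 : ((Real.sqrt Real.pi : ℝ) : ℂ) * Real.sqrt Real.pi = Real.pi := by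
    rw [← Complex.ofReal_mul, Real.mul_self_sqrt Real.pi_pos.le]
  have h2 : Complex.exp (-2 * Complex.I * ν) = phase (-ν) * phase (-ν) := by
    rw [phase_mul, phase]
    congr 1
    push_cast
    ring
  have h3 : (Real.pi : ℂ) ≠ 0 := Complex.ofReal_ne_zero.2 Real.pi_pos.ne'
  have h4 : (starRingEnd ℂ) N₁ * N₂ * Real.pi = phase (-ν) * phase (-ν) := by
    rw [← h2, ← div_mul_cancel₀ (Complex.exp (-2 * Complex.I * ν)) h3, ← hN]
    rfl
  rw [map_mul, map_mul, Complex.conj_ofReal, conj_phase, neg_neg]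
  linear_combination ((starRingEnd ℂ) N₁ * N₂ * phase ν * phase ν) * h1 +
    phase ν * phase ν * h4 + (phase (-ν) * phase ν + 1) * phase_neg_mul ν

theorem isQuasiBases_phi_Psi {ν : ℝ} (hν : ν ∈ nuRange) (θ : ℝ) {N₁ N₂ : ℂ}
    (hN : star N₁ * N₂ = Complex.exp (-2 * Complex.I * ν) / Real.pi) :
    IsQuasiBases (phi ν hν θ N₁) (Psi ν hν θ N₂) De := by
  have hc := conj_mul_coefficient hN
  have hc' := congrArg (starRingEnd ℂ) hc
  rw [map_mul, Complex.conj_conj, map_one] at hc'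
  refine ⟨fun m n => ?_, dense_De, fun f hf g hg => ⟨?_, ?_⟩⟩
  · rw [phi_eq, Psi_eq, inner_smul_left, inner_smul_right, inner_eFamily m n hν, ← mul_assoc, hc,
      one_mul]
  · refine (hasSum_inner_eFamily hν hf hg).congr_fun fun n => ?_
    rw [phi_eq, Psi_eq, inner_smul_left, inner_smul_right]
    linear_combination (inner ℂ f (toL2 (eFamily n ν)) *
      inner ℂ (toL2 (eFamily n (-ν))) g) * hc'
  · refine ((neg_neg ν ▸ hasSum_inner_eFamily (neg_mem_nuRange hν) hf hg)).congr_fun fun n => ?_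
    rw [phi_eq, Psi_eq, inner_smul_left, inner_smul_right]
    linear_combination (inner ℂ f (toL2 (eFamily n (-ν))) *
      inner ℂ (toL2 (eFamily n ν)) g) * hc

theorem Theta_phi {ν : ℝ} (hν : ν ∈ nuRange) (θ : ℝ) {N₁ N₂ : ℂ}
    (hN : star N₁ * N₂ = Complex.exp (-2 * Complex.I * ν) / Real.pi) (hN₁ : N₁ ≠ 0) (n : ℕ × ℕ) :
    (phi ν hν θ N₁ n, Psi ν hν θ N₂ n) ∈ (Theta ν N₁).graph := by
  have h1 := (Theta ν N₁).graph.smul_mem (N₁ * Real.sqrt Real.pi * phase (-ν))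
    (isDilationModule_gaussModule.Theta_graph hν (neg_mem_nuRange hν) N₁ (eFamily_mem n))
  rw [Prod.smul_mk, ← phi_eq ν hν θ, smul_smul] at h1
  rw [Psi_eq]
  convert h1 using 3
  have hc := conj_mul_coefficient hN
  set c := N₁ * Real.sqrt Real.pi * phase (-ν) with hcdef
  -- Here |c|² = π|N₁|², the inverse of the constant in Θ; with conj c times the coefficient of Ψ_n
  -- equal to 1, this identifies ΘΦ-side and Ψ-side coefficients.
  have h2 : (starRingEnd ℂ) c * c = (metricConst N₁ : ℂ)⁻¹ := by
    rw [Complex.conj_mul', hcdef, norm_mul, norm_mul, Complex.norm_real, phase,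
      mul_comm Complex.I, Complex.norm_exp_ofReal_mul_I, metricConst,
      Real.norm_of_nonneg (Real.sqrt_nonneg _), mul_one, ← Complex.ofReal_pow, mul_pow,
      Real.sq_sqrt Real.pi_pos.le]
    push_cast
    rw [one_div, inv_inv, mul_comm]
  have h3 : (metricConst N₁ : ℂ) ≠ 0 := Complex.ofReal_ne_zero.2 (metricConst_pos hN₁).ne'
  have h4 : (starRingEnd ℂ) c ≠ 0 := left_ne_zero_of_mul_eq_one hc
  refine mul_left_cancel₀ h4 ?_
  rw [hc, ← mul_assoc, h2, inv_mul_cancel₀ h3]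

theorem not_isBddOp_T {ν : ℝ} (hν : ν ∈ nuRange) (h0 : ν ≠ 0) : ¬ IsBddOp (T ν) := by
  intro h
  obtain ⟨K, -, hK⟩ := h.graph
  obtain ⟨n, hn⟩ := ((tendsto_norm_eFamily hν h0).eventually_gt_atTop K).exists
  have := hK _ _ (mem_graph_T_e n hν)
  rw [orthonormal_e.1 n, mul_one] at this
  exact absurd hn (not_lt.2 this)

/-! ### Essential self-adjointness of the oscillator Hamiltonian -/

/-- A symmetric operator with a complete orthonormal system of eigenvectors in its domain is
essentially self-adjoint. -/
theorem isSelfAdjoint_closure_toPMap {C : SOp}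
    (hC : ∀ u v, inner ℂ (toL2 (C u)) (toL2 v) = inner ℂ (toL2 u) (toL2 (C v)))
    {ι : Type*} (b : HilbertBasis ι ℂ L2) (s : ι → 𝓢(Plane, ℂ)) (hs : ∀ n, b n = toL2 (s n))
    (c : ι → ℝ) (hc : ∀ n, C (s n) = (c n : ℂ) • s n) : IsSelfAdjoint (toPMap C).closure := by
  have hcl : (toPMap C).IsClosable := LinearPMap.isClosable_iff_exists_closed_extension.2
    ⟨_, LinearPMap.adjoint_isClosed (dense_domain_toPMap C), toPMap_le_adjoint hC⟩
  have hgraph : ((toPMap C).closure.graph : Set (L2 × L2)) =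
      closure ((toPMap C).graph : Set (L2 × L2)) := by
    rw [← hcl.graph_closure_eq_closure_graph]
    rfl
  have hclosed : ∀ x y : L2, IsClosed {p : L2 × L2 | inner ℂ p.2 x = inner ℂ p.1 y} := fun x y =>
    isClosed_eq (continuous_snd.inner continuous_const) (continuous_fst.inner continuous_const)
  have hsymm : ∀ p ∈ closure ((toPMap C).graph : Set (L2 × L2)),
      ∀ q ∈ closure ((toPMap C).graph : Set (L2 × L2)), inner ℂ q.2 p.1 = inner ℂ q.1 p.2 := by
    -- Symmetry passes to the closure one argument at a time.
    have h1 : ∀ p ∈ ((toPMap C).graph : Set (L2 × L2)),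
        ∀ q ∈ closure ((toPMap C).graph : Set (L2 × L2)), inner ℂ q.2 p.1 = inner ℂ q.1 p.2 := by
      intro p hp
      refine closure_minimal (fun q hq => ?_) (hclosed p.1 p.2)
      obtain ⟨u, hu, hu'⟩ := (mem_graph_toPMap C p.1 p.2).1 hp
      obtain ⟨v, hv, hv'⟩ := (mem_graph_toPMap C q.1 q.2).1 hq
      change inner ℂ q.2 p.1 = inner ℂ q.1 p.2
      rw [← hu, ← hu', ← hv, ← hv', hC]
    intro p hp
    refine closure_minimal (fun q hq => ?_) (hclosed p.1 p.2)
    have := h1 q hq p hp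
    change inner ℂ q.2 p.1 = inner ℂ q.1 p.2
    rw [← inner_conj_symm, ← this, inner_conj_symm]
  rw [isSelfAdjoint_iff_graph ((dense_domain_toPMap C).mono
    (LinearPMap.le_closure (toPMap C)).1)]
  intro x y
  simp only [← SetLike.mem_coe, hgraph]
  refine ⟨fun h f g hfg => hsymm _ h _ hfg, fun h => ?_⟩
  -- Testing the adjoint relation on eigenvectors shows that the coefficients of y are c_n times
  -- those of x. The finite partial sums of the two expansions then lie in the graph and converge to
  -- (x, y).
  have hcoef : ∀ n, (inner ℂ (b n) y : ℂ) = (c n : ℂ) * inner ℂ (b n) x := by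
    intro n
    rw [hs, ← h _ _ (subset_closure (mem_graph_toPMap_toL2 C (s n))), hc, map_smul,
      inner_smul_left, Complex.conj_ofReal]
  have hx := b.hasSum_repr x
  have hy := b.hasSum_repr y
  refine mem_closure_of_tendsto (hx.prodMk hy) (Eventually.of_forall fun t => ?_)
  refine Submodule.sum_mem _ fun n _ => ?_
  rw [b.repr_apply_apply, b.repr_apply_apply, hcoef, mul_comm, mul_smul, ← Prod.smul_mk]
  refine Submodule.smul_mem _ _ ?_
  rw [hs, ← map_smul, ← hc]
  exact mem_graph_toPMap_toL2 C (s n)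

theorem isSelfAdjoint_closure_h (ν : ℝ) : IsSelfAdjoint (toPMap (h ν)).closure :=
  isSelfAdjoint_closure_toPMap (inner_h ν) eBasis eS (fun n => by rw [eBasis_apply, e_eq]) _
    (h_eS ν)

end Swanson

end

/-! ### The main theorem -/

open Swanson in
theorem mainTheorem4 (ν θ : ℝ) (hν : ν ∈ Swanson.nuRange) (N₁ N₂ : ℂ)
    (hN : star N₁ * N₂ = Complex.exp (-2 * Complex.I * ν) / Real.pi) :
    -- the norms diverge, and the families are not Riesz bases and not even bases
    (ν ≠ 0 →
      Tendsto (fun n => ‖Swanson.phi ν hν θ N₁ n‖) cofinite atTop ∧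
      Tendsto (fun n => ‖Swanson.Psi ν hν θ N₂ n‖) cofinite atTop ∧
      ¬ Swanson.IsRieszBasis (Swanson.phi ν hν θ N₁) ∧
      ¬ Swanson.IsRieszBasis (Swanson.Psi ν hν θ N₂) ∧
      ∀ σ : ℕ ≃ ℕ × ℕ,
        ¬ Swanson.IsSchauderBasis σ (Swanson.phi ν hν θ N₁) ∧
        ¬ Swanson.IsSchauderBasis σ (Swanson.Psi ν hν θ N₂)) ∧
    -- the oscillator vectors are an orthonormal basis, and the families are quasi-bases
    Orthonormal ℂ Swanson.e ∧
    Swanson.IsQuasiBases (Swanson.phi ν hν θ N₁) (Swanson.Psi ν hν θ N₂) Swanson.De ∧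
    -- the operators used to build `Ψ` are the adjoints of the `A_j`
    (∀ j, Swanson.toPMap (Swanson.Adag ν θ j) ≤ (Swanson.toPMap (Swanson.A ν θ j)).adjoint) ∧
    -- `G` generates the group of dilations of which `T_ν = e^{iνG}` is the continuation
    (∀ (u : 𝓢(Swanson.Plane, ℂ)) (F : ℝ → Swanson.L2),
      (∀ s, Swanson.IsDilate s (Swanson.toL2 u) (F s)) →
      HasDerivAt F (Swanson.toL2 (Swanson.dilationGenerator u)) 0) ∧
    -- `T_ν` is self-adjoint and invertible, and maps the oscillator basis to the families
    IsSelfAdjoint (Swanson.T ν) ∧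
    LinearMap.ker (Swanson.T ν).toFun = ⊥ ∧
    Dense ((Swanson.T ν).inverse.domain : Set Swanson.L2) ∧
    (∃ c : ℂ, c ≠ 0 ∧
      ∀ n, (Swanson.e n, c • Swanson.phi ν hν θ N₁ n) ∈ (Swanson.T ν).graph) ∧
    (∃ c : ℂ, c ≠ 0 ∧
      ∀ n, (Swanson.e n, c • Swanson.Psi ν hν θ N₂ n) ∈ (Swanson.T ν).inverse.adjoint.graph) ∧
    -- `T_ν` and its inverse are unbounded and not everywhere defined
    (ν ≠ 0 →
      ¬ Swanson.IsBddOp (Swanson.T ν) ∧ (Swanson.T ν).domain ≠ ⊤ ∧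
      ¬ Swanson.IsBddOp (Swanson.T ν).inverse ∧ (Swanson.T ν).inverse.domain ≠ ⊤) ∧
    -- `Θ` is a metric operator: self-adjoint, strictly positive, hence invertible, mapping `φ` to
    -- `Ψ` and intertwining `H` and `H†` on the dense span of the `φ`
    IsSelfAdjoint (Swanson.Theta ν N₁) ∧
    (∀ f : (Swanson.Theta ν N₁).domain, (f : Swanson.L2) ≠ 0 →
      0 < (inner ℂ (f : Swanson.L2) (Swanson.Theta ν N₁ f)).re) ∧
    LinearMap.ker (Swanson.Theta ν N₁).toFun = ⊥ ∧
    (ν ≠ 0 →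
      ¬ Swanson.IsBddOp (Swanson.Theta ν N₁) ∧ ¬ Swanson.IsBddOp (Swanson.Theta ν N₁).inverse) ∧
    (∀ n, (Swanson.phi ν hν θ N₁ n, Swanson.Psi ν hν θ N₂ n) ∈ (Swanson.Theta ν N₁).graph) ∧
    Dense (Submodule.span ℂ (Set.range (Swanson.phi ν hν θ N₁)) : Set Swanson.L2) ∧
    Swanson.AgreeOn
      (Swanson.pcomp (Swanson.Theta ν N₁) (Swanson.toPMap (Swanson.H ν θ)))
      (Swanson.pcomp (Swanson.toPMap (Swanson.H ν θ)).adjoint (Swanson.Theta ν N₁))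
      (Submodule.span ℂ (Set.range (Swanson.phi ν hν θ N₁))) ∧
    -- `A_j` and `B_j†` are `Θ`-conjugate: on the span of the `φ`, and on a dense subspace that all
    -- the operators leave stable
    (∀ j, Swanson.AreConjugate (Swanson.Theta ν N₁) (Swanson.toPMap (Swanson.A ν θ j))
      (Swanson.toPMap (Swanson.B ν θ j)).adjoint
      (Submodule.span ℂ (Set.range (Swanson.phi ν hν θ N₁)))) ∧
    (∃ G : Submodule ℂ Swanson.L2, Dense (G : Set Swanson.L2) ∧
      Swanson.LeavesStable (Swanson.Theta ν N₁) G ∧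
      Swanson.LeavesStable (Swanson.Theta ν N₁).inverse G ∧
      ∀ j, Swanson.LeavesStable (Swanson.toPMap (Swanson.A ν θ j)) G ∧
        Swanson.LeavesStable (Swanson.toPMap (Swanson.B ν θ j)) G ∧
        Swanson.LeavesStable (Swanson.toPMap (Swanson.A ν θ j)).adjoint G ∧
        Swanson.LeavesStable (Swanson.toPMap (Swanson.B ν θ j)).adjoint G ∧
        Swanson.AreConjugate (Swanson.Theta ν N₁) (Swanson.toPMap (Swanson.A ν θ j))
          (Swanson.toPMap (Swanson.B ν θ j)).adjoint G) ∧
    -- `H` is similar to the (essentially) self-adjoint oscillator Hamiltonian: `h = T⁻¹ H T`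
    IsSelfAdjoint (Swanson.toPMap (Swanson.h ν)).closure ∧
    Swanson.AgreeOn (Swanson.toPMap (Swanson.h ν))
      (Swanson.pcomp (Swanson.T ν).inverse
        (Swanson.pcomp (Swanson.toPMap (Swanson.H ν θ)) (Swanson.T ν)))
      Swanson.De := by
  -- The normalisation forces both N₁ and N₂ to be nonzero.
  have hprod : star N₁ * N₂ ≠ 0 := by
    rw [hN]
    exact div_ne_zero (Complex.exp_ne_zero _) (Complex.ofReal_ne_zero.2 Real.pi_pos.ne')
  have hN₁ : N₁ ≠ 0 := star_ne_zero.1 (left_ne_zero_of_mul hprod)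
  have hN₂ : N₂ ≠ 0 := right_ne_zero_of_mul hprod
  have hπ : ((Real.sqrt Real.pi : ℝ) : ℂ) ≠ 0 :=
    Complex.ofReal_ne_zero.2 (Real.sqrt_pos.2 Real.pi_pos).ne'
  have hquasi := isQuasiBases_phi_Psi hν θ hN
  have hbi : ∀ m n, inner ℂ (Psi ν hν θ N₂ m) (phi ν hν θ N₁ n) =
      if m = n then (1 : ℂ) else 0 := fun m n => by
    rw [← inner_conj_symm, hquasi.1, apply_ite (starRingEnd ℂ), map_one, map_zero]
    simp only [eq_comm]
  have hphi : ν ≠ 0 → Tendsto (fun n => ‖phi ν hν θ N₁ n‖) cofinite atTop :=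
    fun h0 => tendsto_norm_phi hν h0 θ hN₁
  have hPsi : ν ≠ 0 → Tendsto (fun n => ‖Psi ν hν θ N₂ n‖) cofinite atTop := fun h0 => by
    rw [Psi_eq_phi]
    exact tendsto_norm_phi _ (neg_ne_zero.2 h0) θ hN₂
  have hT : ν ≠ 0 → ¬ IsBddOp (T ν) := not_isBddOp_T hν
  have hT' : ν ≠ 0 → ¬ IsBddOp (T (-ν)) := fun h0 =>
    not_isBddOp_T (neg_mem_nuRange hν) (neg_ne_zero.2 h0)
  refine ⟨fun h0 => ⟨hphi h0, hPsi h0, not_isRieszBasis (hphi h0), not_isRieszBasis (hPsi h0),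
      fun σ => ⟨not_isSchauderBasis hbi (hphi h0) (hPsi h0) σ,
        not_isSchauderBasis hquasi.1 (hPsi h0) (hphi h0) σ⟩⟩,
    orthonormal_e, hquasi, fun j => ?_, fun u F hF => ?_, isSelfAdjoint_T ν, ker_T ν, ?_,
    ⟨(N₁ * Real.sqrt Real.pi * phase (-ν))⁻¹,
      inv_ne_zero (mul_ne_zero (mul_ne_zero hN₁ hπ) (phase_ne_zero _)), fun n => ?_⟩,
    ⟨(N₂ * Real.sqrt Real.pi * phase ν)⁻¹,
      inv_ne_zero (mul_ne_zero (mul_ne_zero hN₂ hπ) (phase_ne_zero _)), fun n => ?_⟩,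
    fun h0 => ⟨hT h0, fun h => hT h0 (isBddOp_T_of_domain h), ?_, ?_⟩,
    isSelfAdjoint_Theta ν hN₁, Theta_pos ν hN₁, ker_Theta ν hN₁,
    fun h0 => ⟨fun h => hT' h0 (isBddOp_of_isBddOp_Theta hN₁ h),
      fun h => hT h0 (isBddOp_of_isBddOp_Theta_inverse hN₁ h)⟩,
    Theta_phi hν θ hN hN₁, dense_span_ladder ν hν θ hN₁, fun f hf => ?_, fun j f hf => ?_,
    ⟨fiber averageModule 0, dense_fiber_averageModule 0, leavesStable_Theta ν N₁ 0,
      leavesStable_Theta_inverse ν hN₁ 0, fun j => ⟨leavesStable_A ν θ 0 j,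
        leavesStable_B ν θ 0 j, leavesStable_adjoint_A ν θ 0 j, leavesStable_adjoint_B ν θ 0 j,
        ?_⟩⟩,
    isSelfAdjoint_closure_h ν, fun f hf => ?_⟩
  · rw [Adag_eq]
    exact toPMap_le_adjoint (inner_A ν θ j)
  · have : F = fun s => dil s (toL2 u) := funext fun s => isDilate_iff.1 (hF s)
    rw [this]
    exact hasDerivAt_dil_zero u
  · rw [inverse_T]
    exact dense_domain_T (-ν)
  · rw [phi_eq, inv_smul_smul₀ (mul_ne_zero (mul_ne_zero hN₁ hπ) (phase_ne_zero _))]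
    exact mem_graph_T_e n hν
  · rw [Psi_eq, inv_smul_smul₀ (mul_ne_zero (mul_ne_zero hN₂ hπ) (phase_ne_zero _)),
      adjoint_inverse_T]
    exact mem_graph_T_e n (neg_mem_nuRange hν)
  · rw [inverse_T]
    exact hT' h0
  · rw [inverse_T]
    exact fun h => hT' h0 (isBddOp_T_of_domain h)
  · exact isDilationModule_gaussModule.intertwines_H hν (neg_mem_nuRange hν) N₁ θ f
      (span_phi_le_fiber ν hν θ N₁ hf)
  · exact isDilationModule_gaussModule.areConjugate hν (neg_mem_nuRange hν) hN₁ θ j f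
      (span_phi_le_fiber ν hν θ N₁ hf)
  -- The stable subspace is also the space of values at ν, where the conjugation relation is
  -- available.
  · rw [fiber_averageModule 0 ν]
    exact isDilationModule_averageModule.areConjugate trivial trivial hN₁ θ j
  · exact isDilationModule_gaussModule.similar_h hν θ f (De_le_fiber hf)
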